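/- Let $\tau^u,\tau^d$ be independent random variables with values in $\{1,2,3,\dots\}$ (the lengths of a rise and of a descent of the persistent random walk). For a random variable $X$ put $\mathcal T_X(t)=\mathbb P(|X|>t)$ and $V_X(t)=\mathbb E[X^2\mathbf 1_{\{|X|\le t\}}]$; write $\mathcal T_u,\mathcal T_d,V_u,V_d$ for $X=\tau^u,\tau^d$, and $\mathcal T=\mathcal T_u+\mathcal T_d$, $V=V_u+V_d$. Let $$b=\lim_{t\to\infty}\frac{\mathcal T_u(t)-\mathcal T_d(t)}{\mathcal T_u(t)+\mathcal T_d(t)}$$ when this limit exists. The mean drift $m$ is $b$ (whose existence is then required) if neither $\tau^u$ nor $\tau^d$ is integrable, $\frac{\mathbb E[\tau^u]-\mathbb E[\tau^d]}{\mathbb E[\tau^u]+\mathbb E[\tau^d]}$ if both are integrable, $+1$ if only $\tau^d$ is integrable, and $-1$ if only $\tau^u$ is integrable. Suppose that $m$ exists and $m\in(-1,1)$, and let $\tau^c=(1-m)\tau^u-(1+m)\tau^d$, $\mathcal T_c=\mathcal T_{\tau^c}$, $V_c=V_{\tau^c}$. Write $X\in D(\alpha)$ if $X$ belongs to the domain of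 attraction of a non-degenerate $\alpha$-stable law, and $\mathrm{RV}(\rho)$ for the functions regularly varying at infinity with index $\rho$. (1) For every $\alpha\in(0,2)$ the following are equivalent: (i) $\tau^c\in D(\alpha)$; (ii) $\tau^u-\tau^d\in D(\alpha)$; (iii) $V\in \mathrm{RV}(2-\alpha)$ and $b$ exists; (iv) $\mathcal T\in \mathrm{RV}(-\alpha)$ and $b$ exists. In that case, as $t\to\infty$, the tails $\mathbb P(|\tau^u-\tau^d|>t)$ and $\mathbb P(\tau^u+\tau^d>t)$ are asymptotically equivalent to $\mathcal T(t)$, the truncated second moments of $\tau^u-\tau^d$ and of $\tau^u+\tau^d$ are asymptotically equivalent to $V(t)$, and with $\kappa=(1-m)^\alpha\frac{1+b}{2}+(1+m)^\alpha\frac{1-b}{2}$ one has $\mathcal T_c(t)\sim\kappa\,\mathcal T(t)$ and $V_c(t)\sim\kappa\,V(t)$. Moreover $$\lim_{t\to\infty}\frac{\mathbb P(\tau^c>t)-\mathbb P(\tau^c<-t)}{\mathbb P(\tau^c>t)+\mathbb P(\tau^c<-t)}=\frac{(1-m)^\alpha(1+b)-(1+m)^\alpha(1-b)}{(1-m)^\alpha(1+b)+(1+m)^\alpha(1-b)}.$$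 (2) If $\tau^c\in D(2)$, then as $t\to\infty$ $$\mathbb V[\tau^c\mathbf 1_{\{|\tau^c|\le t\}}]\sim V_c(t)\sim\Sigma(t)^2,$$ where $\Sigma(t)^2=(1-m)^2\,\mathbb V\big[\tau^u\mathbf 1_{\{\tau^u\le t/(1-m)\}}\big]+(1+m)^2\,\mathbb V\big[\tau^d\mathbf 1_{\{\tau^d\le t/(1+m)\}}\big]$ and $\mathbb V$ is the variance. If in addition $\tau^u$ or $\tau^d$ has infinite second moment, then also $$V_c(t)\sim(1-m)^2\,V_u\Big(\frac{t}{1-m}\Big)+(1+m)^2\,V_d\Big(\frac{t}{1+m}\Big).$$ -/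

import Mathlib

open Filter Topology MeasureTheory ProbabilityTheory Asymptotics

namespace PRW

/-- `f` is regularly varying at infinity with index `ρ`. -/
def RegVar (f : ℝ → ℝ) (ρ : ℝ) : Prop :=
  Measurable f ∧ (∀ᶠ t in atTop, 0 < f t) ∧
    ∀ c : ℝ, 0 < c → Tendsto (fun t => f (c * t) / f t) atTop (𝓝 (c ^ ρ))

/-- The logarithm of the characteristic function of the `α`-stable law with scale `σ`,
skewness `β` and location `δ`. -/
noncomputable def stableExponent (α σ β δ t : ℝ) : ℂ :=
  if α = 1 then
    -((σ * |t| : ℝ) : ℂ) * (1 + Complex.I * ((β * (2 / Real.pi) * Real.sign t * Real.log |t| : ℝ) : ℂ))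
      + Complex.I * ((δ * t : ℝ) : ℂ)
  else
    -((((σ * |t|) ^ α : ℝ)) : ℂ) * (1 - Complex.I * ((β * Real.sign t * Real.tan (Real.pi * α / 2) : ℝ) : ℂ))
      + Complex.I * ((δ * t : ℝ) : ℂ)

/-- `ρ` is a non-degenerate `α`-stable law on the real line. -/
def IsStableLaw (α : ℝ) (ρ : Measure ℝ) : Prop :=
  ∃ σ β δ : ℝ, 0 < σ ∧ β ∈ Set.Icc (-1 : ℝ) 1 ∧
    ∀ t : ℝ, charFun ρ t = Complex.exp (stableExponent α σ β δ t)

/-- The random variable `X` belongs to the domain of attraction of a non-degenerate `α`-stable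
law: sums of `n` independent copies of `X` (realised on the `n`-fold product of the probability
space), suitably centred and scaled, converge in distribution to such a law. -/
def InDomainOfAttraction {Ω : Type*} [MeasurableSpace Ω] (P : Measure Ω) [IsProbabilityMeasure P]
    (X : Ω → ℝ) (α : ℝ) : Prop :=
  ∃ (ρ : Measure ℝ) (_ : IsProbabilityMeasure ρ) (a c : ℕ → ℝ),
    IsStableLaw α ρ ∧ (∀ n, 0 < a n) ∧
      TendstoInDistribution
        (fun (n : ℕ) (ω : Fin n → Ω) => ((∑ i, X (ω i)) - c n) / a n) atTop (id : ℝ → ℝ)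
        (fun n => Measure.pi (fun _ : Fin n => P)) ρ

section Truncation

variable {Ω : Type*} [MeasurableSpace Ω]

/-- The two-sided tail `t ↦ P(|X| > t)`. -/
noncomputable def tail (P : Measure Ω) (X : Ω → ℝ) (t : ℝ) : ℝ :=
  P.real {ω | t < |X ω|}

/-- The truncated second moment `t ↦ E[X² 1_{|X| ≤ t}]`. -/
noncomputable def truncSecondMoment (P : Measure Ω) (X : Ω → ℝ) (t : ℝ) : ℝ :=
  ∫ ω, {ω | |X ω| ≤ t}.indicator (fun ω => X ω ^ 2) ω ∂P

/-- The truncated variance `t ↦ Var[X 1_{|X| ≤ t}]`. -/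
noncomputable def truncVariance (P : Measure Ω) (X : Ω → ℝ) (t : ℝ) : ℝ :=
  variance ({ω | |X ω| ≤ t}.indicator X) P

/-- The relative difference of the upper and the lower tail of `X`. -/
noncomputable def tailBalance (P : Measure Ω) (X : Ω → ℝ) (t : ℝ) : ℝ :=
  (P.real {ω | t < X ω} - P.real {ω | X ω < -t}) /
    (P.real {ω | t < X ω} + P.real {ω | X ω < -t})

/-- `b` is the tail balance parameter of the two nonnegative variables `U` and `D`:
the limit of the relative difference of their tails exists and equals `b`. -/
def IsTailBalance (P : Measure Ω) (U D : Ω → ℝ) (b : ℝ) : Prop :=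
  Tendsto (fun t => (tail P U t - tail P D t) / (tail P U t + tail P D t)) atTop (𝓝 b)

/-- `m` is the mean drift associated with the rise length `U` and the descent length `D`: the
tail balance parameter (required to exist) if neither is integrable, the almost sure drift
otherwise, which is `±1` by convention if exactly one of them is integrable. -/
def IsMeanDrift (P : Measure Ω) (U D : Ω → ℝ) (m : ℝ) : Prop :=
  (¬ Integrable U P ∧ ¬ Integrable D P ∧ IsTailBalance P U D m) ∨
  (Integrable U P ∧ Integrable D P ∧
    m = ((∫ ω, U ω ∂P) - ∫ ω, D ω ∂P) / ((∫ ω, U ω ∂P) + ∫ ω, D ω ∂P)) ∨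
  (¬ Integrable U P ∧ Integrable D P ∧ m = 1) ∨
  (Integrable U P ∧ ¬ Integrable D P ∧ m = -1)

/-- The central variable `(1 - m) U - (1 + m) D`. -/
def central (m : ℝ) (U D : Ω → ℝ) : Ω → ℝ := fun ω => (1 - m) * U ω - (1 + m) * D ω

/-- The sum of the tails of `U` and `D`. -/
noncomputable def sumTail (P : Measure Ω) (U D : Ω → ℝ) (t : ℝ) : ℝ := tail P U t + tail P D t

/-- The sum of the truncated second moments of `U` and `D`. -/
noncomputable def sumTruncSecondMoment (P : Measure Ω) (U D : Ω → ℝ) (t : ℝ) : ℝ :=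
  truncSecondMoment P U t + truncSecondMoment P D t

/-- `Σ(t)²`: the weighted sum of the truncated variances of `U` and `D`. -/
noncomputable def sigmaSq (P : Measure Ω) (m : ℝ) (U D : Ω → ℝ) (t : ℝ) : ℝ :=
  (1 - m) ^ 2 * truncVariance P U (t / (1 - m)) + (1 + m) ^ 2 * truncVariance P D (t / (1 + m))

/-- The weighted sum of the truncated second moments of `U` and `D`. -/
noncomputable def sigmaSqRaw (P : Measure Ω) (m : ℝ) (U D : Ω → ℝ) (t : ℝ) : ℝ :=
  (1 - m) ^ 2 * truncSecondMoment P U (t / (1 - m)) +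
    (1 + m) ^ 2 * truncSecondMoment P D (t / (1 + m))

end Truncation

end PRW

/-!
Write `X = A U - B D` with positive weights `A`, `B`; the central variable and `U - D` are of this
form. The statement rests on two facts about a law `μ` on the line.

* For `α < 2`, `μ` is attracted to an `α`-stable law if and only if its two-sided tail is regularly
  varying of index `-α` and the shares of its upper and lower tails converge
  (`inDomainOfAttraction_iff`).
* If `μ` has no second moment and is attracted to a normal law, then `t² μ(|x| > t)` is negligible
  with respect to the truncated second moment (`tendsto_sq_mul_absTail_div`).

Sufficiency in the first fact (`exists_tendsto_charFun_of_regVar`): with `n T(a n) → 1`, the measures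
`n μ(a n ·)` converge away from the origin to a power measure, and Karamata's theorem controls them
near the origin, so that `n E[e^{itX/a n} - 1 - it sin (X / a n)]` converges to the integral of
the same kernel against `x^(-α-1) dx`. That integral is identified with the explicit stable exponent
by solving `K'' = Γ(2-α) s^(α-2)` in the right half plane and passing to the imaginary axis
(`exists_levyExponent_eq_stableExponent`).

Necessity (`regVar_of_tendsto_charFun`): symmetrization removes the centring, and Baire's theorem
turns the pointwise convergence of `n (1 - |φ(t / a n)|²)` into a bound on `n E[min(1, (X / a n)²)]`.
This allows `φ(t / a n)^n` to be replaced by `exp (n (φ(t / a n) - 1))`. Second differences in `t`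
remove the centring again and are small for small steps, so the exponentials can be inverted; averaged
over the step they are Fourier transforms of finite measures with density `1 - sinc`, and Lévy's
continuity theorem gives convergence of `n μ(a n ·)` to the Lévy measure of the limit
(`tendsto_integral_levyMeasure`). Choosing `n` of order `1 / T(t)` yields regular variation. For
`α = 2` there is no Lévy measure, and the same choice gives the second fact.

For independent nonnegative `U` and `D`, conditioning on the other variable shows that the upper and
lower tails of `U - D` are those of `U` and `D` up to a bounded shift and a factor close to one
(`isDifferenceTails`). A shift is invisible to monotone regularly varying functions, hence `X` satisfies the tail criterion if and only
if `A U` and `B D` do, and this does not depend on the weights (`inDomainOfAttraction_sub_iff`).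
Karamata's theorem translates between tails and truncated second moments (`IsTailMoment.regVar_iff`).

In the normal case with infinite variance, truncating `X` at `t` or truncating both variables at `t`
changes the second moment by at most `t²` times the tails, which is negligible, and squared truncated
means are negligible too. With finite variance all the functions converge to the variance of `X`,
because the mean drift makes `X` centred (`attraction_two`).
-/

namespace PRW

/-! ### Monotone regular variation and Karamata's theorem -/

theorem exists_pow_mul_of_le {l t₀ t : ℝ} (hl : 1 < l) (h0 : 0 < t₀) (ht : t₀ ≤ t) :
    ∃ n : ℕ, ∃ s, t₀ ≤ s ∧ s < l * t₀ ∧ t = l ^ n * s := by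
  obtain ⟨n, h1, h2⟩ := exists_nat_pow_near ((one_le_div h0).2 ht) hl
  have hln : 0 < l ^ n := by positivity
  refine ⟨n, t / l ^ n, ?_, ?_, by field_simp⟩
  · rw [le_div_iff₀ hln]; rwa [le_div_iff₀ h0, mul_comm] at h1
  · rw [div_lt_iff₀ hln]; rw [div_lt_iff₀ h0, pow_succ] at h2; linarith

theorem le_mul_pow {l t₀ s : ℝ} (hl : 1 < l) (h0 : 0 < t₀) (hs : t₀ ≤ s) (n : ℕ) :
    t₀ ≤ l ^ n * s :=
  hs.trans (le_mul_of_one_le_left (h0.le.trans hs) (one_le_pow₀ hl.le))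

/-- Growing case of a discrete l'Hôpital rule: a function that does not increase along
`t ↦ l t` is bounded by its supremum on one period. -/
theorem le_of_forall_mul_le {k : ℝ → ℝ} {l t₀ M : ℝ} (hl : 1 < l) (h0 : 0 < t₀)
    (hk : ∀ t, t₀ ≤ t → k (l * t) ≤ k t) (hM : ∀ t, t₀ ≤ t → t < l * t₀ → k t ≤ M) :
    ∀ t, t₀ ≤ t → k t ≤ M := by
  intro t ht
  obtain ⟨n, s, hs1, hs2, rfl⟩ := exists_pow_mul_of_le hl h0 ht
  have : ∀ n : ℕ, k (l ^ n * s) ≤ M := by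
    intro n
    induction n with
    | zero => simpa using hM s hs1 hs2
    | succ n ih =>
      have := hk _ (le_mul_pow hl h0 hs1 n)
      rw [pow_succ', mul_assoc]; exact this.trans ih
  exact this n

/-- Decaying case of a discrete l'Hôpital rule: a function that does not increase along
`t ↦ l t` and vanishes in the limit along these progressions is nonnegative. -/
theorem nonneg_of_forall_mul_le {k : ℝ → ℝ} {l t₀ : ℝ} (hl : 1 < l) (h0 : 0 < t₀)
    (hk : ∀ t, t₀ ≤ t → k (l * t) ≤ k t)
    (hlim : ∀ t, t₀ ≤ t → Tendsto (fun n : ℕ => k (l ^ n * t)) atTop (𝓝 0)) :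
    ∀ t, t₀ ≤ t → 0 ≤ k t := by
  intro t ht
  refine le_of_tendsto (hlim t ht) (.of_forall fun n => ?_)
  induction n with
  | zero => simp
  | succ n ih =>
    have := hk _ (le_mul_pow hl h0 ht n)
    rw [pow_succ', mul_assoc]; exact this.trans ih

/-- The relation between the two-sided tail `T` and the truncated second moment `V` of a
measure that the Karamata theory below uses. -/
structure IsTailMoment (T V : ℝ → ℝ) : Prop where
  tail_nonneg : ∀ t, 0 ≤ T t
  tail_anti : Antitone T
  tail_lim : Tendsto T atTop (𝓝 0)
  moment_nonneg : ∀ t, 0 ≤ V t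
  moment_mono : Monotone V
  lower : ∀ s t, 0 < s → s ≤ t → s ^ 2 * (T s - T t) ≤ V t - V s
  upper : ∀ s t, 0 < s → s ≤ t → V t - V s ≤ t ^ 2 * (T s - T t)

/-- A function vanishing at `1` with positive derivative there is positive at some point to
the right of `1`. -/
theorem exists_one_lt_pos {F : ℝ → ℝ} {d : ℝ} (hF : HasDerivAt F d 1) (h1 : F 1 = 0)
    (hd : 0 < d) : ∃ l, 1 < l ∧ 0 < F l := by
  have h := hF.tendsto_slope
  have h2 : ∀ᶠ x in 𝓝[>] (1 : ℝ), 0 < slope F 1 x :=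
    (h.mono_left (nhdsWithin_mono _ fun x (hx : 1 < x) => ne_of_gt hx)).eventually_const_lt hd
  obtain ⟨x, hx, hx1⟩ := (h2.and self_mem_nhdsWithin).exists
  have hx1 : 1 < x := hx1
  refine ⟨x, hx1, ?_⟩
  rw [slope_def_field, h1, sub_zero] at hx
  have h3 : 0 < x - 1 := sub_pos.2 hx1
  exact (div_pos_iff_of_pos_right h3).1 hx

theorem RegVar.eventually_pos {f : ℝ → ℝ} {ρ : ℝ} (h : RegVar f ρ) : ∀ᶠ t in atTop, 0 < f t := h.2.1

/-- `t² f(t)` is regularly varying of index `ρ + 2`. -/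
theorem RegVar.tendsto_sq_mul {f : ℝ → ℝ} {ρ : ℝ} (h : RegVar f ρ) {l : ℝ} (hl : 0 < l) :
    Tendsto (fun t => ((l * t) ^ 2 * f (l * t)) / (t ^ 2 * f t)) atTop (𝓝 (l ^ (ρ + 2))) := by
  have h1 := (h.2.2 l hl).const_mul (l ^ 2)
  have : l ^ (ρ + 2) = l ^ 2 * l ^ ρ := by
    rw [Real.rpow_add hl, mul_comm]; norm_num
  rw [this]
  refine h1.congr' ?_
  filter_upwards [eventually_gt_atTop 0, h.eventually_pos] with t ht hf
  field_simp

/-- A regularly varying function of positive index diverges. Monotonicity of `f` replaces the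
uniform convergence theorem in passing from geometric progressions to all arguments. -/
theorem tendsto_sq_mul_atTop {f : ℝ → ℝ} {ρ : ℝ} (h : RegVar f ρ) (hf : Antitone f)
    (hρ : -2 < ρ) : Tendsto (fun t => t ^ 2 * f t) atTop atTop := by
  have hr : (1 : ℝ) < 2 ^ (ρ + 2) := Real.one_lt_rpow (by norm_num) (by linarith)
  obtain ⟨r, hr1, hr2⟩ := exists_between hr
  have h1 := (h.tendsto_sq_mul (l := 2) two_pos).eventually_const_lt hr2
  obtain ⟨t₀, ht₀⟩ := eventually_atTop.1 ((h1.and h.eventually_pos).and (eventually_gt_atTop 0))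
  have h0 : 0 < t₀ := (ht₀ t₀ le_rfl).2
  have hstep : ∀ t, t₀ ≤ t → r * (t ^ 2 * f t) ≤ (2 * t) ^ 2 * f (2 * t) := by
    intro t ht
    obtain ⟨⟨a, b⟩, c⟩ := ht₀ t ht
    have : 0 < t ^ 2 * f t := by positivity
    exact ((lt_div_iff₀ this).1 a).le
  set m := t₀ ^ 2 * f (2 * t₀) with hm
  have hmpos : 0 < m := by
    have := (ht₀ (2 * t₀) (by linarith)).1.2
    positivity
  have hlow : ∀ n : ℕ, ∀ s, t₀ ≤ s → s < 2 * t₀ → r ^ n * m ≤ (2 ^ n * s) ^ 2 * f (2 ^ n * s) := by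
    intro n s hs1 hs2
    induction n with
    | zero =>
      simp only [pow_zero, one_mul]
      have h3 : f (2 * t₀) ≤ f s := hf hs2.le
      have := (ht₀ (2 * t₀) (by linarith)).1.2
      rw [hm]; gcongr
    | succ n ih =>
      have := hstep _ (le_mul_pow one_lt_two h0 hs1 n)
      rw [pow_succ' 2, mul_assoc 2, pow_succ', mul_assoc]
      exact (mul_le_mul_of_nonneg_left ih (by linarith)).trans this
  refine tendsto_atTop.2 fun B => ?_
  obtain ⟨N, hN⟩ := pow_unbounded_of_one_lt (B / m) hr1
  filter_upwards [eventually_ge_atTop (2 ^ (N + 1) * t₀)] with t ht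
  have htt : t₀ ≤ t := le_trans (by
    have : (1 : ℝ) ≤ 2 ^ (N + 1) := one_le_pow₀ (by norm_num)
    nlinarith) ht
  obtain ⟨n, s, hs1, hs2, rfl⟩ := exists_pow_mul_of_le one_lt_two h0 htt
  have hn : N ≤ n := by
    by_contra hcon
    have h4 : n + 1 ≤ N := by omega
    have h5 : (2 : ℝ) ^ n * s < 2 ^ n * (2 * t₀) := by gcongr
    have h6 : (2 : ℝ) ^ (n + 1) ≤ 2 ^ (N + 1) := pow_le_pow_right₀ (by norm_num) (by omega)
    rw [pow_succ] at h6
    nlinarith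
  calc B ≤ r ^ N * m := by rw [div_lt_iff₀ hmpos] at hN; exact hN.le
    _ ≤ r ^ n * m := by gcongr; exact hr1.le
    _ ≤ _ := hlow n s hs1 hs2

theorem tendsto_div_of_forall_bounds {f g : ℝ → ℝ} {L : ℝ}
    (hup : ∀ C, L < C → ∀ᶠ t in atTop, f t ≤ C * g t)
    (hlow : ∀ C, C < L → ∀ᶠ t in atTop, C * g t ≤ f t) (hg : ∀ᶠ t in atTop, 0 < g t) :
    Tendsto (fun t => f t / g t) atTop (𝓝 L) := by
  refine tendsto_order.2 ⟨fun C hC => ?_, fun C hC => ?_⟩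
  · obtain ⟨D, h1, h2⟩ := exists_between hC
    filter_upwards [hlow D h2, hg] with t a b
    rw [lt_div_iff₀ b]; nlinarith
  · obtain ⟨D, h1, h2⟩ := exists_between hC
    filter_upwards [hup D h1, hg] with t a b
    rw [div_lt_iff₀ b]; nlinarith

theorem hasDerivAt_rpow_one (p : ℝ) : HasDerivAt (fun x : ℝ => x ^ p) p 1 := by
  simpa using Real.hasDerivAt_rpow_const (x := 1) (p := p) (Or.inl one_ne_zero)

/-- Karamata's theorem, from the tail to the truncated second moment. Increments of `V` over
`[t, l t]` are compared with those of `t² T t`, by means of `IsTailMoment.lower` and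
`IsTailMoment.upper`; these bounds are sharp as `l → 1`, which is why only derivatives at `l = 1`
are compared and no integral is needed. -/
theorem IsTailMoment.karamata_direct {T V : ℝ → ℝ} (h : IsTailMoment T V) {α : ℝ} (h0 : 0 < α)
    (h2 : α < 2) (hT : RegVar T (-α)) :
    Tendsto (fun t => V t / (t ^ 2 * T t)) atTop (𝓝 (α / (2 - α))) := by
  have hwlim := tendsto_sq_mul_atTop hT h.tail_anti (by linarith)
  have hpos : ∀ᶠ t in atTop, 0 < t ^ 2 * T t := hwlim.eventually_gt_atTop 0
  have h2a : 0 < 2 - α := by linarith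
  -- `k` is `V - C w` or `C w - V`, with `w t = t² T t`
  have key : ∀ (k : ℝ → ℝ) (l : ℝ), 1 < l → (∀ᶠ t in atTop, k (l * t) ≤ k t) →
      (∀ t₀, 0 < t₀ → ∃ M, ∀ t, t₀ ≤ t → t < l * t₀ → k t ≤ M) →
      ∃ M, ∀ᶠ t in atTop, k t ≤ M := by
    intro k l hl hk hb
    obtain ⟨t₀, ht₀⟩ := eventually_atTop.1 (hk.and (eventually_gt_atTop 0))
    obtain ⟨M, hM⟩ := hb t₀ (ht₀ t₀ le_rfl).2
    exact ⟨M, eventually_atTop.2 ⟨t₀, le_of_forall_mul_le hl (ht₀ t₀ le_rfl).2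
      (fun t ht => (ht₀ t ht).1) hM⟩⟩
  refine tendsto_div_of_forall_bounds (fun C hC => ?_) (fun c hc => ?_) hpos
  · obtain ⟨C', hC1, hC2⟩ := exists_between hC
    -- a step `l > 1` along which `V - C' w` eventually decreases
    have hC'0 : 0 < C' := lt_trans (by positivity) hC1
    obtain ⟨l, hl, hF⟩ : ∃ l, 1 < l ∧
        0 < C' * (l ^ (2 - α) - 1) - (l ^ (2 : ℝ) - l ^ (2 - α)) := by
      refine exists_one_lt_pos (d := C' * (2 - α) - (2 - (2 - α))) ?_ (by simp) ?_
      · exact (((hasDerivAt_rpow_one _).sub_const 1).const_mul C').sub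
          ((hasDerivAt_rpow_one _).sub (hasDerivAt_rpow_one _))
      · rw [div_lt_iff₀ h2a] at hC1; linarith
    have hl0 : 0 < l := by linarith
    have e1 := hT.tendsto_sq_mul hl0
    have e2 := hT.2.2 l hl0
    have e3 : Tendsto (fun t => C' * (((l * t) ^ 2 * T (l * t)) / (t ^ 2 * T t) - 1)
        - l ^ 2 * (1 - T (l * t) / T t)) atTop
        (𝓝 (C' * (l ^ (-α + 2) - 1) - l ^ 2 * (1 - l ^ (-α)))) :=
      ((e1.sub_const 1).const_mul C').sub ((e2.const_sub 1).const_mul _)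
    have e4 : C' * (l ^ (-α + 2) - 1) - l ^ 2 * (1 - l ^ (-α))
        = C' * (l ^ (2 - α) - 1) - (l ^ (2 : ℝ) - l ^ (2 - α)) := by
      have : l ^ (2 - α) = l ^ 2 * l ^ (-α) := by
        rw [sub_eq_add_neg, Real.rpow_add hl0]; norm_num
      rw [neg_add_eq_sub, this]; norm_num; ring
    rw [e4] at e3
    obtain ⟨M, hM⟩ := key (fun t => V t - C' * (t ^ 2 * T t)) l hl (by
      filter_upwards [e3.eventually_const_lt hF, eventually_gt_atTop 0, hT.eventually_pos, hpos]
        with t a ht hTt hw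
      have hlt : t ≤ l * t := by nlinarith
      have b := h.upper t (l * t) ht hlt
      have a' := mul_pos a hw
      have : (C' * (((l * t) ^ 2 * T (l * t)) / (t ^ 2 * T t) - 1)
        - l ^ 2 * (1 - T (l * t) / T t)) * (t ^ 2 * T t) = C' * ((l * t) ^ 2 * T (l * t)
          - t ^ 2 * T t) - (l * t) ^ 2 * (T t - T (l * t)) := by field_simp
      rw [this] at a'
      linarith) (by
      intro t₀ ht₀
      refine ⟨V (l * t₀), fun t h1 h2 => ?_⟩
      have := h.moment_mono h2.le
      have := mul_nonneg hC'0.le (mul_nonneg (sq_nonneg t) (h.tail_nonneg t))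
      linarith)
    filter_upwards [hM, hwlim.eventually_ge_atTop (M / (C - C'))] with t a b
    rw [div_le_iff₀ (by linarith)] at b
    linarith
  · obtain ⟨c', hC1, hC2⟩ := exists_between (max_lt hc (show 0 < α / (2 - α) by positivity))
    obtain ⟨hC1, hc'0⟩ := max_lt_iff.1 hC1
    obtain ⟨l, hl, hF⟩ : ∃ l, 1 < l ∧ 0 < (1 - l ^ (-α)) - c' * (l ^ (2 - α) - 1) := by
      refine exists_one_lt_pos (d := (-(-α)) - c' * (2 - α)) ?_ (by simp) ?_
      · exact ((hasDerivAt_rpow_one _).const_sub 1).sub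
          (((hasDerivAt_rpow_one _).sub_const 1).const_mul c')
      · rw [lt_div_iff₀ h2a] at hC2; linarith
    have hl0 : 0 < l := by linarith
    have e1 := hT.tendsto_sq_mul hl0
    have e2 := hT.2.2 l hl0
    have e3 : Tendsto (fun t => (1 - T (l * t) / T t)
        - c' * (((l * t) ^ 2 * T (l * t)) / (t ^ 2 * T t) - 1)) atTop
        (𝓝 ((1 - l ^ (-α)) - c' * (l ^ (-α + 2) - 1))) :=
      (e2.const_sub 1).sub ((e1.sub_const 1).const_mul c')
    rw [neg_add_eq_sub] at e3
    obtain ⟨M, hM⟩ := key (fun t => c' * (t ^ 2 * T t) - V t) l hl (by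
      filter_upwards [e3.eventually_const_lt hF, eventually_gt_atTop 0, hT.eventually_pos, hpos]
        with t a ht hTt hw
      have hlt : t ≤ l * t := by nlinarith
      have b := h.lower t (l * t) ht hlt
      have a' := mul_pos a hw
      have : ((1 - T (l * t) / T t)
        - c' * (((l * t) ^ 2 * T (l * t)) / (t ^ 2 * T t) - 1)) * (t ^ 2 * T t)
          = t ^ 2 * (T t - T (l * t)) - c' * ((l * t) ^ 2 * T (l * t)
          - t ^ 2 * T t) := by field_simp
      rw [this] at a'
      linarith) (by
      intro t₀ ht₀
      refine ⟨c' * ((l * t₀) ^ 2 * T t₀), fun t h1 h2 => ?_⟩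
      have h3 := h.moment_nonneg t
      have h4 := h.tail_anti h1
      have h5 := h.tail_nonneg t
      have h6 := ht₀.le.trans h1
      have : t ^ 2 * T t ≤ (l * t₀) ^ 2 * T t₀ := by gcongr
      have := mul_le_mul_of_nonneg_left this hc'0.le
      linarith)
    filter_upwards [hM, hwlim.eventually_ge_atTop (M / (c' - c))] with t a b
    rw [div_le_iff₀ (by linarith)] at b
    linarith

/-- Karamata's theorem, from the truncated second moment to the tail. -/
theorem IsTailMoment.karamata_converse {T V : ℝ → ℝ} (h : IsTailMoment T V) {α : ℝ} (h0 : 0 < α)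
    (h2 : α < 2) (hV : RegVar V (2 - α)) :
    Tendsto (fun t => (t ^ 2 * T t) / V t) atTop (𝓝 ((2 - α) / α)) := by
  have h2a : 0 < 2 - α := by linarith
  -- `v t = V t / t²` decays geometrically along every geometric progression
  have hv : ∀ l, 1 < l → Tendsto (fun t => (V (l * t) / (l * t) ^ 2) / (V t / t ^ 2)) atTop
      (𝓝 (l ^ (-α))) := by
    intro l hl
    have hl0 : 0 < l := by linarith
    have := (hV.2.2 l hl0).const_mul ((l ^ 2)⁻¹)
    have e : l ^ (-α) = (l ^ 2)⁻¹ * l ^ (2 - α) := by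
      rw [sub_eq_add_neg, Real.rpow_add hl0]; norm_num
      field_simp
    rw [e]
    refine this.congr' ?_
    filter_upwards [eventually_gt_atTop 0] with t ht
    field_simp
  have key : ∀ (A B : ℝ) (l : ℝ), 1 < l →
      (∀ᶠ t in atTop, A * T (l * t) + B * (V (l * t) / (l * t) ^ 2) ≤ A * T t + B * (V t / t ^ 2)) →
      ∀ᶠ t in atTop, 0 ≤ A * T t + B * (V t / t ^ 2) := by
    intro A B l hl hk
    have hl0 : 0 < l := by linarith
    obtain ⟨r, hr1, hr2⟩ := exists_between
      (show l ^ (-α) < 1 from Real.rpow_lt_one_of_one_lt_of_neg hl (by linarith))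
    have hr0 : 0 < r := lt_trans (by positivity) hr1
    obtain ⟨t₀, ht₀⟩ := eventually_atTop.1 ((hk.and (eventually_gt_atTop 0)).and
      (((hv l hl).eventually_lt_const hr1).and hV.eventually_pos))
    have ht0 : 0 < t₀ := (ht₀ t₀ le_rfl).1.2
    refine eventually_atTop.2 ⟨t₀, nonneg_of_forall_mul_le hl ht0
      (fun t ht => (ht₀ t ht).1.1) fun t ht => ?_⟩
    have htpos : 0 < t := ht0.trans_le ht
    have hgeo : Tendsto (fun n : ℕ => l ^ n * t) atTop atTop :=
      (tendsto_pow_atTop_atTop_of_one_lt hl).atTop_mul_const htpos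
    have hT0 : Tendsto (fun n : ℕ => T (l ^ n * t)) atTop (𝓝 0) := h.tail_lim.comp hgeo
    have hv0 : Tendsto (fun n : ℕ => V (l ^ n * t) / (l ^ n * t) ^ 2) atTop (𝓝 0) := by
      have hb : ∀ n : ℕ, V (l ^ n * t) / (l ^ n * t) ^ 2 ≤ r ^ n * (V t / t ^ 2) := by
        intro n
        induction n with
        | zero => simp
        | succ n ih =>
          have hle := le_mul_pow hl ht0 ht n
          obtain ⟨-, a, b⟩ := ht₀ _ hle
          have hp : 0 < l ^ n * t := by positivity
          rw [div_lt_iff₀ (by positivity)] at a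
          rw [pow_succ' l, mul_assoc l, pow_succ' r, mul_assoc r]
          exact a.le.trans (mul_le_mul_of_nonneg_left ih hr0.le)
      refine squeeze_zero (fun n => div_nonneg (h.moment_nonneg _) (sq_nonneg _)) hb ?_
      simpa using (tendsto_pow_atTop_nhds_zero_of_lt_one hr0.le hr2).mul_const (V t / t ^ 2)
    simpa using (hT0.const_mul A).add (hv0.const_mul B)
  refine tendsto_div_of_forall_bounds (fun C hC => ?_) (fun c hc => ?_) hV.eventually_pos
  · obtain ⟨l, hl, hF⟩ : ∃ l, 1 < l ∧ 0 < C * (1 - l ^ (-α)) - (l ^ (2 - α) - 1) := by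
      refine exists_one_lt_pos (d := C * (-(-α)) - (2 - α)) ?_ (by simp) ?_
      · exact (((hasDerivAt_rpow_one _).const_sub 1).const_mul C).sub
          ((hasDerivAt_rpow_one _).sub_const 1)
      · rw [div_lt_iff₀ h0] at hC; linarith
    have hl0 : 0 < l := by linarith
    have e3 := (((hv l hl).const_sub 1).const_mul C).sub ((hV.2.2 l hl0).sub_const 1)
    have := key (-1) C l hl (by
      filter_upwards [e3.eventually_const_lt hF, eventually_gt_atTop 0, hV.eventually_pos]
        with t a ht hVt
      have hlt : t ≤ l * t := by nlinarith
      have b := h.lower t (l * t) ht hlt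
      have a' := mul_pos a (show 0 < V t / t ^ 2 by positivity)
      have e : (C * (1 - V (l * t) / (l * t) ^ 2 / (V t / t ^ 2)) - (V (l * t) / V t - 1))
          * (V t / t ^ 2) = C * (V t / t ^ 2 - V (l * t) / (l * t) ^ 2)
            - (V (l * t) - V t) / t ^ 2 := by field_simp
      rw [e] at a'
      have b' : T t - T (l * t) ≤ (V (l * t) - V t) / t ^ 2 := by
        rw [le_div_iff₀ (by positivity)]; linarith
      linarith)
    filter_upwards [this, eventually_gt_atTop 0] with t a ht
    have : T t ≤ C * V t / t ^ 2 := by rw [mul_div_assoc]; linarith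
    rwa [le_div_iff₀ (by positivity), mul_comm] at this
  · obtain ⟨l, hl, hF⟩ : ∃ l, 1 < l ∧ 0 < (l ^ (-α) - l ^ (-2 : ℝ)) - c * (1 - l ^ (-α)) := by
      refine exists_one_lt_pos (d := (-α - (-2)) - c * (-(-α))) ?_ (by simp) ?_
      · exact ((hasDerivAt_rpow_one _).sub (hasDerivAt_rpow_one _)).sub
          (((hasDerivAt_rpow_one _).const_sub 1).const_mul c)
      · rw [lt_div_iff₀ h0] at hc; linarith
    have hl0 : 0 < l := by linarith
    have e3 := ((hv l hl).sub_const (l ^ (-2 : ℝ))).sub (((hv l hl).const_sub 1).const_mul c)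
    have := key 1 (-c) l hl (by
      filter_upwards [e3.eventually_const_lt hF, eventually_gt_atTop 0, hV.eventually_pos]
        with t a ht hVt
      have hlt : t ≤ l * t := by nlinarith
      have b := h.upper t (l * t) ht hlt
      have a' := mul_pos a (show 0 < V t / t ^ 2 by positivity)
      have e : (V (l * t) / (l * t) ^ 2 / (V t / t ^ 2) - l ^ (-2 : ℝ)
          - c * (1 - V (l * t) / (l * t) ^ 2 / (V t / t ^ 2)))
          * (V t / t ^ 2) = (V (l * t) - V t) / (l * t) ^ 2
            - c * (V t / t ^ 2 - V (l * t) / (l * t) ^ 2) := by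
        rw [Real.rpow_neg hl0.le]; norm_num; field_simp
      rw [e] at a'
      have b' : (V (l * t) - V t) / (l * t) ^ 2 ≤ T t - T (l * t) := by
        rw [div_le_iff₀ (by positivity)]; linarith
      linarith)
    filter_upwards [this, eventually_gt_atTop 0] with t a ht
    have : c * V t / t ^ 2 ≤ T t := by rw [mul_div_assoc]; linarith
    rwa [div_le_iff₀ (by positivity), mul_comm (T t)] at this

/-- The tail is regularly varying of index `-α` iff the truncated second moment is so with
index `2 - α`. -/
theorem IsTailMoment.regVar_iff {T V : ℝ → ℝ} (h : IsTailMoment T V) {α : ℝ} (h0 : 0 < α)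
    (h2 : α < 2) : RegVar T (-α) ↔ RegVar V (2 - α) := by
  have h2a : 0 < 2 - α := by linarith
  constructor
  · intro hT
    have hk := h.karamata_direct h0 h2 hT
    have hL : 0 < α / (2 - α) := by positivity
    have hpos : ∀ᶠ t in atTop, 0 < V t := by
      filter_upwards [hk.eventually_const_lt hL, hT.eventually_pos, eventually_gt_atTop 0]
        with t a b ht
      exact (div_pos_iff_of_pos_right (by positivity)).1 a
    refine ⟨h.moment_mono.measurable, hpos, fun c hc => ?_⟩
    · have e1 : Tendsto (fun t : ℝ => c * t) atTop atTop := tendsto_id.const_mul_atTop hc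
      have := ((hk.comp e1).div hk hL.ne').mul (hT.tendsto_sq_mul hc)
      rw [div_self hL.ne', one_mul, neg_add_eq_sub] at this
      refine this.congr' ?_
      filter_upwards [hT.eventually_pos, e1.eventually hT.eventually_pos, eventually_gt_atTop 0,
        hpos] with t a b ht hv
      simp only [Pi.div_apply, Function.comp_apply]
      field_simp
  · intro hV
    have hk := h.karamata_converse h0 h2 hV
    have hL : 0 < (2 - α) / α := by positivity
    have hpos : ∀ᶠ t in atTop, 0 < T t := by
      filter_upwards [hk.eventually_const_lt hL, hV.eventually_pos, eventually_gt_atTop 0]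
        with t a b ht
      have := (div_pos_iff_of_pos_right b).1 a
      exact (mul_pos_iff_of_pos_left (by positivity)).1 this
    refine ⟨h.tail_anti.measurable, hpos, fun c hc => ?_⟩
    · have e1 : Tendsto (fun t : ℝ => c * t) atTop atTop := tendsto_id.const_mul_atTop hc
      have := (((hk.comp e1).div hk hL.ne').mul (hV.2.2 c hc)).mul_const ((c ^ 2)⁻¹)
      have e : c ^ (-α) = c ^ (2 - α) * (c ^ 2)⁻¹ := by
        rw [sub_eq_add_neg, Real.rpow_add hc]; norm_num; field_simp
      rw [div_self hL.ne', one_mul, ← e] at this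
      refine this.congr' ?_
      filter_upwards [hV.eventually_pos, e1.eventually hV.eventually_pos, hpos,
        eventually_gt_atTop 0] with t a b a' ht
      simp only [Pi.div_apply, Function.comp_apply]
      field_simp

/-- A monotone regularly varying function is insensitive to bounded shifts of its argument. -/
theorem RegVar.tendsto_shift {T : ℝ → ℝ} {ρ : ℝ} (hT : RegVar T ρ) (hanti : Antitone T) (s : ℝ) :
    Tendsto (fun t => T (t + s) / T t) atTop (𝓝 1) := by
  have hcont : Tendsto (fun x : ℝ => x ^ ρ) (𝓝 1) (𝓝 1) := by
    simpa using (Real.continuousAt_rpow_const 1 ρ (Or.inl one_ne_zero)).tendsto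
  have habs : ∀ δ : ℝ, 0 < δ → ∀ᶠ t : ℝ in atTop, |s| ≤ δ * t := fun δ hδ =>
    (tendsto_id.const_mul_atTop hδ).eventually_ge_atTop _
  refine tendsto_order.2 ⟨fun C hC => ?_, fun C hC => ?_⟩
  · have h1 : ∀ᶠ x in 𝓝[>] (1 : ℝ), C < x ^ ρ :=
      (hcont.mono_left nhdsWithin_le_nhds).eventually_const_lt hC
    obtain ⟨x, hx, hx1⟩ := (h1.and self_mem_nhdsWithin).exists
    have hx1 : 1 < x := hx1
    filter_upwards [(hT.2.2 x (by linarith)).eventually_const_lt hx, habs (x - 1) (by linarith),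
      hT.eventually_pos] with t a b c
    refine a.trans_le ?_
    gcongr
    apply hanti
    have := le_abs_self s
    linarith
  · have h1 : ∀ᶠ x in 𝓝[<] (1 : ℝ), x ^ ρ < C :=
      (hcont.mono_left nhdsWithin_le_nhds).eventually_lt_const hC
    have h2 : ∀ᶠ x in 𝓝[<] (1 : ℝ), 0 < x :=
      nhdsWithin_le_nhds (lt_mem_nhds one_pos)
    obtain ⟨x, ⟨hx, hx0⟩, hx1⟩ := ((h1.and h2).and self_mem_nhdsWithin).exists
    have hx1 : x < 1 := hx1
    filter_upwards [(hT.2.2 x hx0).eventually_lt_const hx, habs (1 - x) (by linarith),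
      hT.eventually_pos] with t a b c
    refine lt_of_le_of_lt ?_ a
    gcongr
    apply hanti
    have := neg_abs_le s
    linarith

/-! ### The Lévy measure of a stable law and its exponent -/

open Set Complex in
theorem norm_exp_neg_sub_one_le {z : ℂ} (hz : 0 ≤ z.re) : ‖Complex.exp (-z) - 1‖ ≤ ‖z‖ := by
  have h := (convex_halfSpace_re_ge 0).norm_image_sub_le_of_norm_hasDerivWithin_le
    (f := fun w : ℂ => Complex.exp (-w)) (f' := fun w => Complex.exp (-w) * (-1)) (C := 1)
    (x := 0) (y := z)
    (fun w _ => ((hasDerivAt_neg w).cexp).hasDerivWithinAt)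
    (fun w hw => by
      have hw : 0 ≤ w.re := hw
      simpa [Complex.norm_exp] using hw) (by simp) hz
  simpa using h

theorem norm_exp_neg_sub_one_add_le {z : ℂ} (hz : 0 ≤ z.re) :
    ‖Complex.exp (-z) - 1 + z‖ ≤ ‖z‖ ^ 2 := by
  have h := (convex_segment (𝕜 := ℝ) (0 : ℂ) z).norm_image_sub_le_of_norm_hasDerivWithin_le
    (f := fun w : ℂ => Complex.exp (-w) - 1 + w)
    (f' := fun w => Complex.exp (-w) * (-1) + 1) (C := ‖z‖) (x := 0) (y := z)
    (fun w _ => ((((hasDerivAt_neg w).cexp).sub_const 1).add (hasDerivAt_id w)).hasDerivWithinAt)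
    (fun w hw => by
      obtain ⟨t, ht, rfl⟩ := (segment_eq_image' ℝ (0 : ℂ) z ▸ hw)
      have h1 : 0 ≤ ((0 : ℂ) + t • (z - 0)).re := by
        simpa using mul_nonneg ht.1 hz
      have h2 := norm_exp_neg_sub_one_le h1
      have h3 : Complex.exp (-((0 : ℂ) + t • (z - 0))) * (-1) + 1
          = -(Complex.exp (-((0 : ℂ) + t • (z - 0))) - 1) := by ring
      rw [h3, norm_neg]
      refine h2.trans ?_
      simp only [sub_zero, zero_add, norm_smul, Real.norm_eq_abs, abs_of_nonneg ht.1]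
      exact mul_le_of_le_one_left (norm_nonneg _) ht.2)
    (left_mem_segment _ _ _) (right_mem_segment _ _ _)
  simpa [pow_two] using h

theorem abs_sin_sub_self_le {x : ℝ} (h0 : 0 ≤ x) (h1 : x ≤ 1) : |Real.sin x - x| ≤ x ^ 2 := by
  rcases h0.eq_or_lt with rfl | h0
  · simp
  have h2 := Real.sin_le h0.le
  have h3 := Real.sin_gt_sub_cube h0
  have h4 : x ^ 3 ≤ x ^ 2 := pow_le_pow_of_le_one h0.le h1 (by norm_num)
  rw [abs_le]
  constructor <;> nlinarith [h3, sq_nonneg x]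

/-- The function `min 1 x²` is integrable against the Lévy measure `x^(-α-1) dx` on `(0, ∞)`. -/
theorem integrableOn_min_one_sq_mul_rpow {α : ℝ} (h0 : 0 < α) (h2 : α < 2) :
    IntegrableOn (fun x : ℝ => min 1 (x ^ 2) * x ^ (-α - 1)) (Set.Ioi 0) := by
  rw [← Set.Ioc_union_Ioi_eq_Ioi zero_le_one]
  refine IntegrableOn.union ?_ ?_
  · have h : IntegrableOn (fun x : ℝ => x ^ (1 - α)) (Set.Ioc 0 1) :=
      (intervalIntegral.intervalIntegrable_rpow' (by linarith)).1
    refine h.congr_fun (fun x hx => ?_) measurableSet_Ioc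
    have hx1 : x ^ 2 ≤ 1 := pow_le_one₀ hx.1.le hx.2
    simp only
    rw [min_eq_right hx1, ← Real.rpow_natCast, ← Real.rpow_add hx.1]
    congr 1; norm_num; ring
  · have h : IntegrableOn (fun x : ℝ => x ^ (-α - 1)) (Set.Ioi 1) :=
      integrableOn_Ioi_rpow_of_lt (by linarith) one_pos
    refine h.congr_fun (fun x hx => ?_) measurableSet_Ioi
    have hx1 : 1 ≤ x ^ 2 := one_le_pow₀ (le_of_lt hx)
    simp only
    rw [min_eq_left hx1, one_mul]

/-- The integrand `e^{-sx} - 1 + s sin x` of the Laplace exponent of the one-sided stable Lévy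
measure; the compensator `sin` works for every index `α ∈ (0, 2)`. -/
noncomputable def laplaceKernel (s : ℂ) (x : ℝ) : ℂ :=
  Complex.exp (-(s * x)) - 1 + s * (Real.sin x : ℂ)

theorem norm_laplaceKernel_le {s : ℂ} (hs : 0 ≤ s.re) {x : ℝ} (hx : 0 ≤ x) :
    ‖laplaceKernel s x‖ ≤ (‖s‖ ^ 2 + ‖s‖ + 2) * min 1 (x ^ 2) := by
  have hre : 0 ≤ (s * x).re := by simpa using mul_nonneg hs hx
  rcases le_total x 1 with h1 | h1
  · have hx1 : x ^ 2 ≤ 1 := pow_le_one₀ hx h1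
    rw [min_eq_right hx1]
    have e : laplaceKernel s x = (Complex.exp (-(s * x)) - 1 + s * x)
        + s * ((Real.sin x - x : ℝ) : ℂ) := by
      simp only [laplaceKernel]; push_cast; ring
    rw [e]
    refine (norm_add_le _ _).trans ?_
    have a := norm_exp_neg_sub_one_add_le hre
    have b := abs_sin_sub_self_le hx h1
    rw [norm_mul, Complex.norm_real, Real.norm_of_nonneg hx] at a
    rw [norm_mul, Complex.norm_real, Real.norm_eq_abs]
    have := mul_le_mul_of_nonneg_left b (norm_nonneg s)
    nlinarith [sq_nonneg x]
  · have hx1 : 1 ≤ x ^ 2 := one_le_pow₀ h1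
    rw [min_eq_left hx1, mul_one]
    have a : ‖Complex.exp (-(s * x))‖ ≤ 1 := by
      rw [Complex.norm_exp]; simpa using mul_nonneg hs hx
    have b : ‖s * (Real.sin x : ℂ)‖ ≤ ‖s‖ := by
      rw [norm_mul, Complex.norm_real, Real.norm_eq_abs]
      exact mul_le_of_le_one_right (norm_nonneg _) (Real.abs_sin_le_one x)
    have := norm_add_le (Complex.exp (-(s * x)) - 1) (s * (Real.sin x : ℂ))
    have := norm_sub_le (Complex.exp (-(s * x))) 1
    simp only [norm_one] at this
    unfold laplaceKernel
    nlinarith [sq_nonneg ‖s‖]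

theorem mul_exp_neg_le {r x : ℝ} (hr : 0 < r) : x * Real.exp (-(r * x)) ≤ 1 / r := by
  have h := Real.add_one_le_exp (r * x)
  rw [Real.exp_neg, ← div_eq_mul_inv, div_le_div_iff₀ (Real.exp_pos _) hr]
  linarith

theorem sq_mul_exp_neg_le {r x : ℝ} (hr : 0 < r) (hx : 0 ≤ x) :
    x ^ 2 * Real.exp (-(r * x)) ≤ 4 / r ^ 2 := by
  have h := mul_exp_neg_le (x := x) (half_pos hr)
  have h2 : Real.exp (-(r * x)) = Real.exp (-(r / 2 * x)) ^ 2 := by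
    rw [← Real.exp_nat_mul]; congr 1; push_cast; ring
  have h3 : 0 ≤ x * Real.exp (-(r / 2 * x)) := by positivity
  rw [h2, ← mul_pow]
  calc _ ≤ (1 / (r / 2)) ^ 2 := by gcongr
    _ = _ := by field_simp; norm_num

/-- The weight `x^(-α-1)` as a complex number. -/
noncomputable def levyWeight (α x : ℝ) : ℂ := ((x ^ (-α - 1) : ℝ) : ℂ)

theorem measurable_levyWeight (α : ℝ) : Measurable (levyWeight α) := by
  unfold levyWeight; fun_prop

theorem norm_levyWeight {α x : ℝ} (hx : 0 ≤ x) : ‖levyWeight α x‖ = x ^ (-α - 1) := by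
  rw [levyWeight, Complex.norm_real, Real.norm_of_nonneg (by positivity)]

/-- Laplace exponent of the one-sided stable Lévy measure `x^(-α-1) dx`. -/
noncomputable def laplaceExponent (α : ℝ) (s : ℂ) : ℂ :=
  ∫ x in Set.Ioi (0 : ℝ), laplaceKernel s x * levyWeight α x

/-- Functions bounded by a multiple of `min 1 x²` are integrable against the Lévy measure. -/
theorem integrableOn_mul_levyWeight {α : ℝ} (h0 : 0 < α) (h2 : α < 2) {f : ℝ → ℂ} {C : ℝ}
    (hf : Measurable f) (hC : ∀ x, 0 < x → ‖f x‖ ≤ C * min 1 (x ^ 2)) :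
    IntegrableOn (fun x => f x * levyWeight α x) (Set.Ioi 0) := by
  refine Integrable.mono' ((integrableOn_min_one_sq_mul_rpow h0 h2).const_mul C)
    (hf.mul (measurable_levyWeight α)).aestronglyMeasurable ?_
  filter_upwards [ae_restrict_mem measurableSet_Ioi] with x hx
  have hx : 0 < x := hx
  rw [norm_mul, norm_levyWeight hx.le, ← mul_assoc]
  gcongr
  exact hC x hx

theorem measurable_laplaceKernel (s : ℂ) : Measurable (laplaceKernel s) := by
  unfold laplaceKernel; fun_prop

/-- Differentiation under the integral sign against the stable Lévy measure. -/
theorem hasDerivAt_integral_levyWeight {α : ℝ} (h0 : 0 < α) (h2 : α < 2) {F F' : ℂ → ℝ → ℂ}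
    (hF : ∀ s, Measurable (F s)) (hF' : ∀ s, Measurable (F' s)) {s₀ : ℂ} (hs₀ : 0 < s₀.re) {C C' : ℝ}
    (hC : ∀ x, 0 < x → ‖F s₀ x‖ ≤ C * min 1 (x ^ 2))
    (hC' : ∀ s ∈ Metric.ball s₀ (s₀.re / 2), ∀ x, 0 < x → ‖F' s x‖ ≤ C' * min 1 (x ^ 2))
    (hd : ∀ s x, HasDerivAt (fun s => F s x) (F' s x) s) :
    HasDerivAt (fun s => ∫ x in Set.Ioi (0 : ℝ), F s x * levyWeight α x)
      (∫ x in Set.Ioi (0 : ℝ), F' s₀ x * levyWeight α x) s₀ := by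
  refine (hasDerivAt_integral_of_dominated_loc_of_deriv_le (Metric.ball_mem_nhds s₀ (half_pos hs₀))
    (F' := fun s x => F' s x * levyWeight α x)
    (bound := fun x => C' * (min 1 (x ^ 2) * x ^ (-α - 1)))
    (.of_forall fun s => ((hF s).mul (measurable_levyWeight α)).aestronglyMeasurable)
    (integrableOn_mul_levyWeight h0 h2 (hF s₀) hC)
    ((hF' s₀).mul (measurable_levyWeight α)).aestronglyMeasurable ?_
    ((integrableOn_min_one_sq_mul_rpow h0 h2).const_mul C') ?_).2
  · filter_upwards [ae_restrict_mem measurableSet_Ioi] with x hx s hs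
    have hx : 0 < x := hx
    rw [norm_mul, norm_levyWeight hx.le, ← mul_assoc]
    gcongr
    exact hC' s hs x hx
  · exact .of_forall fun x s _ => (hd s x).mul_const _

theorem re_gt_of_mem_ball {s s₀ : ℂ} (hs : s ∈ Metric.ball s₀ (s₀.re / 2)) :
    s₀.re / 2 < s.re := by
  have := (Complex.abs_re_le_norm (s - s₀)).trans_lt (by simpa [dist_eq_norm] using hs)
  rw [Complex.sub_re, abs_lt] at this
  linarith

/-- First derivative of the Laplace kernel in `s`. -/
noncomputable def laplaceKernelDeriv (s : ℂ) (x : ℝ) : ℂ :=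
  -(x * Complex.exp (-(s * x))) + (Real.sin x : ℂ)

theorem norm_laplaceKernelDeriv_le {r R : ℝ} (hr : 0 < r) {s : ℂ} (hs : r ≤ s.re) (hR : ‖s‖ ≤ R)
    {x : ℝ} (hx : 0 < x) :
    ‖laplaceKernelDeriv s x‖ ≤ (R + 1 + 1 / r) * min 1 (x ^ 2) := by
  have hre : 0 ≤ (s * x).re := by simpa using mul_nonneg (hr.le.trans hs) hx.le
  have hR0 := (norm_nonneg s).trans hR
  have hr' : 0 < 1 / r := by positivity
  rcases le_total x 1 with h1 | h1
  · have hx1 : x ^ 2 ≤ 1 := pow_le_one₀ hx.le h1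
    rw [min_eq_right hx1]
    have e : laplaceKernelDeriv s x = -(x * (Complex.exp (-(s * x)) - 1))
        + ((Real.sin x - x : ℝ) : ℂ) := by
      simp only [laplaceKernelDeriv]; push_cast; ring
    rw [e]
    refine (norm_add_le _ _).trans ?_
    have a := norm_exp_neg_sub_one_le hre
    have b := abs_sin_sub_self_le hx.le h1
    rw [norm_mul, Complex.norm_real, Real.norm_of_nonneg hx.le] at a
    rw [norm_neg, norm_mul, Complex.norm_real, Complex.norm_real, Real.norm_of_nonneg hx.le,
      Real.norm_eq_abs]
    have c := mul_le_mul_of_nonneg_left (a.trans (mul_le_mul_of_nonneg_right hR hx.le)) hx.le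
    nlinarith [sq_nonneg x]
  · have hx1 : 1 ≤ x ^ 2 := one_le_pow₀ h1
    rw [min_eq_left hx1, mul_one]
    have a : ‖Complex.exp (-(s * x))‖ ≤ Real.exp (-(r * x)) := by
      rw [Complex.norm_exp]
      gcongr
      simpa using mul_le_mul_of_nonneg_right hs hx.le
    have b := mul_exp_neg_le (x := x) hr
    unfold laplaceKernelDeriv
    refine (norm_add_le _ _).trans ?_
    rw [norm_neg, norm_mul, Complex.norm_real, Complex.norm_real, Real.norm_of_nonneg hx.le,
      Real.norm_eq_abs]
    have := Real.abs_sin_le_one x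
    have := mul_le_mul_of_nonneg_left a hx.le
    linarith

theorem norm_sq_mul_exp_le {r : ℝ} (hr : 0 < r) {s : ℂ} (hs : r ≤ s.re) {x : ℝ} (hx : 0 < x) :
    ‖(x : ℂ) ^ 2 * Complex.exp (-(s * x))‖ ≤ (1 + 4 / r ^ 2) * min 1 (x ^ 2) := by
  have a : ‖Complex.exp (-(s * x))‖ ≤ Real.exp (-(r * x)) := by
    rw [Complex.norm_exp]
    gcongr
    simpa using mul_le_mul_of_nonneg_right hs hx.le
  have a1 : Real.exp (-(r * x)) ≤ 1 := by
    rw [Real.exp_le_one_iff]; nlinarith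
  have c : 0 < 4 / r ^ 2 := by positivity
  rw [norm_mul, norm_pow, Complex.norm_real, Real.norm_of_nonneg hx.le]
  rcases le_total x 1 with h1 | h1
  · have hx1 : x ^ 2 ≤ 1 := pow_le_one₀ hx.le h1
    rw [min_eq_right hx1]
    nlinarith [sq_nonneg x, mul_le_mul_of_nonneg_left (a.trans a1) (sq_nonneg x)]
  · have hx1 : 1 ≤ x ^ 2 := one_le_pow₀ h1
    rw [min_eq_left hx1, mul_one]
    have := sq_mul_exp_neg_le hr hx.le
    have := mul_le_mul_of_nonneg_left a (sq_nonneg x)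
    linarith

theorem hasDerivAt_laplaceExponent {α : ℝ} (h0 : 0 < α) (h2 : α < 2) {s : ℂ} (hs : 0 < s.re) :
    HasDerivAt (laplaceExponent α)
      (∫ x in Set.Ioi (0 : ℝ), laplaceKernelDeriv s x * levyWeight α x) s := by
  refine hasDerivAt_integral_levyWeight h0 h2 measurable_laplaceKernel
    (fun s => by unfold laplaceKernelDeriv; fun_prop) hs
    (fun x hx => norm_laplaceKernel_le hs.le hx.le) (fun z hz x hx =>
      norm_laplaceKernelDeriv_le (half_pos hs) (re_gt_of_mem_ball hz).le
        (R := ‖s‖ + s.re / 2) ?_ hx) ?_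
  · have h1 : ‖z - s‖ < s.re / 2 := by simpa [dist_eq_norm] using hz
    have h3 := norm_add_le (z - s) s
    rw [sub_add_cancel] at h3
    linarith
  · intro z x
    unfold laplaceKernel laplaceKernelDeriv
    have h := (((((hasDerivAt_id z).mul_const (x : ℂ)).fun_neg.cexp).sub_const 1).add
      ((hasDerivAt_id z).mul_const (Real.sin x : ℂ)))
    refine h.congr_deriv ?_
    simp; ring

theorem hasDerivAt_integral_laplaceKernelDeriv {α : ℝ} (h0 : 0 < α) (h2 : α < 2) {s : ℂ}
    (hs : 0 < s.re) :
    HasDerivAt (fun s => ∫ x in Set.Ioi (0 : ℝ), laplaceKernelDeriv s x * levyWeight α x)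
      (∫ x in Set.Ioi (0 : ℝ), (x : ℂ) ^ 2 * Complex.exp (-(s * x)) * levyWeight α x) s := by
  refine hasDerivAt_integral_levyWeight h0 h2
    (fun s => by unfold laplaceKernelDeriv; fun_prop) (fun s => by fun_prop) hs
    (fun x hx => norm_laplaceKernelDeriv_le hs le_rfl le_rfl hx) (fun z hz x hx =>
      norm_sq_mul_exp_le (half_pos hs) (re_gt_of_mem_ball hz).le hx) ?_
  intro z x
  unfold laplaceKernelDeriv
  have h := ((((hasDerivAt_id z).mul_const (x : ℂ)).fun_neg.cexp).const_mul (x : ℂ)).fun_neg.add_const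
    (Real.sin x : ℂ)
  refine h.congr_deriv ?_
  simp; ring

/-- On the half plane the second derivative of the Laplace exponent is `Γ(2-α) s^(α-2)`. -/
theorem integral_sq_mul_exp_levyWeight {α : ℝ} (h0 : 0 < α) (h2 : α < 2) {s : ℂ} (hs : 0 < s.re) :
    ∫ x in Set.Ioi (0 : ℝ), (x : ℂ) ^ 2 * Complex.exp (-(s * x)) * levyWeight α x
      = Real.Gamma (2 - α) * s ^ ((α : ℂ) - 2) := by
  set U : Set ℂ := {z | 0 < z.re} with hU
  have hUo : IsOpen U := isOpen_lt continuous_const Complex.continuous_re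
  have hUc : IsPreconnected U := (convex_halfSpace_re_gt 0).isPreconnected
  have hd1 : DifferentiableOn ℂ
      (fun s => ∫ x in Set.Ioi (0 : ℝ), laplaceKernelDeriv s x * levyWeight α x) U := fun z hz =>
    (hasDerivAt_integral_laplaceKernelDeriv h0 h2 hz).differentiableAt.differentiableWithinAt
  have ha1 : AnalyticOnNhd ℂ
      (fun s : ℂ => ∫ x in Set.Ioi (0 : ℝ), (x : ℂ) ^ 2 * Complex.exp (-(s * x)) * levyWeight α x)
      U := by
    have := (hd1.analyticOnNhd hUo).deriv
    refine this.congr hUo fun z hz => (hasDerivAt_integral_laplaceKernelDeriv h0 h2 hz).deriv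
  have ha2 : AnalyticOnNhd ℂ (fun s : ℂ => (Real.Gamma (2 - α) : ℂ) * s ^ ((α : ℂ) - 2)) U := by
    refine DifferentiableOn.analyticOnNhd (fun z hz => ?_) hUo
    exact ((hasDerivAt_id z).cpow_const (Or.inl hz)).differentiableAt.const_mul _
      |>.differentiableWithinAt
  have hreal : ∀ r : ℝ, 0 < r →
      ∫ x in Set.Ioi (0 : ℝ), (x : ℂ) ^ 2 * Complex.exp (-((r : ℂ) * x)) * levyWeight α x
      = Real.Gamma (2 - α) * (r : ℂ) ^ ((α : ℂ) - 2) := by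
    intro r hr
    have h := Real.integral_rpow_mul_exp_neg_mul_Ioi (a := 2 - α) (by linarith) hr
    have e : ∀ x ∈ Set.Ioi (0 : ℝ), (x : ℂ) ^ 2 * Complex.exp (-((r : ℂ) * x)) * levyWeight α x
        = ((x ^ (2 - α - 1) * Real.exp (-(r * x)) : ℝ) : ℂ) := by
      intro x hx
      have hx : 0 < x := hx
      have : x ^ (2 - α - 1) = x ^ 2 * x ^ (-α - 1) := by
        rw [← Real.rpow_natCast, ← Real.rpow_add hx]; congr 1; norm_num; ring
      rw [this, levyWeight]
      push_cast; ring
    rw [setIntegral_congr_fun measurableSet_Ioi e, integral_complex_ofReal, h]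
    push_cast
    rw [one_div, Real.inv_rpow hr.le, ← Real.rpow_neg hr.le, Complex.ofReal_cpow hr.le]
    push_cast
    rw [mul_comm, neg_sub]
  refine ha1.eqOn_of_preconnected_of_frequently_eq ha2 hUc (z₀ := 1) (by simp [hU]) ?_ hs
  have hseq : Tendsto (fun n : ℕ => ((1 + 1 / ((n : ℝ) + 1) : ℝ) : ℂ)) atTop (𝓝[≠] 1) := by
    refine tendsto_nhdsWithin_iff.2 ⟨?_, .of_forall fun n => ?_⟩
    · have := (tendsto_one_div_add_atTop_nhds_zero_nat (𝕜 := ℝ)).const_add 1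
      have := (Complex.continuous_ofReal.tendsto _).comp this
      simpa [Function.comp_def] using this
    · have : (0 : ℝ) < 1 / ((n : ℝ) + 1) := by positivity
      have h3 : (1 + 1 / ((n : ℝ) + 1) : ℝ) ≠ 1 := by linarith
      change ((1 + 1 / ((n : ℝ) + 1) : ℝ) : ℂ) ≠ 1
      rwa [Ne, Complex.ofReal_eq_one]
  exact hseq.frequently (.of_forall fun n => hreal _ (by positivity))

theorem continuousWithinAt_laplaceExponent {α : ℝ} (h0 : 0 < α) (h2 : α < 2) (s : ℂ) :
    ContinuousWithinAt (laplaceExponent α) {z | 0 ≤ z.re} s := by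
  unfold laplaceExponent
  refine continuousWithinAt_of_dominated
    (bound := fun x => ((‖s‖ + 1) ^ 2 + (‖s‖ + 1) + 2) * (min 1 (x ^ 2) * x ^ (-α - 1)))
    (.of_forall fun z =>
      ((measurable_laplaceKernel z).mul (measurable_levyWeight α)).aestronglyMeasurable) ?_
    ((integrableOn_min_one_sq_mul_rpow h0 h2).const_mul _) ?_
  · have h1 : ∀ᶠ z in 𝓝[{z | 0 ≤ z.re}] s, ‖z‖ < ‖s‖ + 1 :=
      nhdsWithin_le_nhds (continuous_norm.continuousAt.eventually_lt_const (by linarith))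
    filter_upwards [h1, self_mem_nhdsWithin] with z hz1 hz2
    filter_upwards [ae_restrict_mem measurableSet_Ioi] with x hx
    have hx : 0 < x := hx
    rw [norm_mul, norm_levyWeight hx.le, ← mul_assoc]
    gcongr
    exact (norm_laplaceKernel_le hz2 hx.le).trans (by gcongr)
  · refine .of_forall fun x => Continuous.continuousWithinAt ?_
    unfold laplaceKernel; fun_prop

theorem laplaceExponent_conj (α : ℝ) (s : ℂ) :
    laplaceExponent α (starRingEnd ℂ s) = starRingEnd ℂ (laplaceExponent α s) := by
  unfold laplaceExponent
  rw [← integral_conj]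
  refine integral_congr_ae (.of_forall fun x => ?_)
  simp only [laplaceKernel, levyWeight, map_mul, map_add, map_sub, map_one, Complex.conj_ofReal,
    ← Complex.exp_conj, map_neg]

theorem eqOn_const_of_hasDerivAt_zero {H : ℂ → ℂ} (h : ∀ z : ℂ, 0 < z.re → HasDerivAt H 0 z) :
    ∃ c, ∀ z : ℂ, 0 < z.re → H z = c := by
  obtain ⟨c, hc⟩ := (isOpen_lt continuous_const Complex.continuous_re).exists_is_const_of_deriv_eq_zero
    (convex_halfSpace_re_gt 0).isPreconnected
    (fun z hz => (h z hz).differentiableAt.differentiableWithinAt) (fun z hz => (h z hz).deriv)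
  exact ⟨c, hc⟩

/-- A second primitive `G` of `Γ(2-α) s^(α-2)` determines the Laplace exponent, up to a real
linear term, on the imaginary axis. -/
theorem exists_laplaceExponent_eq {α : ℝ} (h0 : 0 < α) (h2 : α < 2) {G G' : ℂ → ℂ}
    (hG : ∀ s : ℂ, 0 < s.re → HasDerivAt G (G' s) s)
    (hG' : ∀ s : ℂ, 0 < s.re → HasDerivAt G' (Real.Gamma (2 - α) * s ^ ((α : ℂ) - 2)) s)
    (hlim : Tendsto (fun e : ℝ => G e) (𝓝[>] 0) (𝓝 0)) (h1 : (G 1).im = 0) :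
    ∃ A : ℝ, ∀ s : ℂ, 0 ≤ s.re → ContinuousAt G s → laplaceExponent α s = G s + A * s := by
  obtain ⟨A, hA⟩ := eqOn_const_of_hasDerivAt_zero (H := fun s =>
      (∫ x in Set.Ioi (0 : ℝ), laplaceKernelDeriv s x * levyWeight α x) - G' s) (fun z hz => by
    have := (hasDerivAt_integral_laplaceKernelDeriv h0 h2 hz).sub (hG' z hz)
    rwa [integral_sq_mul_exp_levyWeight h0 h2 hz, sub_self] at this)
  obtain ⟨B, hB⟩ := eqOn_const_of_hasDerivAt_zero (H := fun s =>
      laplaceExponent α s - G s - A * s) (fun z hz => by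
    have := ((hasDerivAt_laplaceExponent h0 h2 hz).sub (hG z hz)).sub
      ((hasDerivAt_id z).const_mul A)
    rw [hA z hz, mul_one, sub_self] at this
    exact this)
  have hcont := continuousWithinAt_laplaceExponent h0 h2
  have hB0 : B = 0 := by
    have e1 : Tendsto (fun e : ℝ => (e : ℂ)) (𝓝[>] 0) (𝓝[{z | 0 ≤ z.re}] 0) := by
      refine tendsto_nhdsWithin_iff.2 ⟨?_, ?_⟩
      · exact (Complex.continuous_ofReal.tendsto' 0 0 (by simp)).mono_left nhdsWithin_le_nhds
      · filter_upwards [self_mem_nhdsWithin] with e he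
        exact le_of_lt (show 0 < e from he)
    have e2 : Tendsto (fun e : ℝ => laplaceExponent α e - G e - A * e) (𝓝[>] 0)
        (𝓝 (laplaceExponent α 0 - 0 - A * 0)) :=
      (((hcont 0).tendsto.comp e1).sub hlim).sub ((e1.mono_right nhdsWithin_le_nhds).const_mul A)
    have e3 : Tendsto (fun e : ℝ => laplaceExponent α e - G e - A * e) (𝓝[>] 0) (𝓝 B) := by
      refine tendsto_const_nhds.congr' ?_
      filter_upwards [self_mem_nhdsWithin] with e he
      exact (hB e (by simpa using he)).symm
    have e4 := tendsto_nhds_unique e3 e2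
    rw [e4]
    simp [laplaceExponent, laplaceKernel]
  have hAim : A.im = 0 := by
    have e1 := hB 1 (by simp)
    have e2 : (laplaceExponent α 1).im = 0 := by
      rw [← Complex.conj_eq_iff_im, ← laplaceExponent_conj, map_one]
    rw [hB0, mul_one, sub_eq_zero] at e1
    rw [← e1, Complex.sub_im, e2, h1, sub_self]
  obtain ⟨A, rfl⟩ : ∃ a : ℝ, A = a := ⟨A.re, by apply Complex.ext <;> simp [hAim]⟩
  refine ⟨A, fun s hs hc => ?_⟩
  have e1 : Tendsto (fun e : ℝ => s + e) (𝓝[>] 0) (𝓝[{z | 0 ≤ z.re}] s) := by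
    refine tendsto_nhdsWithin_iff.2 ⟨?_, ?_⟩
    · have : Continuous fun e : ℝ => s + e := by fun_prop
      exact (this.tendsto' 0 s (by simp)).mono_left nhdsWithin_le_nhds
    · filter_upwards [self_mem_nhdsWithin] with e he
      have he : 0 < e := he
      change 0 ≤ (s + e).re
      simp only [Complex.add_re, Complex.ofReal_re]
      linarith
  have e0 := e1.mono_right nhdsWithin_le_nhds
  have e2 : Tendsto (fun e : ℝ => G (s + e) + A * (s + e)) (𝓝[>] 0) (𝓝 (G s + A * s)) :=
    (hc.tendsto.comp e0).add (e0.const_mul _)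
  refine tendsto_nhds_unique ((hcont s).tendsto.comp e1) (e2.congr' ?_)
  filter_upwards [self_mem_nhdsWithin] with e he
  have he : 0 < e := he
  have := hB (s + e) (by simp; linarith)
  rw [hB0] at this
  simp only [Function.comp]
  linear_combination -this

/-- The exponent of the totally skewed stable law: `∫ (e^{iux} - 1 - iu sin x) x^(-α-1) dx`. -/
noncomputable def levyExponent (α u : ℝ) : ℂ := laplaceExponent α (-(Complex.I * u))

theorem levyExponent_neg (α u : ℝ) : levyExponent α (-u) = starRingEnd ℂ (levyExponent α u) := by
  unfold levyExponent
  rw [← laplaceExponent_conj]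
  simp

theorem stableExponent_neg (α σ β δ u : ℝ) :
    stableExponent α σ β δ (-u) = starRingEnd ℂ (stableExponent α σ β δ u) := by
  unfold stableExponent
  generalize Real.tan (Real.pi * α / 2) = c
  split_ifs <;>
  · simp only [map_add, map_mul, map_neg, map_sub, map_one, Complex.conj_ofReal, Complex.conj_I,
      abs_neg, Real.sign_neg]
    push_cast
    ring

theorem stableExponent_zero {α σ β δ : ℝ} (h0 : 0 < α) : stableExponent α σ β δ 0 = 0 := by
  unfold stableExponent
  split_ifs <;> simp [Real.zero_rpow h0.ne']

theorem log_neg_I_mul {u : ℝ} (hu : 0 < u) :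
    Complex.log (-(Complex.I * u)) = Real.log u - Complex.I * (Real.pi / 2) := by
  have : -(Complex.I * u) = (u : ℂ) * (-Complex.I) := by ring
  rw [this, Complex.log_ofReal_mul hu (by simp), Complex.log_neg_I]
  ring

theorem neg_I_mul_mem_slitPlane {u : ℝ} (hu : 0 < u) : -(Complex.I * u) ∈ Complex.slitPlane := by
  right; simpa using hu.ne'

/-- The second primitive is `Γ(2-α) s^α / (α (α-1))` for `α ≠ 1`, and the boundary value at
`s = -iu` gives the power `|u|^α` with the phase `tan (π α / 2)`. -/
theorem exists_levyExponent_eq_stableExponent_of_ne_one {α : ℝ} (h0 : 0 < α) (h2 : α < 2)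
    (h1 : α ≠ 1) : ∃ σ δ : ℝ, 0 < σ ∧
      ∀ u : ℝ, 0 < u → levyExponent α u = stableExponent α σ 1 δ u := by
  have hα0 : (α : ℂ) ≠ 0 := by exact_mod_cast h0.ne'
  have hα1 : (α : ℂ) - 1 ≠ 0 := by exact_mod_cast sub_ne_zero.2 h1
  set g : ℝ := Real.Gamma (2 - α) / (α * (α - 1)) with hg
  have hgC : (g : ℂ) = (Real.Gamma (2 - α) : ℂ) / ((α : ℂ) * (α - 1)) := by
    rw [hg]; push_cast; ring
  have hgam : 0 < Real.Gamma (2 - α) := Real.Gamma_pos_of_pos (by linarith)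
  obtain ⟨A, hA⟩ := exists_laplaceExponent_eq h0 h2 (G := fun s => (g : ℂ) * s ^ (α : ℂ))
    (G' := fun s => (g : ℂ) * (α * s ^ ((α : ℂ) - 1))) (fun s hs => by
      simpa using ((hasDerivAt_id s).cpow_const (c := (α : ℂ)) (Or.inl hs)).const_mul (g : ℂ))
    (fun s hs => by
      have := (((hasDerivAt_id s).cpow_const (c := (α : ℂ) - 1) (Or.inl hs)).const_mul
        (α : ℂ)).const_mul (g : ℂ)
      refine this.congr_deriv ?_
      have e : (α : ℂ) - 1 - 1 = α - 2 := by ring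
      simp only [id, e, hgC]
      field_simp)
    (by
      have e : Tendsto (fun e : ℝ => ((g * e ^ α : ℝ) : ℂ)) (𝓝[>] 0) (𝓝 0) := by
        have h3 : Tendsto (fun e : ℝ => g * e ^ α) (𝓝 0) (𝓝 0) := by
          have := ((Real.continuousAt_rpow_const 0 α (Or.inr h0.le)).tendsto).const_mul g
          simpa [Real.zero_rpow h0.ne'] using this
        exact (Complex.continuous_ofReal.tendsto' 0 0 (by simp)).comp
          (h3.mono_left nhdsWithin_le_nhds)
      refine e.congr' ?_
      filter_upwards [self_mem_nhdsWithin] with x hx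
      have hx : 0 < x := hx
      rw [Complex.ofReal_mul, Complex.ofReal_cpow hx.le])
    (by simp)
  -- the scale is determined by the real part `Γ(2-α) cos(πα/2) / (α (α-1)) < 0`
  have hC : 0 < -(g * Real.cos (Real.pi * α / 2)) := by
    have hpi := Real.pi_pos
    rcases lt_or_gt_of_ne h1 with h | h
    · have hcos : 0 < Real.cos (Real.pi * α / 2) :=
        Real.cos_pos_of_mem_Ioo ⟨by nlinarith, by nlinarith⟩
      have : g < 0 := div_neg_of_pos_of_neg hgam (mul_neg_of_pos_of_neg h0 (by linarith))
      nlinarith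
    · have hcos : Real.cos (Real.pi * α / 2) < 0 :=
        Real.cos_neg_of_pi_div_two_lt_of_lt (by nlinarith) (by nlinarith)
      have : 0 < g := div_pos hgam (mul_pos h0 (by linarith))
      nlinarith
  set C := -(g * Real.cos (Real.pi * α / 2)) with hCdef
  refine ⟨C ^ (1 / α), -A, by positivity, fun u hu => ?_⟩
  have hcos : Real.cos (Real.pi * α / 2) ≠ 0 := by
    rintro h; rw [hCdef, h] at hC; simp at hC
  have hcont : ContinuousAt (fun s : ℂ => (g : ℂ) * s ^ (α : ℂ)) (-(Complex.I * u)) :=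
    (((hasDerivAt_id (-(Complex.I * u))).cpow_const (c := (α : ℂ))
      (neg_I_mul_mem_slitPlane hu)).const_mul (g : ℂ)).continuousAt
  rw [levyExponent, hA _ (by simp) hcont, stableExponent, if_neg h1]
  have hne : -(Complex.I * u) ≠ 0 := by
    simpa using hu.ne'
  have hpow : (-(Complex.I * u)) ^ (α : ℂ)
      = ((u ^ α : ℝ) : ℂ) * (Real.cos (Real.pi * α / 2) - Complex.I * Real.sin (Real.pi * α / 2)) := by
    rw [Complex.cpow_def_of_ne_zero hne, log_neg_I_mul hu]
    have e : ((Real.log u : ℂ) - Complex.I * (Real.pi / 2)) * α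
        = ((Real.log u * α : ℝ) : ℂ) + ((-(Real.pi * α / 2) : ℝ) : ℂ) * Complex.I := by
      push_cast; ring
    rw [e, Complex.exp_add, Complex.exp_mul_I, ← Complex.ofReal_exp, ← Real.rpow_def_of_pos hu,
      ← Complex.ofReal_cos, ← Complex.ofReal_sin, Real.cos_neg, Real.sin_neg]
    push_cast; ring
  rw [hpow, abs_of_pos hu, Real.sign_of_pos hu, Real.mul_rpow (by positivity) hu.le,
    ← Real.rpow_mul hC.le, one_div, inv_mul_cancel₀ h0.ne', Real.rpow_one, Real.tan_eq_sin_div_cos,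
    hCdef]
  have hcosC : (Real.cos (Real.pi * α / 2) : ℂ) ≠ 0 := by exact_mod_cast hcos
  simp only [Complex.ofReal_mul, Complex.ofReal_neg, Complex.ofReal_div, Complex.ofReal_one]
  generalize (Real.cos (Real.pi * α / 2) : ℂ) = c at *
  field_simp

/-- For `α = 1` the second primitive is `s log s`, the source of the logarithm in the exponent of
the `1`-stable laws. -/
theorem exists_levyExponent_one_eq_stableExponent : ∃ σ δ : ℝ, 0 < σ ∧
      ∀ u : ℝ, 0 < u → levyExponent 1 u = stableExponent 1 σ 1 δ u := by
  obtain ⟨A, hA⟩ := exists_laplaceExponent_eq one_pos one_lt_two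
    (G := fun s => s * Complex.log s - s) (G' := fun s => Complex.log s) (fun s hs => by
      have hs0 : s ≠ 0 := by rintro rfl; simp at hs
      have := ((hasDerivAt_id s).mul (Complex.hasDerivAt_log (Or.inl hs))).sub (hasDerivAt_id s)
      refine this.congr_deriv ?_
      simp [hs0])
    (fun s hs => by
      have h := Complex.hasDerivAt_log (Or.inl hs)
      refine h.congr_deriv ?_
      have e1 : (2 : ℝ) - 1 = 1 := by norm_num
      have e : ((1 : ℝ) : ℂ) - 2 = -1 := by norm_num
      rw [e, e1, Real.Gamma_one, Complex.cpow_neg_one]; simp)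
    (by
      have e : Tendsto (fun e : ℝ => ((e * Real.log e - e : ℝ) : ℂ)) (𝓝[>] 0) (𝓝 0) := by
        have h3 : Tendsto (fun e : ℝ => e * Real.log e - e) (𝓝 0) (𝓝 0) := by
          have : Continuous fun e : ℝ => e * Real.log e - e :=
            Real.continuous_mul_log.sub continuous_id
          exact this.tendsto' _ _ (by simp)
        exact (Complex.continuous_ofReal.tendsto' 0 0 (by simp)).comp
          (h3.mono_left nhdsWithin_le_nhds)
      refine e.congr' ?_
      filter_upwards [self_mem_nhdsWithin] with x hx
      have hx : 0 < x := hx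
      push_cast
      rw [Complex.ofReal_log hx.le])
    (by simp)
  refine ⟨Real.pi / 2, 1 - A, by positivity, fun u hu => ?_⟩
  have hcont : ContinuousAt (fun s : ℂ => s * Complex.log s - s) (-(Complex.I * u)) :=
    (continuousAt_id.mul (continuousAt_clog (neg_I_mul_mem_slitPlane hu))).sub continuousAt_id
  rw [levyExponent, hA _ (by simp) hcont, stableExponent, if_pos rfl, log_neg_I_mul hu,
    abs_of_pos hu, Real.sign_of_pos hu]
  have hpi : (Real.pi : ℂ) ≠ 0 := by exact_mod_cast Real.pi_ne_zero
  push_cast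
  field_simp
  ring_nf
  rw [Complex.I_sq]
  ring

/-- The Lévy exponent of `x^(-α-1) dx` on `(0, ∞)` is the exponent of a stable law with skewness
one. -/
theorem exists_levyExponent_eq_stableExponent {α : ℝ} (h0 : 0 < α) (h2 : α < 2) :
    ∃ σ δ : ℝ, 0 < σ ∧ ∀ u : ℝ, levyExponent α u = stableExponent α σ 1 δ u := by
  obtain ⟨σ, δ, hσ, h⟩ : ∃ σ δ : ℝ, 0 < σ ∧
      ∀ u : ℝ, 0 < u → levyExponent α u = stableExponent α σ 1 δ u := by
    rcases eq_or_ne α 1 with rfl | h1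
    · exact exists_levyExponent_one_eq_stableExponent
    · exact exists_levyExponent_eq_stableExponent_of_ne_one h0 h2 h1
  refine ⟨σ, δ, hσ, fun u => ?_⟩
  rcases lt_trichotomy u 0 with hu | rfl | hu
  · have := h (-u) (by linarith)
    rw [levyExponent_neg, stableExponent_neg] at this
    exact (starRingEnd ℂ).injective this
  · rw [stableExponent_zero h0]
    simp [levyExponent, laplaceExponent, laplaceKernel]
  · exact h u hu

theorem stableExponent_add {α σ δ p q : ℝ} (h0 : 0 < α) (hσ : 0 < σ) (hpq : 0 < p + q)
    (u : ℝ) :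
    (p : ℂ) * stableExponent α σ 1 δ u + q * stableExponent α σ 1 δ (-u)
      = stableExponent α (σ * (p + q) ^ (1 / α)) ((p - q) / (p + q)) ((p - q) * δ) u := by
  have hC : ((p : ℂ) + q) ≠ 0 := by exact_mod_cast hpq.ne'
  unfold stableExponent
  generalize Real.tan (Real.pi * α / 2) = c
  simp only [abs_neg, Real.sign_neg]
  split_ifs with h1
  · subst h1
    simp only [div_one, Real.rpow_one]
    push_cast
    field_simp
    ring
  · have : (σ * (p + q) ^ (1 / α) * |u|) ^ α = (p + q) * (σ * |u|) ^ α := by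
      rw [mul_right_comm, Real.mul_rpow (by positivity) (by positivity), ← Real.rpow_mul hpq.le,
        one_div, inv_mul_cancel₀ h0.ne', Real.rpow_one]; ring
    rw [this]
    push_cast
    field_simp
    ring

/-- Every stable exponent of index `α ∈ (0, 2)` is, up to a drift, the Lévy exponent of
`p x^(-α-1) dx` on the positive and `q |x|^(-α-1) dx` on the negative half line. -/
theorem exists_stableExponent_eq_levyExponent {α σ β : ℝ} (δ : ℝ) (h0 : 0 < α) (h2 : α < 2)
    (hσ : 0 < σ) (hβ : β ∈ Set.Icc (-1 : ℝ) 1) :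
    ∃ p q d : ℝ, 0 ≤ p ∧ 0 ≤ q ∧ 0 < p + q ∧ ∀ u : ℝ, stableExponent α σ β δ u
      = p * levyExponent α u + q * levyExponent α (-u) + Complex.I * ((d * u : ℝ) : ℂ) := by
  obtain ⟨σ₀, δ₀, hσ₀, h⟩ := exists_levyExponent_eq_stableExponent h0 h2
  set s := (σ / σ₀) ^ α with hs
  have hs0 : 0 < s := by positivity
  have hsum : (1 + β) / 2 * s + (1 - β) / 2 * s = s := by ring
  have hdiff : (1 + β) / 2 * s - (1 - β) / 2 * s = β * s := by ring
  have e1 : σ₀ * s ^ (1 / α) = σ := by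
    rw [hs, ← Real.rpow_mul (by positivity), mul_one_div_cancel h0.ne', Real.rpow_one]; field_simp
  refine ⟨(1 + β) / 2 * s, (1 - β) / 2 * s, δ - β * s * δ₀,
    mul_nonneg (by linarith [hβ.1]) hs0.le, mul_nonneg (by linarith [hβ.2]) hs0.le,
    by rw [hsum]; exact hs0, fun u => ?_⟩
  rw [h, h, stableExponent_add h0 hσ₀ (by rw [hsum]; exact hs0), hsum, hdiff, e1,
    mul_div_assoc, div_self hs0.ne', mul_one]
  unfold stableExponent
  split_ifs <;> push_cast <;> ring

/-- Conversely, such a Lévy exponent is the exponent of a stable law. -/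
theorem exists_levyExponent_add_eq_stableExponent {α p q : ℝ} (h0 : 0 < α) (h2 : α < 2)
    (hp : 0 ≤ p) (hq : 0 ≤ q) (hpq : 0 < p + q) :
    ∃ σ β δ : ℝ, 0 < σ ∧ β ∈ Set.Icc (-1 : ℝ) 1 ∧ ∀ u : ℝ,
      p * levyExponent α u + q * levyExponent α (-u) = stableExponent α σ β δ u := by
  obtain ⟨σ₀, δ₀, hσ₀, h⟩ := exists_levyExponent_eq_stableExponent h0 h2
  refine ⟨σ₀ * (p + q) ^ (1 / α), (p - q) / (p + q), (p - q) * δ₀, by positivity, ⟨?_, ?_⟩,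
    fun u => ?_⟩
  · rw [le_div_iff₀ hpq]; linarith
  · rw [div_le_iff₀ hpq]; linarith
  · rw [h, h, stableExponent_add h0 hσ₀ hpq]

/-! ### Convergence to a stable law through characteristic functions -/

section DomainOfAttraction

variable {Ω : Type*} [MeasurableSpace Ω] {P : Measure Ω} [IsProbabilityMeasure P] {X : Ω → ℝ}

theorem measurable_normalized_sum (hX : Measurable X) (n : ℕ) (a c : ℝ) :
    Measurable fun ω : Fin n → Ω => ((∑ i, X (ω i)) - c) / a := by fun_prop

theorem charFun_normalized_sum (hX : Measurable X) (n : ℕ) (a c t : ℝ) :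
    charFun ((Measure.pi fun _ : Fin n => P).map fun ω => ((∑ i, X (ω i)) - c) / a) t
      = charFun (P.map X) (t / a) ^ n * Complex.exp (-(Complex.I * ((t * (c / a) : ℝ) : ℂ))) := by
  have hind : iIndepFun (fun (i : Fin n) (ω : Fin n → Ω) => X (ω i)) (Measure.pi fun _ => P) :=
    iIndepFun_pi (X := fun _ => X) fun _ => hX.aemeasurable
  have hm : ∀ i : Fin n, Measurable fun ω : Fin n → Ω => X (ω i) := fun i =>
    hX.comp (measurable_pi_apply i)
  have h1 := hind.charFun_map_fun_sum_eq_prod fun i => (hm i).aemeasurable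
  have h2 : ∀ i : Fin n, (Measure.pi fun _ : Fin n => P).map (fun ω => X (ω i)) = P.map X := by
    intro i
    have := (measurePreserving_eval (fun _ : Fin n => P) i).map_eq
    conv_rhs => rw [← this, Measure.map_map hX (measurable_pi_apply i)]
    rfl
  have h3 : charFun ((Measure.pi fun _ : Fin n => P).map fun ω => ∑ i, X (ω i)) (t / a)
      = charFun (P.map X) (t / a) ^ n := by
    rw [h1]; simp [h2]
  rw [← h3, charFun_apply_real, charFun_apply_real, 
    integral_map (measurable_normalized_sum hX n a c).aemeasurable (by fun_prop),
    integral_map (Measurable.aemeasurable (by fun_prop)) (by fun_prop), ← integral_mul_const]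
  refine integral_congr_ae (.of_forall fun ω => ?_)
  simp only
  rw [← Complex.exp_add]
  congr 1
  push_cast
  ring

/-- Membership in a domain of attraction, written with characteristic functions. -/
theorem InDomainOfAttraction.tendsto_charFun {α : ℝ} (hX : Measurable X)
    (h : InDomainOfAttraction P X α) : ∃ (σ β δ : ℝ) (a θ : ℕ → ℝ), 0 < σ ∧ β ∈ Set.Icc (-1 : ℝ) 1 ∧
      (∀ n, 0 < a n) ∧ ∀ t : ℝ, Tendsto (fun n => charFun (P.map X) (t / a n) ^ n
        * Complex.exp (-(Complex.I * ((t * θ n : ℝ) : ℂ)))) atTop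
        (𝓝 (Complex.exp (stableExponent α σ β δ t))) := by
  obtain ⟨ρ, hρ, a, c, ⟨σ, β, δ, hσ, hβ, hch⟩, ha, hlim⟩ := h
  refine ⟨σ, β, δ, a, fun n => c n / a n, hσ, hβ, ha, fun t => ?_⟩
  have h1 := (ProbabilityMeasure.tendsto_iff_tendsto_charFun.1 hlim.tendsto) t
  simp only [ProbabilityMeasure.coe_mk, Measure.map_id] at h1
  rw [hch] at h1
  refine h1.congr fun n => ?_
  exact charFun_normalized_sum hX n (a n) (c n) t

/-- **Lévy's continuity theorem**, including the existence of the limit law. -/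
theorem exists_tendsto_of_tendsto_charFun {μ : ℕ → ProbabilityMeasure ℝ} {f : ℝ → ℂ}
    (hf : ContinuousAt f 0) (h : ∀ t, Tendsto (fun n => charFun (μ n : Measure ℝ) t) atTop (𝓝 (f t))) :
    ∃ ρ : ProbabilityMeasure ℝ, Tendsto μ atTop (𝓝 ρ) ∧ ∀ t, charFun (ρ : Measure ℝ) t = f t := by
  have htight := isTightMeasureSet_of_tendsto_charFun (μ := fun n => (μ n : Measure ℝ)) hf h
  have hset : {((m : ProbabilityMeasure ℝ) : Measure ℝ) | m ∈ Set.range μ}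
      = Set.range fun n => (μ n : Measure ℝ) := by
    ext m; simp
  have hcomp : IsCompact (closure (Set.range μ)) :=
    isCompact_closure_of_isTightMeasureSet (by rw [hset]; exact htight)
  obtain ⟨ρ, -, φ, hφ, hlim⟩ := hcomp.tendsto_subseq fun n => subset_closure (Set.mem_range_self n)
  have hch : ∀ t, charFun (ρ : Measure ℝ) t = f t := fun t =>
    tendsto_nhds_unique (ProbabilityMeasure.tendsto_iff_tendsto_charFun.1 hlim t)
      ((h t).comp hφ.tendsto_atTop)
  refine ⟨ρ, ProbabilityMeasure.tendsto_of_tendsto_charFun fun t => ?_, hch⟩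
  rw [hch]; exact h t

theorem inDomainOfAttraction_of_tendsto_charFun {α σ β δ : ℝ} {a θ : ℕ → ℝ} (hX : Measurable X)
    (hσ : 0 < σ) (hβ : β ∈ Set.Icc (-1 : ℝ) 1) (ha : ∀ n, 0 < a n)
    (hcont : ContinuousAt (stableExponent α σ β δ) 0)
    (h : ∀ t : ℝ, Tendsto (fun n => charFun (P.map X) (t / a n) ^ n
        * Complex.exp (-(Complex.I * ((t * θ n : ℝ) : ℂ)))) atTop
        (𝓝 (Complex.exp (stableExponent α σ β δ t)))) : InDomainOfAttraction P X α := by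
  have hmeas := fun n => measurable_normalized_sum hX n (a n) (θ n * a n)
  obtain ⟨μ, hμ⟩ : ∃ μ : ℕ → ProbabilityMeasure ℝ, ∀ n, (μ n : Measure ℝ) =
      (Measure.pi fun _ : Fin n => P).map fun ω => ((∑ i, X (ω i)) - θ n * a n) / a n :=
    ⟨fun n => ⟨_, Measure.isProbabilityMeasure_map (hmeas n).aemeasurable⟩, fun _ => rfl⟩
  have hconv : ∀ t, Tendsto (fun n => charFun (μ n : Measure ℝ) t) atTop
      (𝓝 (Complex.exp (stableExponent α σ β δ t))) := fun t => by
    refine (h t).congr fun n => ?_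
    rw [hμ, charFun_normalized_sum hX, mul_div_cancel_right₀ _ (ha n).ne']
  obtain ⟨ρ, hlim, hch⟩ := exists_tendsto_of_tendsto_charFun hcont.cexp hconv
  refine ⟨(ρ : Measure ℝ), inferInstance, a, fun n => θ n * a n, ⟨σ, β, δ, hσ, hβ, hch⟩, ha,
    fun n => (hmeas n).aemeasurable, aemeasurable_id, ?_⟩
  have hid : (⟨(ρ : Measure ℝ).map id, Measure.isProbabilityMeasure_map aemeasurable_id⟩ :
      ProbabilityMeasure ℝ) = ρ := Subtype.ext Measure.map_id
  rw [hid]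
  exact hlim.congr fun n => Subtype.ext (hμ n)

end DomainOfAttraction

theorem continuous_levyExponent {α : ℝ} (h0 : 0 < α) (h2 : α < 2) : Continuous (levyExponent α) := by
  refine continuous_iff_continuousAt.2 fun u => ?_
  have h := continuousWithinAt_laplaceExponent h0 h2 (-(Complex.I * u))
  refine Tendsto.comp h (tendsto_nhdsWithin_iff.2 ⟨?_, .of_forall fun v => ?_⟩)
  · have : Continuous fun v : ℝ => -(Complex.I * (v : ℂ)) := by fun_prop
    exact this.tendsto u
  · simp

/-! ### Tails and truncated moments of a measure on the line -/

section Law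

/-- Upper tail of a measure on the line. -/
noncomputable def upTail (μ : Measure ℝ) (t : ℝ) : ℝ := μ.real (Set.Ioi t)

/-- Lower tail of a measure on the line. -/
noncomputable def loTail (μ : Measure ℝ) (t : ℝ) : ℝ := μ.real (Set.Iio (-t))

/-- Two-sided tail of a measure on the line. -/
noncomputable def absTail (μ : Measure ℝ) (t : ℝ) : ℝ := μ.real {x | t < |x|}

/-- Truncated second moment of a measure on the line. -/
noncomputable def lawMoment (μ : Measure ℝ) (t : ℝ) : ℝ := ∫ x in {x | |x| ≤ t}, x ^ 2 ∂μ

/-- The functional `∫ min(1, (x/a)²) μ(dx)`, which measures the size of `μ` at scale `a`. -/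
noncomputable def scaledMoment (μ : Measure ℝ) (a : ℝ) : ℝ := ∫ x, min 1 ((x / a) ^ 2) ∂μ

variable (μ : Measure ℝ)

theorem measurableSet_abs_le (t : ℝ) : MeasurableSet {x : ℝ | |x| ≤ t} :=
  measurableSet_le (by fun_prop) (by fun_prop)

theorem measurableSet_lt_abs (t : ℝ) : MeasurableSet {x : ℝ | t < |x|} :=
  measurableSet_lt (by fun_prop) (by fun_prop)

theorem scaledMoment_nonneg (a : ℝ) : 0 ≤ scaledMoment μ a :=
  integral_nonneg fun x => by positivity

variable [IsFiniteMeasure μ]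

theorem absTail_eq_add {t : ℝ} (ht : 0 ≤ t) : absTail μ t = upTail μ t + loTail μ t := by
  unfold absTail upTail loTail
  rw [← measureReal_union _ measurableSet_Iio]
  · congr 1
    ext x
    simp [lt_abs, lt_neg]
  · rw [Set.disjoint_left]
    intro x h1 h2
    have h1 : t < x := h1
    have h2 : x < -t := h2
    linarith

theorem integrableOn_sq_abs_le (t : ℝ) : IntegrableOn (fun x : ℝ => x ^ 2) {x | |x| ≤ t} μ := by
  refine Integrable.mono' (integrable_const (t ^ 2)) (by fun_prop) ?_
  filter_upwards [ae_restrict_mem (measurableSet_abs_le t)] with x hx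
  have hx : |x| ≤ t := hx
  rw [Real.norm_of_nonneg (sq_nonneg x), ← sq_abs]
  gcongr

theorem antitone_upTail : Antitone (upTail μ) := fun _ _ h =>
  measureReal_mono (Set.Ioi_subset_Ioi h)

theorem antitone_loTail : Antitone (loTail μ) := fun _ _ h =>
  measureReal_mono (Set.Iio_subset_Iio (neg_le_neg h))

theorem antitone_absTail : Antitone (absTail μ) := fun _ _ h =>
  measureReal_mono fun _ hx => h.trans_lt hx

theorem tendsto_absTail : Tendsto (absTail μ) atTop (𝓝 0) := by
  have h : Tendsto (fun t : ℝ => μ {x | t < |x|}) atTop (𝓝 (μ (⋂ t : ℝ, {x | t < |x|}))) :=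
    tendsto_measure_iInter_atTop (fun t => (measurableSet_lt_abs t).nullMeasurableSet)
      (fun _ _ h _ hx => h.trans_lt hx) ⟨0, measure_ne_top _ _⟩
  have e : (⋂ t : ℝ, {x : ℝ | t < |x|}) = ∅ := by
    ext x
    simpa using ⟨|x|, le_rfl⟩
  rw [e, measure_empty] at h
  have := (ENNReal.tendsto_toReal ENNReal.zero_ne_top).comp h
  simp only [ENNReal.toReal_zero] at this
  exact this

theorem isTailMoment : IsTailMoment (absTail μ) (lawMoment μ) where
  tail_nonneg _ := measureReal_nonneg
  tail_anti := antitone_absTail μ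
  tail_lim := tendsto_absTail μ
  moment_nonneg _ := integral_nonneg fun _ => sq_nonneg _
  moment_mono s t h := setIntegral_mono_set (integrableOn_sq_abs_le μ t)
    (.of_forall fun _ => sq_nonneg _) (LE.le.eventuallyLE fun _ hx => le_trans hx h)
  lower s t hs hst := by
    have key : lawMoment μ t - lawMoment μ s = ∫ x in {x | |x| ≤ t} \ {x | |x| ≤ s}, x ^ 2 ∂μ := by
      rw [setIntegral_sdiff (measurableSet_abs_le s) (integrableOn_sq_abs_le μ t)
        fun x hx => le_trans hx hst]; rfl
    have key2 : absTail μ s - absTail μ t = μ.real ({x | |x| ≤ t} \ {x | |x| ≤ s}) := by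
      unfold absTail
      rw [← measureReal_sdiff (s₁ := {x : ℝ | s < |x|}) (s₂ := {x : ℝ | t < |x|})
        (fun x hx => lt_of_le_of_lt hst hx) (measurableSet_lt_abs t)]
      congr 1
      ext x
      simp [and_comm]
    rw [key, key2, mul_comm, ← smul_eq_mul, ← setIntegral_const]
    refine setIntegral_mono_on (integrable_const _) ((integrableOn_sq_abs_le μ t).mono_set
      Set.sdiff_subset) ((measurableSet_abs_le t).diff (measurableSet_abs_le s)) fun x hx => ?_
    have : s < |x| := not_le.1 hx.2
    rw [← sq_abs x]; gcongr
  upper s t hs hst := by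
    have key : lawMoment μ t - lawMoment μ s = ∫ x in {x | |x| ≤ t} \ {x | |x| ≤ s}, x ^ 2 ∂μ := by
      rw [setIntegral_sdiff (measurableSet_abs_le s) (integrableOn_sq_abs_le μ t)
        fun x hx => le_trans hx hst]; rfl
    have key2 : absTail μ s - absTail μ t = μ.real ({x | |x| ≤ t} \ {x | |x| ≤ s}) := by
      unfold absTail
      rw [← measureReal_sdiff (s₁ := {x : ℝ | s < |x|}) (s₂ := {x : ℝ | t < |x|})
        (fun x hx => lt_of_le_of_lt hst hx) (measurableSet_lt_abs t)]
      congr 1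
      ext x
      simp [and_comm]
    rw [key, key2, mul_comm, ← smul_eq_mul, ← setIntegral_const]
    refine setIntegral_mono_on ((integrableOn_sq_abs_le μ t).mono_set
      Set.sdiff_subset) (integrable_const _) ((measurableSet_abs_le t).diff (measurableSet_abs_le s))
      fun x hx => ?_
    have : |x| ≤ t := hx.1
    rw [← sq_abs x]; gcongr

theorem integrable_min_one_sq (a : ℝ) : Integrable (fun x : ℝ => min 1 ((x / a) ^ 2)) μ := by
  refine Integrable.mono' (integrable_const 1) (by fun_prop) (.of_forall fun x => ?_)
  rw [Real.norm_of_nonneg (by positivity)]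
  exact min_le_left _ _

theorem integrable_min_one_abs (a : ℝ) : Integrable (fun x : ℝ => min 1 |x / a|) μ := by
  refine Integrable.mono' (integrable_const 1) (by fun_prop) (.of_forall fun x => ?_)
  rw [Real.norm_of_nonneg (by positivity)]
  exact min_le_left _ _

theorem scaledMoment_eq {a : ℝ} (ha : 0 < a) :
    scaledMoment μ a = lawMoment μ a / a ^ 2 + absTail μ a := by
  unfold scaledMoment
  rw [← integral_add_compl (measurableSet_abs_le a) (integrable_min_one_sq μ a)]
  congr 1
  · rw [lawMoment, ← integral_div]
    refine setIntegral_congr_fun (measurableSet_abs_le a) fun x hx => ?_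
    have hx : |x| ≤ a := hx
    change min 1 ((x / a) ^ 2) = x ^ 2 / a ^ 2
    rw [div_pow, min_eq_right]
    rw [div_le_one (by positivity), ← sq_abs]
    gcongr
  · have : {x : ℝ | |x| ≤ a}ᶜ = {x | a < |x|} := by ext; simp
    rw [this, absTail, ← setIntegral_one_eq_measureReal]
    refine setIntegral_congr_fun (measurableSet_lt_abs a) fun x hx => ?_
    have hx : a < |x| := hx
    change min 1 ((x / a) ^ 2) = 1
    rw [div_pow, min_eq_left]
    rw [one_le_div (by positivity), ← sq_abs x]
    gcongr

/-- If the second moment is infinite, the truncated second moment is unbounded. -/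
theorem tendsto_lawMoment_atTop (h : ¬ Integrable (fun x : ℝ => x ^ 2) μ) :
    Tendsto (lawMoment μ) atTop atTop := by
  refine (isTailMoment μ).moment_mono.tendsto_atTop_atTop fun B => ?_
  by_contra! hcon
  refine h ((aecover_closedBall (x := (0 : ℝ)) tendsto_natCast_atTop_atTop (μ := μ)
      (r := fun n : ℕ => (n : ℝ))).integrable_of_integral_norm_bounded B (fun n => ?_)
      (.of_forall fun n => ?_))
  all_goals
    have e : Metric.closedBall (0 : ℝ) n = {x | |x| ≤ (n : ℝ)} := by ext; simp
    rw [e]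
  · exact integrableOn_sq_abs_le μ n
  · simpa [lawMoment] using (hcon n).le

/-- The square of the integral is negligible with respect to the integral of the square, for
truncations `f a` of the identity whose second moment diverges. -/
theorem tendsto_sq_integral_div {f : ℝ → ℝ → ℝ}
    (hf0 : ∀ a x, 0 ≤ f a x) (hf1 : ∀ a x, f a x ≤ |x|)
    (hint : ∀ a, Integrable (f a) μ) (hint2 : ∀ a, Integrable (fun x => f a x ^ 2) μ)
    (hlim : Tendsto (fun a => ∫ x, f a x ^ 2 ∂μ) atTop atTop) :
    Tendsto (fun a => (∫ x, f a x ∂μ) ^ 2 / ∫ x, f a x ^ 2 ∂μ) atTop (𝓝 0) := by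
  have hμ0 : 0 ≤ μ.real Set.univ := measureReal_nonneg
  refine tendsto_order.2 ⟨fun c hc => .of_forall fun a => hc.trans_le (by positivity),
    fun c hc => ?_⟩
  set e := c / 4 with he
  have he0 : 0 < e := by positivity
  obtain ⟨K, hK, hK0⟩ := (((tendsto_absTail μ).eventually_lt_const he0).and
    (eventually_ge_atTop 0)).exists
  filter_upwards [hlim.eventually_gt_atTop 0,
    hlim.eventually_gt_atTop (4 * (K * μ.real Set.univ) ^ 2 / c)] with a hM hM2
  set M := ∫ x, f a x ^ 2 ∂μ with hMdef
  -- split at `K`, with the Cauchy-Schwarz inequality on `{K < |x|}`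
  set s := Real.sqrt (e / M) with hs
  have hs0 : 0 < s := Real.sqrt_pos.2 (by positivity)
  have hss : s * s = e / M := Real.mul_self_sqrt (by positivity)
  have h1 : ∀ x, f a x ≤ K + (s / 2 * f a x ^ 2 + 1 / (2 * s) *
      Set.indicator {x | K < |x|} (fun _ => (1 : ℝ)) x) := by
    intro x
    by_cases hx : K < |x|
    · rw [Set.indicator_of_mem (by exact hx)]
      have : s / 2 * f a x ^ 2 + 1 / (2 * s) * 1 - f a x = (s * f a x - 1) ^ 2 / (2 * s) := by
        field_simp; ring
      have h3 : 0 ≤ (s * f a x - 1) ^ 2 / (2 * s) := by positivity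
      linarith
    · rw [Set.indicator_of_notMem (by exact hx)]
      have := hf1 a x
      have h4 : 0 ≤ s / 2 * f a x ^ 2 := by positivity
      simp only [mul_zero, add_zero]
      linarith [not_lt.1 hx]
  have hind : Integrable (Set.indicator {x : ℝ | K < |x|} fun _ => (1 : ℝ)) μ :=
    (integrable_const 1).indicator (measurableSet_lt_abs K)
  have h2 := integral_mono (hint a) ((integrable_const K).add
    (((hint2 a).const_mul (s / 2)).add (hind.const_mul (1 / (2 * s))))) h1
  have e1 := integral_add (integrable_const K) (((hint2 a).const_mul (s / 2)).add
    (hind.const_mul (1 / (2 * s))))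
  have e2 := integral_add ((hint2 a).const_mul (s / 2)) (hind.const_mul (1 / (2 * s)))
  simp only [Pi.add_apply] at h2 e1
  rw [e1, e2,
    integral_const_mul, integral_const_mul, integral_indicator (measurableSet_lt_abs K),
    setIntegral_one_eq_measureReal, integral_const, smul_eq_mul, ← hMdef] at h2
  have h3 : 1 / (2 * s) * μ.real {x | K < |x|} ≤ 1 / (2 * s) * e := by
    gcongr; exact hK.le
  have h4 : s / 2 * M + 1 / (2 * s) * e = s * M := by
    have : e = s * s * M := by rw [hss]; field_simp
    rw [this]; field_simp; ring
  have h5 : ∫ x, f a x ∂μ ≤ K * μ.real Set.univ + s * M := by linarith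
  have h0 : 0 ≤ ∫ x, f a x ∂μ := integral_nonneg (hf0 a)
  rw [div_lt_iff₀ hM]
  have h6 : (s * M) ^ 2 = e * M := by rw [mul_pow, pow_two s, hss]; field_simp
  rw [div_lt_iff₀ hc] at hM2
  have h7 : (∫ x, f a x ∂μ) ^ 2 ≤ (K * μ.real Set.univ + s * M) ^ 2 := by gcongr
  nlinarith [sq_nonneg (K * μ.real Set.univ - s * M)]

/-- When the second moment is infinite, the square of the first truncated moment at scale `a` is
negligible with respect to the second one. -/
theorem tendsto_sq_integral_min_div (h : ¬ Integrable (fun x : ℝ => x ^ 2) μ) :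
    Tendsto (fun a => (∫ x, min 1 |x / a| ∂μ) ^ 2 / scaledMoment μ a) atTop (𝓝 0) := by
  have hpt : ∀ a x : ℝ, 0 < a → min |a| |x| = a * min 1 |x / a| := by
    intro a x ha
    rw [abs_div, abs_of_pos ha, mul_min_of_nonneg _ _ ha.le]
    field_simp
  have hpt2 : ∀ a x : ℝ, 0 < a → min |a| |x| ^ 2 = a ^ 2 * min 1 ((x / a) ^ 2) := by
    intro a x ha
    rw [hpt a x ha, mul_pow, ← sq_abs (x / a)]
    congr 1
    rcases le_total 1 |x / a| with h | h
    · rw [min_eq_left h, min_eq_left (one_le_pow₀ h), one_pow]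
    · rw [min_eq_right h, min_eq_right (pow_le_one₀ (abs_nonneg _) h)]
  have key := tendsto_sq_integral_div μ (f := fun a x => min |a| |x|)
    (fun a x => by positivity) (fun a x => min_le_right _ _)
    (fun a => Integrable.mono' (integrable_const |a|) (by fun_prop) (.of_forall fun x => by
      rw [Real.norm_of_nonneg (by positivity)]; exact min_le_left _ _))
    (fun a => Integrable.mono' (integrable_const (|a| ^ 2)) (by fun_prop) (.of_forall fun x => by
      rw [Real.norm_of_nonneg (by positivity)]; gcongr; exact min_le_left _ _)) (by
      refine tendsto_atTop_mono' _ ?_ (tendsto_lawMoment_atTop μ h)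
      filter_upwards [eventually_gt_atTop 0] with a ha
      simp_rw [hpt2 a _ ha]
      rw [integral_const_mul, ← scaledMoment, scaledMoment_eq μ ha]
      have := (isTailMoment μ).tail_nonneg a
      have h3 : 0 ≤ a ^ 2 * absTail μ a := by positivity
      rw [mul_add, mul_div_cancel₀ _ (by positivity)]
      linarith)
  refine key.congr' ?_
  filter_upwards [eventually_gt_atTop 0] with a ha
  simp_rw [hpt2 a _ ha, hpt a _ ha]
  rw [integral_const_mul, integral_const_mul, ← scaledMoment, mul_pow]
  field_simp

theorem norm_charFun_sub_one_le [IsProbabilityMeasure μ] (t a : ℝ) :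
    ‖charFun μ (t / a) - 1‖ ≤ (|t| + 2) * ∫ x, min 1 |x / a| ∂μ := by
  have h1 : charFun μ (t / a) - 1 = ∫ x, (Complex.exp (((t / a : ℝ) : ℂ) * x * Complex.I) - 1) ∂μ := by
    rw [integral_sub _ (integrable_const 1), integral_const, charFun_apply_real]
    · simp
    · refine Integrable.mono' (integrable_const 1) (by fun_prop) (.of_forall fun x => ?_)
      rw [← Complex.ofReal_mul, Complex.norm_exp_ofReal_mul_I]
  rw [h1, ← integral_const_mul]
  refine norm_integral_le_of_norm_le ((integrable_min_one_abs μ a).const_mul _)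
    (.of_forall fun x => ?_)
  have e : ((t / a : ℝ) : ℂ) * x * Complex.I = Complex.I * ((t * (x / a) : ℝ) : ℂ) := by
    push_cast; ring
  rw [e]
  have h2 := Real.norm_exp_I_mul_ofReal_sub_one_le (x := t * (x / a))
  have h3 : ‖Complex.exp (Complex.I * ((t * (x / a) : ℝ) : ℂ)) - 1‖ ≤ 2 := by
    refine (norm_sub_le _ _).trans ?_
    rw [mul_comm, Complex.norm_exp_ofReal_mul_I]; norm_num
  rw [Real.norm_eq_abs, abs_mul] at h2
  rcases le_total 1 |x / a| with h | h
  · rw [min_eq_left h]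
    nlinarith [abs_nonneg t]
  · rw [min_eq_right h]
    nlinarith [abs_nonneg (x / a)]

end Law

/-- Powers of `1 + z n` behave like `exp (n z n)` when `n |z n|² → 0`. -/
theorem tendsto_one_add_pow_mul_exp {z : ℕ → ℂ} (h : Tendsto (fun n : ℕ => n * ‖z n‖ ^ 2) atTop (𝓝 0)) :
    Tendsto (fun n : ℕ => (1 + z n) ^ n * Complex.exp (-(n * z n))) atTop (𝓝 1) := by
  have hz : ∀ᶠ n : ℕ in atTop, ‖z n‖ ≤ 1 / 2 := by
    filter_upwards [h.eventually_lt_const (show (0 : ℝ) < 1 / 4 by norm_num),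
      eventually_ge_atTop 1] with n hn h1
    have h1 : (1 : ℝ) ≤ n := by exact_mod_cast h1
    by_contra! hcon
    nlinarith [sq_nonneg ‖z n‖]
  have hlog : Tendsto (fun n : ℕ => (n : ℂ) * (Complex.log (1 + z n) - z n)) atTop (𝓝 0) := by
    refine squeeze_zero_norm' ?_ h
    filter_upwards [hz] with n hn
    have h1 := Complex.norm_log_one_add_sub_self_le (z := z n) (by linarith)
    rw [norm_mul, Complex.norm_natCast]
    gcongr
    refine h1.trans ?_
    have : (1 - ‖z n‖)⁻¹ ≤ 2 := by
      rw [inv_le_comm₀ (by linarith) (by norm_num)]; linarith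
    nlinarith [sq_nonneg ‖z n‖]
  have h2 := (Complex.continuous_exp.tendsto 0).comp hlog
  rw [Complex.exp_zero] at h2
  refine h2.congr' ?_
  filter_upwards [hz] with n hn
  have hne : 1 + z n ≠ 0 := by
    intro h0
    have : z n = -1 := by linear_combination h0
    rw [this] at hn; norm_num at hn
  simp only [Function.comp]
  rw [mul_sub, sub_eq_add_neg, Complex.exp_add, Complex.exp_nat_mul, Complex.exp_log hne]

/-! ### Regularly varying tails give attraction to a stable law -/

/-- Convergence of the upper tails at every point implies weak convergence. -/
theorem tendsto_probabilityMeasure_of_Ioi {ρ : ℕ → ProbabilityMeasure ℝ} {ν : ProbabilityMeasure ℝ}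
    (h : ∀ x, Tendsto (fun n => (ρ n : Measure ℝ).real (Set.Ioi x)) atTop
      (𝓝 ((ν : Measure ℝ).real (Set.Ioi x)))) : Tendsto ρ atTop (𝓝 ν) := by
  have hset : ∀ (m : ProbabilityMeasure ℝ) (x y : ℝ), x ≤ y → (m : Measure ℝ).real (Set.Ioc x y)
      = (m : Measure ℝ).real (Set.Ioi x) - (m : Measure ℝ).real (Set.Ioi y) := by
    intro m x y hxy
    rw [← measureReal_sdiff (Set.Ioi_subset_Ioi hxy) measurableSet_Ioi]
    congr 1; ext z; simp
  refine IsPiSystem.tendsto_probabilityMeasure_of_tendsto_of_mem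
    (isPiSystem_Ioc (id : ℝ → ℝ) (id : ℝ → ℝ)) ?_ ?_ ?_
  · rintro s ⟨x, y, hxy, rfl⟩; exact measurableSet_Ioc
  · intro u hu x hx
    obtain ⟨e, he, hsub⟩ := Metric.isOpen_iff.1 hu x hx
    refine ⟨Set.Ioc (x - e / 2) (x + e / 2), ⟨x - e / 2, x + e / 2, by simp; linarith, rfl⟩,
      Ioc_mem_nhds (by linarith) (by linarith), fun y hy => hsub ?_⟩
    rw [Metric.mem_ball, Real.dist_eq, abs_lt]
    constructor <;> linarith [hy.1, hy.2]
  · rintro s ⟨x, y, hxy, rfl⟩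
    have hxy : x ≤ y := le_of_lt hxy
    have h1 := (h x).sub (h y)
    rw [← hset ν x y hxy] at h1
    refine NNReal.tendsto_coe.1 (h1.congr fun n => ?_)
    rw [← hset (ρ n) x y hxy]; rfl

/-- The Pareto law is the normalised restriction of the one-sided stable Lévy measure to
`(e, ∞)`. -/
theorem integral_paretoMeasure {e α : ℝ} (he : 0 < e) (hα : 0 < α) (f : ℝ → ℂ) :
    ∫ x, f x ∂(paretoMeasure e α)
      = (α * e ^ α : ℝ) * ∫ x in Set.Ioi e, f x * levyWeight α x := by
  have hm : Measurable (paretoPDF e α) := (measurable_paretoPDFReal e α).ennreal_ofReal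
  rw [paretoMeasure, integral_withDensity_eq_integral_toReal_smul hm (.of_forall fun x => by
    simp [paretoPDF]), ← integral_const_mul, ← integral_Ici_eq_integral_Ioi,
    ← integral_indicator measurableSet_Ici]
  refine integral_congr_ae (.of_forall fun x => ?_)
  simp only [paretoPDF]
  rw [ENNReal.toReal_ofReal (paretoPDFReal_nonneg he.le hα.le x), paretoPDFReal]
  by_cases hx : e ≤ x
  · rw [if_pos hx, Set.indicator_of_mem (by exact hx), levyWeight, Complex.real_smul,
      show -α - 1 = -(α + 1) by ring]
    push_cast; ring
  · rw [if_neg hx, Set.indicator_of_notMem (by exact hx), zero_smul]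

theorem integral_levyWeight_Ioi {α x : ℝ} (hα : 0 < α) (hx : 0 < x) :
    ∫ y in Set.Ioi x, y ^ (-α - 1) = x ^ (-α) / α := by
  rw [integral_Ioi_rpow_of_lt (by linarith) hx, sub_add_cancel]
  field_simp

theorem paretoMeasure_real_Ioi {e α x : ℝ} (he : 0 < e) (hα : 0 < α) :
    (paretoMeasure e α).real (Set.Ioi x) = (max x e / e) ^ (-α) := by
  have := isProbabilityMeasure_paretoMeasure he hα
  have h1 : (((paretoMeasure e α).real (Set.Ioi x) : ℝ) : ℂ)
      = ∫ y, Set.indicator (Set.Ioi x) (fun _ => (1 : ℂ)) y ∂(paretoMeasure e α) := by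
    rw [integral_indicator measurableSet_Ioi]; simp
  have h2 : ∫ y in Set.Ioi e, Set.indicator (Set.Ioi x) (fun _ => (1 : ℂ)) y * levyWeight α y
      = ∫ y in Set.Ioi (max x e), levyWeight α y := by
    have : ∀ y, Set.indicator (Set.Ioi x) (fun _ => (1 : ℂ)) y * levyWeight α y
        = Set.indicator (Set.Ioi x) (levyWeight α) y := by
      intro y
      by_cases hy : y ∈ Set.Ioi x <;> simp [hy]
    simp_rw [this]
    rw [setIntegral_indicator measurableSet_Ioi, Set.Ioi_inter_Ioi, max_comm]
  have hm : 0 < max x e := lt_max_of_lt_right he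
  rw [integral_paretoMeasure he hα, h2] at h1
  unfold levyWeight at h1
  rw [integral_complex_ofReal, integral_levyWeight_Ioi hα hm] at h1
  have h3 : (paretoMeasure e α).real (Set.Ioi x) = α * e ^ α * (max x e ^ (-α) / α) := by
    exact_mod_cast h1
  rw [h3, Real.div_rpow hm.le he.le, Real.rpow_neg he.le]
  field_simp

section OneSided

variable {μ : Measure ℝ} [IsProbabilityMeasure μ] {α c : ℝ} {a : ℕ → ℝ}

theorem integrable_comp_div {f : ℝ → ℂ} {C : ℝ} (hf : Continuous f)
    (hC : ∀ x, ‖f x‖ ≤ C * min 1 (x ^ 2)) (b : ℝ) : Integrable (fun x => f (x / b)) μ := by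
  refine Integrable.mono' ((integrable_min_one_sq μ b).const_mul C) (by fun_prop)
    (.of_forall fun x => hC _)

/-- Vague convergence of the rescaled measures away from the origin. -/
theorem tendsto_integral_Ioi_mul (h0 : 0 < α) (hc : 0 ≤ c) (ha : ∀ n, 0 < a n)
    (h1 : ∀ x, 0 < x → Tendsto (fun n : ℕ => n * upTail μ (x * a n)) atTop (𝓝 (c * x ^ (-α))))
    {f : ℝ → ℂ} {C : ℝ} (hf : Continuous f) (hC : ∀ x, ‖f x‖ ≤ C * min 1 (x ^ 2)) {e : ℝ}
    (he : 0 < e) :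
    Tendsto (fun n : ℕ => (n : ℂ) * ∫ x in Set.Ioi (e * a n), f (x / a n) ∂μ) atTop
      (𝓝 ((c * α : ℝ) * ∫ x in Set.Ioi e, f x * levyWeight α x)) := by
  have hC0 : 0 ≤ C := by simpa using (norm_nonneg _).trans (hC 1)
  have hbd : ∀ x, ‖f x‖ ≤ C := fun x =>
    (hC x).trans (mul_le_of_le_one_right hC0 (min_le_left _ _))
  rcases hc.eq_or_lt with rfl | hc
  · simp only [zero_mul, Complex.ofReal_zero]
    have h2 := (h1 e he).const_mul C
    simp only [zero_mul, mul_zero] at h2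
    refine squeeze_zero_norm (fun n => ?_) h2
    rw [norm_mul, Complex.norm_natCast]
    have := norm_setIntegral_le_of_norm_le_const (μ := μ) (s := Set.Ioi (e * a n)) (C := C)
      (measure_lt_top _ _) (fun x _ => hbd (x / a n))
    have h3 : 0 ≤ (n : ℝ) := by positivity
    calc _ ≤ (n : ℝ) * (C * upTail μ (e * a n)) := by gcongr; exact this
      _ = _ := by ring
  -- normalise the restrictions to `(e a n, ∞)` and compare with a Pareto law
  have hpos : 0 < c * e ^ (-α) := by positivity
  obtain ⟨N, hN⟩ := eventually_atTop.1 ((h1 e he).eventually_const_lt hpos)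
  have hup : ∀ n, 0 < upTail μ (e * a (n + N)) := by
    intro n
    have := hN (n + N) (by omega)
    exact (pos_iff_pos_of_mul_pos this).1 (by
      by_contra hcon
      have h3 : 0 ≤ ((n + N : ℕ) : ℝ) := by positivity
      have : ((n + N : ℕ) : ℝ) = 0 := le_antisymm (not_lt.1 hcon) h3
      simp_all)
  have hne : ∀ n, μ (Set.Ioi (e * a (n + N))) ≠ 0 := fun n h => by
    have := hup n
    simp [upTail, Measure.real, h] at this
  set m : ℕ → Measure ℝ := fun n =>
    (μ[|Set.Ioi (e * a (n + N))]).map (fun x => x / a (n + N)) with hm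
  have hmp : ∀ n, IsProbabilityMeasure (m n) := fun n => by
    have := cond_isProbabilityMeasure (hne n)
    exact Measure.isProbabilityMeasure_map (by fun_prop)
  have hpar := isProbabilityMeasure_paretoMeasure he h0
  have hshift : ∀ x, 0 < x → Tendsto (fun n : ℕ => ((n + N : ℕ) : ℝ) * upTail μ (x * a (n + N)))
      atTop (𝓝 (c * x ^ (-α))) := fun x hx => (tendsto_add_atTop_iff_nat N).2 (h1 x hx)
  have hweak : Tendsto (β := ProbabilityMeasure ℝ) (fun n => ⟨m n, hmp n⟩) atTop
      (𝓝 ⟨paretoMeasure e α, hpar⟩) := by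
    refine tendsto_probabilityMeasure_of_Ioi fun x => ?_
    simp only [ProbabilityMeasure.coe_mk]
    rw [paretoMeasure_real_Ioi he h0]
    have hmx : 0 < max x e := lt_max_of_lt_right he
    have h3 := (hshift _ hmx).div (hshift e he) hpos.ne'
    have h4 : c * max x e ^ (-α) / (c * e ^ (-α)) = (max x e / e) ^ (-α) := by
      rw [Real.div_rpow hmx.le he.le]; field_simp
    rw [h4] at h3
    refine h3.congr' ?_
    filter_upwards [eventually_ge_atTop 1] with n hn
    have hnN : ((n + N : ℕ) : ℝ) ≠ 0 := by positivity
    have h5 : (m n).real (Set.Ioi x) = upTail μ (max x e * a (n + N)) / upTail μ (e * a (n + N)) := by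
      have han := ha (n + N)
      rw [hm, map_measureReal_apply (by fun_prop) measurableSet_Ioi,
        Measure.real, cond_apply measurableSet_Ioi, ENNReal.toReal_mul, ENNReal.toReal_inv]
      have : Set.Ioi (e * a (n + N)) ∩ (fun x => x / a (n + N)) ⁻¹' Set.Ioi x
          = Set.Ioi (max x e * a (n + N)) := by
        ext y
        simp only [Set.mem_inter_iff, Set.mem_Ioi, Set.mem_preimage, lt_div_iff₀ han,
          max_mul_of_nonneg _ _ han.le, max_lt_iff]
        exact and_comm
      rw [this, upTail, upTail, div_eq_inv_mul]; rfl
    rw [h5]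
    simp only [Pi.div_apply]
    field_simp
  have h6 := (ProbabilityMeasure.tendsto_iff_forall_integral_rclike_tendsto ℂ).1 hweak
    (BoundedContinuousFunction.ofNormedAddCommGroup f hf C hbd)
  simp only [ProbabilityMeasure.coe_mk, BoundedContinuousFunction.coe_ofNormedAddCommGroup] at h6
  rw [integral_paretoMeasure he h0] at h6
  have h7 := ((Complex.continuous_ofReal.tendsto _).comp (hshift e he)).mul h6
  refine (tendsto_add_atTop_iff_nat N).1 ?_
  have h8 : ((c * e ^ (-α) : ℝ) : ℂ) * ((α * e ^ α : ℝ) * ∫ x in Set.Ioi e, f x * levyWeight α x)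
      = (c * α : ℝ) * ∫ x in Set.Ioi e, f x * levyWeight α x := by
    rw [← mul_assoc, ← Complex.ofReal_mul]
    congr 2
    rw [Real.rpow_neg he.le]; field_simp
  rw [h8] at h7
  refine h7.congr fun n => ?_
  have h9 : ∫ x, f x ∂(m n) = ((upTail μ (e * a (n + N)))⁻¹ : ℝ) *
      ∫ x in Set.Ioi (e * a (n + N)), f (x / a (n + N)) ∂μ := by
    rw [hm, integral_map (by fun_prop) (by fun_prop), ProbabilityTheory.cond,
      integral_smul_measure, Complex.real_smul, ENNReal.toReal_inv]
    rfl
  rw [h9]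
  simp only [Function.comp]
  have h10 : (upTail μ (e * a (n + N)) : ℂ) ≠ 0 := by exact_mod_cast (hup n).ne'
  push_cast
  field_simp

/-- Vague convergence of the rescaled measures on `(0, ∞)`, tested against bounded continuous
functions that vanish quadratically at the origin. -/
theorem tendsto_integral_Ioi_zero (h0 : 0 < α) (h2 : α < 2) (hc : 0 ≤ c) (ha : ∀ n, 0 < a n)
    (h1 : ∀ x, 0 < x → Tendsto (fun n : ℕ => n * upTail μ (x * a n)) atTop (𝓝 (c * x ^ (-α))))
    (hsmall : ∀ η, 0 < η → ∀ᶠ e in 𝓝[>] (0 : ℝ), ∀ᶠ n : ℕ in atTop,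
      n * (lawMoment μ (e * a n) / a n ^ 2) ≤ η)
    {f : ℝ → ℂ} {C : ℝ} (hf : Continuous f) (hC : ∀ x, ‖f x‖ ≤ C * min 1 (x ^ 2)) :
    Tendsto (fun n : ℕ => (n : ℂ) * ∫ x in Set.Ioi 0, f (x / a n) ∂μ) atTop
      (𝓝 ((c * α : ℝ) * ∫ x in Set.Ioi 0, f x * levyWeight α x)) := by
  have hC0 : 0 ≤ C := by simpa using (norm_nonneg _).trans (hC 1)
  have hid : Tendsto (fun e : ℝ => e) (𝓝[>] 0) (𝓝 0) := nhdsWithin_le_nhds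
  -- split at a small level `e`: the part in `(0, e a n]` is bounded by the truncated second moment
  have hcover := (aecover_Ioi_of_Ioi (μ := volume) hid).integral_tendsto_of_countably_generated
    (integrableOn_mul_levyWeight h0 h2 hf.measurable fun x _ => hC x)
  have hF := hcover.const_mul ((c * α : ℝ) : ℂ)
  refine Metric.tendsto_atTop'.2 fun η hη => ?_
  have hη3 : 0 < η / 3 := by positivity
  obtain ⟨e, ⟨⟨hFe, hse⟩, he⟩⟩ := (((Metric.tendsto_nhds.1 hF (η / 3) hη3).and
    (hsmall (η / 3 / (C + 1)) (by positivity))).and self_mem_nhdsWithin).exists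
  have he : 0 < e := he
  have hmid := Metric.tendsto_nhds.1 (tendsto_integral_Ioi_mul h0 hc ha h1 hf hC he) (η / 3) hη3
  rw [Measure.restrict_restrict measurableSet_Ioi, Set.Ioi_inter_Ioi, sup_of_le_left he.le] at hFe
  obtain ⟨N, hN⟩ := eventually_atTop.1 (hmid.and hse)
  refine ⟨N, fun n hn => ?_⟩
  obtain ⟨hm1, hm2⟩ := hN n hn.le
  have hea : 0 < e * a n := mul_pos he (ha n)
  have hint := integrable_comp_div (μ := μ) hf hC (a n)
  have hsplit : ∫ x in Set.Ioi 0, f (x / a n) ∂μ = (∫ x in Set.Ioc 0 (e * a n), f (x / a n) ∂μ)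
      + ∫ x in Set.Ioi (e * a n), f (x / a n) ∂μ := by
    rw [← Set.Ioc_union_Ioi_eq_Ioi hea.le, setIntegral_union
      (Set.Ioc_disjoint_Ioi le_rfl) measurableSet_Ioi hint.integrableOn
      hint.integrableOn]
  have hsm : ‖∫ x in Set.Ioc 0 (e * a n), f (x / a n) ∂μ‖ ≤ C * (lawMoment μ (e * a n) / a n ^ 2) := by
    have hsub : Set.Ioc 0 (e * a n) ⊆ {x | |x| ≤ e * a n} := fun x hx => by
      change |x| ≤ _
      rw [abs_of_pos hx.1]; exact hx.2
    have hi2 := (integrableOn_sq_abs_le μ (e * a n)).mono_set hsub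
    calc _ ≤ ∫ x in Set.Ioc 0 (e * a n), C * (x ^ 2 / a n ^ 2) ∂μ := by
          refine norm_integral_le_of_norm_le ((hi2.div_const _).const_mul C)
            (.of_forall fun x => (hC _).trans ?_)
          rw [← div_pow]
          gcongr
          exact min_le_right _ _
      _ = C * ((∫ x in Set.Ioc 0 (e * a n), x ^ 2 ∂μ) / a n ^ 2) := by
          rw [integral_const_mul, integral_div]
      _ ≤ _ := by
          gcongr
          exact setIntegral_mono_set (integrableOn_sq_abs_le μ _) (.of_forall fun x => sq_nonneg x)
            (LE.le.eventuallyLE hsub)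
  have hfirst : ‖(n : ℂ) * ∫ x in Set.Ioc 0 (e * a n), f (x / a n) ∂μ‖ < η / 3 := by
    rw [norm_mul, Complex.norm_natCast]
    calc _ ≤ (n : ℝ) * (C * (lawMoment μ (e * a n) / a n ^ 2)) := by gcongr
      _ = C * (n * (lawMoment μ (e * a n) / a n ^ 2)) := by ring
      _ ≤ C * (η / 3 / (C + 1)) := by gcongr
      _ < η / 3 := by
        rw [← mul_div_assoc, div_lt_iff₀ (by positivity)]; nlinarith
  rw [hsplit, mul_add]
  rw [dist_eq_norm] at *
  set A := (n : ℂ) * ∫ x in Set.Ioc 0 (e * a n), f (x / a n) ∂μ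
  set B := (n : ℂ) * ∫ x in Set.Ioi (e * a n), f (x / a n) ∂μ
  set L := ((c * α : ℝ) : ℂ) * ∫ x in Set.Ioi e, f x * levyWeight α x
  set L' := ((c * α : ℝ) : ℂ) * ∫ x in Set.Ioi 0, f x * levyWeight α x
  have e1 : A + B - L' = A + (B - L) + (L - L') := by ring
  rw [e1]
  have := norm_add₃_le (a := A) (b := B - L) (c := L - L')
  linarith

end OneSided

/-- Norming constants: `n T(a n) → 1` for a regularly varying tail `T` of negative index. -/
theorem exists_norming {T : ℝ → ℝ} {ρ : ℝ} (hanti : Antitone T) (hlim : Tendsto T atTop (𝓝 0))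
    (hT : RegVar T ρ) : ∃ a : ℕ → ℝ, (∀ n, 0 < a n) ∧ Tendsto a atTop atTop ∧
      Tendsto (fun n : ℕ => n * T (a n)) atTop (𝓝 1) := by
  have hpos : ∀ t, 0 < T t := fun t => by
    obtain ⟨s, hs, hts⟩ := (hT.eventually_pos.and (eventually_ge_atTop t)).exists
    exact hs.trans_le (hanti hts)
  -- `a n` is a generalized inverse of `T` at `1 / (n + 1)`, kept above `1` to be positive; regular
  -- variation bounds the jump of `T` at `a n`
  set S : ℕ → Set ℝ := fun n => {t | 1 ≤ t ∧ T t ≤ 1 / ((n : ℝ) + 1)} with hS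
  have hne : ∀ n, (S n).Nonempty := fun n => by
    have h1 : (0 : ℝ) < 1 / ((n : ℝ) + 1) := by positivity
    obtain ⟨t, ht, ht1⟩ := ((hlim.eventually_lt_const h1).and (eventually_ge_atTop 1)).exists
    exact ⟨t, ht1, ht.le⟩
  have hbdd : ∀ n, BddBelow (S n) := fun n => ⟨1, fun t ht => ht.1⟩
  set a : ℕ → ℝ := fun n => sInf (S n) with ha
  have ha1 : ∀ n, 1 ≤ a n := fun n => le_csInf (hne n) fun t ht => ht.1
  have hup : ∀ n t, a n < t → T t ≤ 1 / ((n : ℝ) + 1) := fun n t ht => by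
    obtain ⟨s, hs, hst⟩ := exists_lt_of_csInf_lt (hne n) ht
    exact (hanti hst.le).trans hs.2
  have hlow : ∀ n t, 1 ≤ t → t < a n → 1 / ((n : ℝ) + 1) < T t := fun n t h1 ht => by
    by_contra! hcon
    exact not_lt.2 (csInf_le (hbdd n) ⟨h1, hcon⟩) ht
  have hatop : Tendsto a atTop atTop := by
    refine tendsto_atTop.2 fun B => ?_
    have h1 := (tendsto_one_div_add_atTop_nhds_zero_nat (𝕜 := ℝ)).eventually_lt_const (hpos B)
    filter_upwards [h1] with n hn
    by_contra! hcon
    exact not_le.2 hn (hup n B hcon)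
  have hlim1 : Tendsto (fun n : ℕ => ((n : ℝ) + 1) * T (a n)) atTop (𝓝 1) := by
    have hc1 : Tendsto (fun x : ℝ => (x ^ ρ)⁻¹) (𝓝 1) (𝓝 1) := by
      have := (Real.continuousAt_rpow_const 1 ρ (Or.inl one_ne_zero)).tendsto.inv₀ (by simp)
      simpa using this
    refine tendsto_order.2 ⟨fun C hC => ?_, fun C hC => ?_⟩
    · have h1 : ∀ᶠ x in 𝓝[<] (1 : ℝ), C < (x ^ ρ)⁻¹ :=
        (hc1.mono_left nhdsWithin_le_nhds).eventually_const_lt hC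
      have h2 : ∀ᶠ x in 𝓝[<] (1 : ℝ), 0 < x := nhdsWithin_le_nhds (lt_mem_nhds one_pos)
      obtain ⟨x, ⟨hx, hx0⟩, hx1⟩ := ((h1.and h2).and self_mem_nhdsWithin).exists
      have hx1 : x < 1 := hx1
      have h3 := (((hT.2.2 x hx0).inv₀ (by positivity)).comp hatop).eventually_const_lt hx
      filter_upwards [h3, (hatop.const_mul_atTop hx0).eventually_ge_atTop 1] with n hn hn1
      refine hn.trans ?_
      simp only [Function.comp, inv_div]
      have h4 := hlow n (x * a n) hn1 (by nlinarith [ha1 n])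
      rw [div_lt_iff₀ (hpos _)]
      rw [div_lt_iff₀ (by positivity)] at h4
      have h5 := hpos (a n)
      nlinarith
    · have h1 : ∀ᶠ x in 𝓝[>] (1 : ℝ), (x ^ ρ)⁻¹ < C :=
        (hc1.mono_left nhdsWithin_le_nhds).eventually_lt_const hC
      obtain ⟨x, hx, hx1⟩ := (h1.and self_mem_nhdsWithin).exists
      have hx1 : 1 < x := hx1
      have hx0 : 0 < x := by linarith
      have h3 := (((hT.2.2 x hx0).inv₀ (by positivity)).comp hatop).eventually_lt_const hx
      filter_upwards [h3] with n hn
      refine lt_of_le_of_lt ?_ hn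
      simp only [Function.comp, inv_div]
      have h4 := hup n (x * a n) (by nlinarith [ha1 n])
      rw [le_div_iff₀ (hpos _)]
      rw [le_div_iff₀ (by positivity)] at h4
      have h5 := hpos (a n)
      nlinarith
  refine ⟨a, fun n => by linarith [ha1 n], hatop, ?_⟩
  have := hlim1.sub (hlim.comp hatop)
  rw [sub_zero] at this
  refine this.congr fun n => ?_
  simp only [Function.comp]; ring

section Sufficiency

variable {μ : Measure ℝ}

theorem upTail_map_neg (t : ℝ) : upTail (μ.map Neg.neg) t = loTail μ t := by
  rw [upTail, loTail, map_measureReal_apply measurable_neg measurableSet_Ioi]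
  congr 1; ext x; simp

theorem lawMoment_map_neg (t : ℝ) : lawMoment (μ.map Neg.neg) t = lawMoment μ t := by
  rw [lawMoment, lawMoment, setIntegral_map (measurableSet_abs_le t) (by fun_prop) (by fun_prop)]
  simp

/-- The exponential kernel of the Lévy-Khintchine formula, `e^{itx} - 1 - it sin x`. -/
noncomputable def levyKernel (t x : ℝ) : ℂ := laplaceKernel (-(Complex.I * t)) x

theorem levyKernel_neg (t x : ℝ) : levyKernel t (-x) = levyKernel (-t) x := by
  simp [levyKernel, laplaceKernel]

theorem continuous_levyKernel (t : ℝ) : Continuous (levyKernel t) := by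
  unfold levyKernel laplaceKernel; fun_prop

theorem norm_levyKernel_le (t x : ℝ) : ‖levyKernel t x‖ ≤ (|t| ^ 2 + |t| + 2) * min 1 (x ^ 2) := by
  have key : ∀ t x : ℝ, 0 ≤ x → ‖levyKernel t x‖ ≤ (|t| ^ 2 + |t| + 2) * min 1 (x ^ 2) := by
    intro t x hx
    have := norm_laplaceKernel_le (s := -(Complex.I * t)) (by simp) hx
    simpa [levyKernel] using this
  rcases le_total 0 x with hx | hx
  · exact key t x hx
  · have := key (-t) (-x) (by linarith)
    rwa [levyKernel_neg, neg_neg, abs_neg, neg_sq] at this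

variable [IsProbabilityMeasure μ]

theorem integrable_exp_mul_I (s : ℝ) : Integrable (fun x : ℝ => Complex.exp ((s : ℂ) * x * Complex.I)) μ := by
  refine Integrable.mono' (integrable_const 1) (by fun_prop) (.of_forall fun x => ?_)
  rw [← Complex.ofReal_mul, Complex.norm_exp_ofReal_mul_I]

theorem integral_levyKernel (t b : ℝ) : ∫ x, levyKernel t (x / b) ∂μ
    = charFun μ (t / b) - 1 - Complex.I * ((t * ∫ x, Real.sin (x / b) ∂μ : ℝ) : ℂ) := by
  have hs : Integrable (fun x : ℝ => ((Real.sin (x / b) : ℝ) : ℂ)) μ := by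
    refine Integrable.mono' (integrable_const 1) (by fun_prop) (.of_forall fun x => ?_)
    rw [Complex.norm_real]; exact Real.abs_sin_le_one _
  have e : ∀ x : ℝ, levyKernel t (x / b) = Complex.exp (((t / b : ℝ) : ℂ) * x * Complex.I) - 1
      - Complex.I * t * ((Real.sin (x / b) : ℝ) : ℂ) := by
    intro x
    simp only [levyKernel, laplaceKernel]
    have : -(-(Complex.I * (t : ℂ)) * ((x / b : ℝ) : ℂ)) = ((t / b : ℝ) : ℂ) * x * Complex.I := by
      push_cast; ring
    rw [this]; ring
  simp_rw [e]
  have i1 : Integrable (fun x : ℝ => Complex.exp (((t / b : ℝ) : ℂ) * x * Complex.I) - 1) μ :=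
    (integrable_exp_mul_I _).sub (integrable_const 1)
  rw [integral_sub i1 (hs.const_mul _),
    integral_sub (integrable_exp_mul_I _) (integrable_const 1), integral_const_mul,
    integral_complex_ofReal, charFun_apply_real]
  simp
  ring

/-- **Sufficiency, index below two.** A law with regularly varying two-sided tail and balanced tails
is attracted to a stable law. The centring constants are `n E[sin (X / a n)]`, in accordance with
the compensator `sin` of the Lévy kernel. -/
theorem exists_tendsto_charFun_of_regVar {α p q : ℝ} (h0 : 0 < α) (h2 : α < 2)
    (hT : RegVar (absTail μ) (-α))
    (hp : Tendsto (fun t => upTail μ t / absTail μ t) atTop (𝓝 p))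
    (hq : Tendsto (fun t => loTail μ t / absTail μ t) atTop (𝓝 q)) :
    ∃ (σ β δ : ℝ) (a θ : ℕ → ℝ), 0 < σ ∧ β ∈ Set.Icc (-1 : ℝ) 1 ∧ (∀ n, 0 < a n) ∧
      ContinuousAt (stableExponent α σ β δ) 0 ∧ ∀ t : ℝ, Tendsto (fun n => charFun μ (t / a n) ^ n
        * Complex.exp (-(Complex.I * ((t * θ n : ℝ) : ℂ)))) atTop
        (𝓝 (Complex.exp (stableExponent α σ β δ t))) := by
  have hp0 : 0 ≤ p := ge_of_tendsto hp (.of_forall fun t =>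
    div_nonneg measureReal_nonneg measureReal_nonneg)
  have hq0 : 0 ≤ q := ge_of_tendsto hq (.of_forall fun t =>
    div_nonneg measureReal_nonneg measureReal_nonneg)
  have hpq : p + q = 1 := by
    refine tendsto_nhds_unique (hp.add hq) (tendsto_const_nhds.congr' ?_)
    filter_upwards [hT.eventually_pos, eventually_ge_atTop 0] with t ht ht0
    rw [← add_div, ← absTail_eq_add μ ht0, div_self ht.ne']
  obtain ⟨a, ha, hatop, hna⟩ := exists_norming (antitone_absTail μ) (tendsto_absTail μ) hT
  have hax : ∀ x, 0 < x → Tendsto (fun n => x * a n) atTop atTop :=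
    fun x hx => hatop.const_mul_atTop hx
  have hnT : ∀ x, 0 < x → Tendsto (fun n : ℕ => n * absTail μ (x * a n)) atTop (𝓝 (x ^ (-α))) := by
    intro x hx
    have := hna.mul ((hT.2.2 x hx).comp hatop)
    rw [one_mul] at this
    refine this.congr' ?_
    filter_upwards [hatop.eventually hT.eventually_pos] with n hn
    simp only [Function.comp]; field_simp
  have hup : ∀ x, 0 < x → Tendsto (fun n : ℕ => n * upTail μ (x * a n)) atTop
      (𝓝 (p * x ^ (-α))) := by
    intro x hx
    refine ((hp.comp (hax x hx)).mul (hnT x hx)).congr' ?_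
    filter_upwards [(hax x hx).eventually hT.eventually_pos] with n hn
    simp only [Function.comp]; field_simp
  have hlo : ∀ x, 0 < x → Tendsto (fun n : ℕ => n * loTail μ (x * a n)) atTop
      (𝓝 (q * x ^ (-α))) := by
    intro x hx
    refine ((hq.comp (hax x hx)).mul (hnT x hx)).congr' ?_
    filter_upwards [(hax x hx).eventually hT.eventually_pos] with n hn
    simp only [Function.comp]; field_simp
  -- Karamata's theorem makes the truncated second moments near the origin uniformly small
  have hkar := (isTailMoment μ).karamata_direct h0 h2 hT
  have hmom : ∀ e, 0 < e → Tendsto (fun n : ℕ => n * (lawMoment μ (e * a n) / a n ^ 2)) atTop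
      (𝓝 (α / (2 - α) * e ^ (2 - α))) := by
    intro e he
    have := ((hkar.comp (hax e he)).mul (hnT e he)).mul_const (e ^ 2)
    have e1 : α / (2 - α) * e ^ (-α) * e ^ 2 = α / (2 - α) * e ^ (2 - α) := by
      rw [mul_assoc, ← Real.rpow_natCast, ← Real.rpow_add he]; congr 2; norm_num; ring
    rw [e1] at this
    refine this.congr' ?_
    filter_upwards [(hax e he).eventually hT.eventually_pos] with n hn
    have := ha n
    simp only [Function.comp]; field_simp
  have hsmall : ∀ η, 0 < η → ∀ᶠ e in 𝓝[>] (0 : ℝ), ∀ᶠ n : ℕ in atTop,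
      n * (lawMoment μ (e * a n) / a n ^ 2) ≤ η := by
    intro η hη
    have h3 : Tendsto (fun e : ℝ => α / (2 - α) * e ^ (2 - α)) (𝓝[>] 0) (𝓝 0) := by
      have := ((Real.continuousAt_rpow_const 0 (2 - α) (Or.inr (by linarith))).tendsto).const_mul
        (α / (2 - α))
      rw [Real.zero_rpow (by linarith), mul_zero] at this
      exact this.mono_left nhdsWithin_le_nhds
    filter_upwards [h3.eventually_lt_const hη, self_mem_nhdsWithin] with e he he0
    exact ((hmom e he0).eventually_lt_const he).mono fun n hn => hn.le
  -- convergence of the compensated exponents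
  have hE : ∀ t : ℝ, Tendsto (fun n : ℕ => (n : ℂ) * ∫ x, levyKernel t (x / a n) ∂μ) atTop
      (𝓝 (((p * α : ℝ) : ℂ) * levyExponent α t + ((q * α : ℝ) : ℂ) * levyExponent α (-t))) := by
    intro t
    have A1 := tendsto_integral_Ioi_zero h0 h2 hp0 ha hup hsmall (continuous_levyKernel t)
      (norm_levyKernel_le t)
    have hprob : IsProbabilityMeasure (μ.map Neg.neg) :=
      Measure.isProbabilityMeasure_map measurable_neg.aemeasurable
    have A2 := tendsto_integral_Ioi_zero (μ := μ.map Neg.neg) h0 h2 hq0 ha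
      (by simpa only [upTail_map_neg] using hlo) (by simpa only [lawMoment_map_neg] using hsmall)
      (continuous_levyKernel (-t)) (norm_levyKernel_le (-t))
    have := A1.add A2
    refine this.congr fun n => ?_
    have hint := integrable_comp_div (μ := μ) (continuous_levyKernel t) (norm_levyKernel_le t) (a n)
    rw [← mul_add]
    congr 1
    rw [setIntegral_map measurableSet_Ioi
      (f := fun x => levyKernel (-t) (x / a n))
      ((continuous_levyKernel (-t)).comp (continuous_id.div_const (a n))).aestronglyMeasurable
      measurable_neg.aemeasurable, ← integral_add_compl (measurableSet_Ioi (a := (0 : ℝ))) hint]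
    congr 1
    have hIio : Neg.neg ⁻¹' Set.Ioi (0 : ℝ) = Set.Iio 0 := by ext; simp
    rw [hIio, Set.compl_Ioi]
    have hnull : ∫ x in Set.Iic 0, levyKernel t (x / a n) ∂μ
        = ∫ x in Set.Iio 0, levyKernel t (x / a n) ∂μ := by
      rw [← integral_indicator measurableSet_Iic, ← integral_indicator measurableSet_Iio]
      refine integral_congr_ae (.of_forall fun x => ?_)
      simp only [Set.indicator, Set.mem_Iic, Set.mem_Iio]
      rcases lt_trichotomy x 0 with hx | rfl | hx
      · simp [hx, hx.le]
      · simp [levyKernel, laplaceKernel]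
      · simp [hx.le, not_le.2 hx]
    rw [hnull]
    refine setIntegral_congr_fun measurableSet_Iio fun x _ => ?_
    rw [← levyKernel_neg, neg_div, neg_neg]
  obtain ⟨σ, β, δ, hσ, hβ, hst⟩ := exists_levyExponent_add_eq_stableExponent (p := p * α)
    (q := q * α) h0 h2 (by positivity) (by positivity) (by rw [← add_mul, hpq, one_mul]; exact h0)
  refine ⟨σ, β, δ, a, fun n => n * ∫ x, Real.sin (x / a n) ∂μ, hσ, hβ, ha, ?_, fun t => ?_⟩
  · have : stableExponent α σ β δ = fun u => ((p * α : ℝ) : ℂ) * levyExponent α u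
        + ((q * α : ℝ) : ℂ) * levyExponent α (-u) := funext fun u => (hst u).symm
    rw [this]
    have hc := continuous_levyExponent h0 h2
    fun_prop
  -- `n |φ(t / a n) - 1|² → 0`
  have hnotL2 : ¬ Integrable (fun x : ℝ => x ^ 2) μ := by
    intro hcon
    have hV : Tendsto (lawMoment μ) atTop atTop := by
      have h4 : 0 < α / (2 - α) := div_pos h0 (by linarith)
      have := hkar.pos_mul_atTop h4 (tendsto_sq_mul_atTop hT (antitone_absTail μ) (by linarith))
      refine this.congr' ?_
      filter_upwards [hT.eventually_pos, eventually_gt_atTop 0] with t ht ht0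
      field_simp
    obtain ⟨s, hs⟩ := (hV.eventually_gt_atTop (∫ x, x ^ 2 ∂μ)).exists
    exact not_lt.2 (setIntegral_le_integral hcon (.of_forall fun x => sq_nonneg x)) hs
  have hz : Tendsto (fun n : ℕ => n * ‖charFun μ (t / a n) - 1‖ ^ 2) atTop (𝓝 0) := by
    have h5 : Tendsto (fun n : ℕ => n * scaledMoment μ (a n)) atTop
        (𝓝 (α / (2 - α) * 1 ^ (2 - α) + 1 ^ (-α))) := by
      refine ((hmom 1 one_pos).add (hnT 1 one_pos)).congr fun n => ?_
      rw [scaledMoment_eq μ (ha n), one_mul, mul_add]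
    have h6 := (((tendsto_sq_integral_min_div μ hnotL2).comp hatop).mul h5).const_mul ((|t| + 2) ^ 2)
    rw [zero_mul, mul_zero] at h6
    refine squeeze_zero' (.of_forall fun n => by positivity) ?_ h6
    filter_upwards [hatop.eventually hT.eventually_pos] with n hn
    have h7 := norm_charFun_sub_one_le μ t (a n)
    have h8 : 0 < scaledMoment μ (a n) := by
      rw [scaledMoment_eq μ (ha n)]
      have := (isTailMoment μ).moment_nonneg (a n)
      positivity
    simp only [Function.comp]
    calc _ ≤ (n : ℝ) * ((|t| + 2) * ∫ x, min 1 |x / a n| ∂μ) ^ 2 := by gcongr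
      _ = _ := by field_simp
  have hpow := tendsto_one_add_pow_mul_exp hz
  have hfin := hpow.mul ((Complex.continuous_exp.tendsto _).comp (hE t))
  rw [one_mul, hst] at hfin
  refine hfin.congr fun n => ?_
  simp only [Function.comp]
  rw [integral_levyKernel, mul_assoc, ← Complex.exp_add, add_sub_cancel]
  congr 2
  push_cast
  ring

end Sufficiency

/-! ### Convergence of Lévy measures from second differences of the exponents -/

theorem one_sub_sinc_nonneg (x : ℝ) : 0 ≤ 1 - Real.sinc x := by
  linarith [Real.sinc_le_one x]

/-- The weights `1 - sinc x` and `min 1 x²` are comparable, so that averaged second differences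
control the whole Lévy measure. -/
theorem min_one_sq_le_sinc (x : ℝ) : min 1 (x ^ 2) ≤ 20 * (1 - Real.sinc x) := by
  wlog hx : 0 ≤ x generalizing x
  · have := this (-x) (by linarith)
    rwa [Real.sinc_neg, neg_sq] at this
  rcases hx.eq_or_lt with rfl | hx
  · simp
  rw [Real.sinc_of_ne_zero hx.ne']
  have hb : ∀ y : ℝ, 0 ≤ y → y ≤ 1 → Real.sin y ≤ y - 11 / 96 * y ^ 3 := by
    intro y h0 h1
    have := (abs_le.1 (Real.sin_bound (x := y) (by rwa [abs_of_nonneg h0]))).2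
    rw [abs_of_nonneg h0] at this
    have h3 : y ^ 5 ≤ y ^ 3 := pow_le_pow_of_le_one h0 h1 (by norm_num)
    nlinarith [pow_nonneg h0 3]
  have hgoal : min 1 (x ^ 2) * x ≤ 20 * (x - Real.sin x) → min 1 (x ^ 2) ≤ 20 * (1 - Real.sin x / x) := by
    intro h
    have : 20 * (1 - Real.sin x / x) = 20 * (x - Real.sin x) / x := by field_simp
    rwa [this, le_div_iff₀ hx]
  apply hgoal
  rcases le_total x 1 with h1 | h1
  · have := hb x hx.le h1
    have h2 : min 1 (x ^ 2) * x ≤ x ^ 2 * x := by gcongr; exact min_le_right _ _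
    nlinarith [pow_pos hx 3]
  · have h2 : min 1 (x ^ 2) * x ≤ 1 * x := by gcongr; exact min_le_left _ _
    have h3 : Real.sin x ≤ Real.sin 1 + (x - 1) := by
      have := Real.abs_sin_sub_sin_le x 1
      rw [abs_of_nonneg (by linarith : 0 ≤ x - 1)] at this
      linarith [le_abs_self (Real.sin x - Real.sin 1)]
    have h4 := hb 1 zero_le_one le_rfl
    have h5 := Real.sin_le_one x
    rcases le_total x 2 with h6 | h6 <;> nlinarith

theorem one_sub_cos_le_min (x : ℝ) : 1 - Real.cos x ≤ 2 * min 1 (x ^ 2) := by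
  rcases le_total 1 (x ^ 2) with h | h
  · rw [min_eq_left h]; linarith [Real.neg_one_le_cos x]
  · rw [min_eq_right h]; nlinarith [Real.one_sub_sq_div_two_le_cos (x := x)]

theorem one_sub_cos_mul_le_min {h : ℝ} (h0 : 0 ≤ h) (h1 : h ≤ 1) (x : ℝ) :
    1 - Real.cos (h * x) ≤ 2 * min 1 (x ^ 2) := by
  refine (one_sub_cos_le_min _).trans ?_
  have : (h * x) ^ 2 ≤ x ^ 2 := by
    rw [mul_pow]
    have : h ^ 2 ≤ 1 := pow_le_one₀ h0 h1
    nlinarith [sq_nonneg x]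
  gcongr

theorem integral_one_sub_cos {h : ℝ} (x : ℝ) :
    ∫ s in (0 : ℝ)..h, (1 - Real.cos (s * x)) = h * (1 - Real.sinc (h * x)) := by
  rw [intervalIntegral.integral_sub (by simp) (by
    exact Continuous.intervalIntegrable (by fun_prop) _ _)]
  rcases eq_or_ne x 0 with rfl | hx
  · simp
  rcases eq_or_ne h 0 with rfl | hh
  · simp
  rw [intervalIntegral.integral_comp_mul_right _ hx, integral_cos,
    Real.sinc_of_ne_zero (mul_ne_zero hh hx)]
  simp
  field_simp

theorem one_sub_sinc_mul_le_min {h : ℝ} (h0 : 0 < h) (h1 : h ≤ 1) (x : ℝ) :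
    1 - Real.sinc (h * x) ≤ 2 * min 1 (x ^ 2) := by
  have e := integral_one_sub_cos (h := h) x
  have : ∫ s in (0 : ℝ)..h, (1 - Real.cos (s * x)) ≤ ∫ s in (0 : ℝ)..h, 2 * min 1 (x ^ 2) := by
    refine intervalIntegral.integral_mono_on h0.le
      (Continuous.intervalIntegrable (by fun_prop) _ _) (by simp) fun s hs => ?_
    exact one_sub_cos_mul_le_min hs.1 (hs.2.trans h1) x
  rw [e, intervalIntegral.integral_const, smul_eq_mul, sub_zero] at this
  exact le_of_mul_le_mul_left this h0

section SecondDifference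

/-- `∫ exp(itx) (1 - cos(hx)) M(dx)`: for the Lévy measure `M` of an infinitely divisible law
with exponent `ψ` and no Gaussian part, this is `ψ t - (ψ (t + h) + ψ (t - h)) / 2`. -/
noncomputable def secondDiff (M : Measure ℝ) (h t : ℝ) : ℂ :=
  ∫ x, Complex.exp ((t : ℂ) * x * Complex.I) * ((1 - Real.cos (h * x) : ℝ) : ℂ) ∂M

variable {M : Measure ℝ}

theorem norm_exp_mul_ofReal_mul_I (t x : ℝ) : ‖Complex.exp ((t : ℂ) * x * Complex.I)‖ = 1 := by
  rw [← Complex.ofReal_mul, Complex.norm_exp_ofReal_mul_I]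

theorem integrable_one_sub_cos (hM : Integrable (fun x : ℝ => min 1 (x ^ 2)) M) {h : ℝ}
    (h0 : 0 ≤ h) (h1 : h ≤ 1) : Integrable (fun x => 1 - Real.cos (h * x)) M :=
  Integrable.mono' (hM.const_mul 2) (by fun_prop) (.of_forall fun x => by
    rw [Real.norm_of_nonneg (by linarith [Real.cos_le_one (h * x)])]
    exact one_sub_cos_mul_le_min h0 h1 x)

theorem integrable_one_sub_sinc (hM : Integrable (fun x : ℝ => min 1 (x ^ 2)) M) {h : ℝ}
    (h0 : 0 < h) (h1 : h ≤ 1) : Integrable (fun x => 1 - Real.sinc (h * x)) M :=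
  Integrable.mono' (hM.const_mul 2)
    ((continuous_const.sub (Real.continuous_sinc.comp (by fun_prop))).aestronglyMeasurable)
    (.of_forall fun x => by
      rw [Real.norm_of_nonneg (one_sub_sinc_nonneg _)]
      exact one_sub_sinc_mul_le_min h0 h1 x)

theorem norm_secondDiff_le (h t : ℝ) :
    ‖secondDiff M h t‖ ≤ ∫ x, (1 - Real.cos (h * x)) ∂M := by
  refine (norm_integral_le_integral_norm _).trans (le_of_eq ?_)
  refine integral_congr_ae (.of_forall fun x => ?_)
  simp only
  rw [norm_mul, norm_exp_mul_ofReal_mul_I, one_mul, Complex.norm_real,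
    Real.norm_of_nonneg (by linarith [Real.cos_le_one (h * x)])]

theorem secondDiff_zero (h : ℝ) :
    secondDiff M h 0 = ((∫ x, (1 - Real.cos (h * x)) ∂M : ℝ) : ℂ) := by
  rw [secondDiff, ← integral_complex_ofReal]
  simp

/-- Averaging the second differences over the step turns `1 - cos (s x)` into `1 - sinc (h x)`. -/
theorem integral_secondDiff [SFinite M] (hM : Integrable (fun x : ℝ => min 1 (x ^ 2)) M) {h : ℝ}
    (h0 : 0 < h) (h1 : h ≤ 1) (t : ℝ) : ∫ s in (0 : ℝ)..h, secondDiff M s t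
      = h * ∫ x, Complex.exp ((t : ℂ) * x * Complex.I) * ((1 - Real.sinc (h * x) : ℝ) : ℂ) ∂M := by
  have hfinI : IsFiniteMeasure (volume.restrict (Set.uIoc 0 h)) :=
    isFiniteMeasure_restrict.2 (by simp [Set.uIoc_of_le h0.le])
  have hint : Integrable (Function.uncurry fun (s x : ℝ) =>
      Complex.exp ((t : ℂ) * x * Complex.I) * ((1 - Real.cos (s * x) : ℝ) : ℂ))
      ((volume.restrict (Set.uIoc 0 h)).prod M) := by
    have hb : Integrable (fun z : ℝ × ℝ => (1 : ℝ) * (2 * min 1 (z.2 ^ 2)))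
        ((volume.restrict (Set.uIoc 0 h)).prod M) :=
      Integrable.mul_prod (integrable_const (1 : ℝ)) (hM.const_mul 2)
    refine Integrable.mono' hb (by
      refine Continuous.aestronglyMeasurable ?_
      unfold Function.uncurry
      fun_prop) ?_
    rw [← Measure.restrict_univ (μ := M), Measure.prod_restrict]
    filter_upwards [ae_restrict_mem (measurableSet_uIoc.prod MeasurableSet.univ)] with z hz
    have hz1 := hz.1
    rw [Set.uIoc_of_le h0.le] at hz1
    simp only [Function.uncurry]
    rw [norm_mul, norm_exp_mul_ofReal_mul_I, one_mul, one_mul, Complex.norm_real,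
      Real.norm_of_nonneg (by linarith [Real.cos_le_one (z.1 * z.2)])]
    exact one_sub_cos_mul_le_min hz1.1.le (hz1.2.trans h1) z.2
  unfold secondDiff
  rw [intervalIntegral_integral_swap hint, ← integral_const_mul]
  refine integral_congr_ae (.of_forall fun x => ?_)
  simp only
  rw [intervalIntegral.integral_const_mul, intervalIntegral.integral_ofReal, integral_one_sub_cos]
  push_cast; ring

end SecondDifference

/-- Weak convergence of finite measures from pointwise convergence of characteristic functions. -/
theorem tendsto_finiteMeasure_of_tendsto_charFun {F : ℕ → FiniteMeasure ℝ} {G : FiniteMeasure ℝ}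
    (hG : G ≠ 0) (h : ∀ t, Tendsto (fun n => charFun (F n : Measure ℝ) t) atTop
      (𝓝 (charFun (G : Measure ℝ) t))) : Tendsto F atTop (𝓝 G) := by
  have hmass : Tendsto (fun n => (F n).mass) atTop (𝓝 G.mass) := by
    have h0 := (Complex.continuous_re.tendsto _).comp (h 0)
    simp only [charFun_zero, Function.comp_def, Complex.ofReal_re] at h0
    exact NNReal.tendsto_coe.1 h0
  have hGm : 0 < G.mass := pos_iff_ne_zero.2 (G.mass_nonzero_iff.2 hG)
  have hne : ∀ᶠ n in atTop, F n ≠ 0 := by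
    filter_upwards [hmass.eventually_const_lt hGm] with n hn h0
    simp [h0] at hn
  refine (FiniteMeasure.tendsto_normalize_iff_tendsto hG).1 ⟨?_, hmass⟩
  refine ProbabilityMeasure.tendsto_of_tendsto_charFun fun t => ?_
  have hnorm : ∀ H : FiniteMeasure ℝ, H ≠ 0 → charFun (H.normalize : Measure ℝ) t
      = ((H.mass : ℝ) : ℂ)⁻¹ * charFun (H : Measure ℝ) t := by
    intro H hH
    rw [FiniteMeasure.toMeasure_normalize_eq_of_nonzero _ hH, charFun_apply_real,
      charFun_apply_real, integral_smul_nnreal_measure, NNReal.smul_def, Complex.real_smul]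
    simp
  rw [hnorm G hG]
  have hinv : Tendsto (fun n => (((F n).mass : ℝ) : ℂ)⁻¹) atTop (𝓝 ((G.mass : ℝ) : ℂ)⁻¹) := by
    refine Tendsto.inv₀ ?_ (by simpa using hGm.ne')
    exact (Complex.continuous_ofReal.tendsto _).comp (NNReal.tendsto_coe.2 hmass)
  refine (hinv.mul (h t)).congr' ?_
  filter_upwards [hne] with n hn
  rw [hnorm _ hn]

/-- If the second differences associated with the measures `M n` converge to those of the
Lévy-Khintchine exponent with Lévy measure `L` and Gaussian coefficient `s`, then the `M n` converge
to `L` away from the origin. Averaging over the step `h` turns the weight `1 - cos(hx)` into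
`1 - sinc(hx)`, which vanishes at `0` only. -/
theorem tendsto_integral_of_tendsto_secondDiff {M : ℕ → Measure ℝ} {L : Measure ℝ}
    [∀ n, SFinite (M n)] [SFinite L] {C s h : ℝ} (h0 : 0 < h) (h1 : h ≤ 1) (hs : 0 ≤ s)
    (hM : ∀ n, Integrable (fun x : ℝ => min 1 (x ^ 2)) (M n))
    (hL : Integrable (fun x : ℝ => min 1 (x ^ 2)) L)
    (hC : ∀ n, ∫ x, min 1 (x ^ 2) ∂(M n) ≤ C)
    (hlim : ∀ u ∈ Set.Ioc 0 h, ∀ t, Tendsto (fun n => secondDiff (M n) u t) atTop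
      (𝓝 (secondDiff L u t + ((s * u ^ 2 : ℝ) : ℂ))))
    (hpos : 0 < (∫ x, (1 - Real.sinc (h * x)) ∂L) + s * h ^ 2 / 3)
    {f : ℝ → ℝ} {B r : ℝ} (hf : Continuous f) (hr : 0 < r) (hB : ∀ x, |f x| ≤ B)
    (hfr : ∀ x, |x| ≤ r → f x = 0) :
    Tendsto (fun n => ∫ x, f x ∂(M n)) atTop (𝓝 (∫ x, f x ∂L)) := by
  set w : ℝ → ℝ := fun x => 1 - Real.sinc (h * x) with hw
  have hwc : Continuous w := continuous_const.sub (Real.continuous_sinc.comp (by fun_prop))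
  have hw0 : ∀ x, 0 ≤ w x := fun x => one_sub_sinc_nonneg _
  have hmw : Measurable fun x => ENNReal.ofReal (w x) := hwc.measurable.ennreal_ofReal
  have hfinI : IsFiniteMeasure (volume.restrict (Set.uIoc 0 h)) :=
    isFiniteMeasure_restrict.2 (by simp [Set.uIoc_of_le h0.le])
  have havg : ∀ t : ℝ, Tendsto (fun n => ∫ x, Complex.exp ((t : ℂ) * x * Complex.I) * (w x : ℂ) ∂(M n))
      atTop (𝓝 ((∫ x, Complex.exp ((t : ℂ) * x * Complex.I) * (w x : ℂ) ∂L)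
        + ((s * h ^ 2 / 3 : ℝ) : ℂ))) := by
    intro t
    have hmeas : ∀ (N : Measure ℝ) [SFinite N], Integrable (fun x : ℝ => min 1 (x ^ 2)) N →
        AEStronglyMeasurable (fun u => secondDiff N u t) (volume.restrict (Set.uIoc 0 h)) := by
      intro N _ hN
      refine StronglyMeasurable.aestronglyMeasurable ?_
      unfold secondDiff
      refine StronglyMeasurable.integral_prod_right (f := fun u x : ℝ =>
        Complex.exp ((t : ℂ) * x * Complex.I) * ((1 - Real.cos (u * x) : ℝ) : ℂ)) ?_
      refine Continuous.stronglyMeasurable ?_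
      unfold Function.uncurry
      fun_prop
    have hbd : ∀ (N : Measure ℝ), Integrable (fun x : ℝ => min 1 (x ^ 2)) N → ∀ u ∈ Set.uIoc 0 h,
        ‖secondDiff N u t‖ ≤ 2 * ∫ x, min 1 (x ^ 2) ∂N := by
      intro N hN u hu
      rw [Set.uIoc_of_le h0.le] at hu
      refine (norm_secondDiff_le u t).trans ?_
      rw [← integral_const_mul]
      exact integral_mono (integrable_one_sub_cos hN hu.1.le (hu.2.trans h1)) (hN.const_mul 2)
        fun x => one_sub_cos_mul_le_min hu.1.le (hu.2.trans h1) x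
    have key := intervalIntegral.tendsto_integral_filter_of_dominated_convergence
      (μ := volume) (a := 0) (b := h) (l := atTop) (F := fun n u => secondDiff (M n) u t)
      (f := fun u => secondDiff L u t + ((s * u ^ 2 : ℝ) : ℂ)) (fun _ => 2 * C)
      (.of_forall fun n => hmeas _ (hM n))
      (.of_forall fun n => .of_forall fun u hu => (hbd _ (hM n) u hu).trans (by linarith [hC n]))
      (by simp) (.of_forall fun u hu => hlim u (by rwa [Set.uIoc_of_le h0.le] at hu) t)
    have hI : IntervalIntegrable (fun u => secondDiff L u t) volume 0 h := by
      rw [intervalIntegrable_iff]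
      refine Integrable.mono' (integrable_const (2 * ∫ x, min 1 (x ^ 2) ∂L)) (hmeas L hL) ?_
      filter_upwards [ae_restrict_mem measurableSet_uIoc] with u hu
      exact hbd L hL u hu
    rw [intervalIntegral.integral_add hI (Continuous.intervalIntegrable (by fun_prop) _ _),
      integral_secondDiff hL h0 h1, intervalIntegral.integral_ofReal,
      intervalIntegral.integral_const_mul, integral_pow] at key
    have hh : (h : ℂ) ≠ 0 := by exact_mod_cast h0.ne'
    have key2 := key.const_mul (h : ℂ)⁻¹
    have e1 : (h : ℂ)⁻¹ * (h * (∫ x, Complex.exp ((t : ℂ) * x * Complex.I)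
        * ((1 - Real.sinc (h * x) : ℝ) : ℂ) ∂L)
        + ((s * ((h ^ (2 + 1) - 0 ^ (2 + 1)) / ((2 : ℕ) + 1)) : ℝ) : ℂ))
        = (∫ x, Complex.exp ((t : ℂ) * x * Complex.I) * (w x : ℂ) ∂L)
        + ((s * h ^ 2 / 3 : ℝ) : ℂ) := by
      rw [mul_add, inv_mul_cancel_left₀ hh]
      congr 1
      push_cast
      field_simp
      ring
    rw [e1] at key2
    refine key2.congr fun n => ?_
    rw [integral_secondDiff (hM n) h0 h1, inv_mul_cancel_left₀ hh]
  -- the finite measures `w M n` converge weakly to `w L + (s h² / 3) δ₀`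
  have hfin : ∀ (N : Measure ℝ), Integrable (fun x : ℝ => min 1 (x ^ 2)) N →
      IsFiniteMeasure (N.withDensity fun x => ENNReal.ofReal (w x)) := fun N hN =>
    isFiniteMeasure_withDensity_ofReal (integrable_one_sub_sinc hN h0 h1).2
  have hdens : ∀ (N : Measure ℝ) {E : Type} [NormedAddCommGroup E] [NormedSpace ℝ E] (g : ℝ → E),
      ∫ x, g x ∂(N.withDensity fun x => ENNReal.ofReal (w x)) = ∫ x, w x • g x ∂N := by
    intro N E _ _ g
    rw [integral_withDensity_eq_integral_toReal_smul hmw (.of_forall fun x => by simp)]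
    simp_rw [ENNReal.toReal_ofReal (hw0 _)]
  set sG : NNReal := Real.toNNReal (s * h ^ 2 / 3) with hsG
  have hsGv : (sG : ℝ) = s * h ^ 2 / 3 := Real.coe_toNNReal _ (by positivity)
  obtain ⟨F, hF⟩ : ∃ F : ℕ → FiniteMeasure ℝ, ∀ n, (F n : Measure ℝ)
      = (M n).withDensity fun x => ENNReal.ofReal (w x) :=
    ⟨fun n => ⟨_, hfin _ (hM n)⟩, fun _ => rfl⟩
  have := hfin L hL
  obtain ⟨G, hGdef⟩ : ∃ G : FiniteMeasure ℝ, (G : Measure ℝ)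
      = (L.withDensity fun x => ENNReal.ofReal (w x)) + sG • Measure.dirac 0 :=
    ⟨⟨_, inferInstance⟩, rfl⟩
  have hcharG : ∀ t, charFun (G : Measure ℝ) t
      = (∫ x, Complex.exp ((t : ℂ) * x * Complex.I) * (w x : ℂ) ∂L)
        + ((s * h ^ 2 / 3 : ℝ) : ℂ) := by
    intro t
    rw [charFun_apply_real, hGdef, integral_add_measure, hdens, integral_smul_nnreal_measure,
      integral_dirac, ← hsGv]
    · congr 1
      · refine integral_congr_ae (.of_forall fun x => ?_)
        simp only [Complex.real_smul]; ring
      · simp [NNReal.smul_def]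
    · exact Integrable.mono' (integrable_const 1) (by fun_prop)
        (.of_forall fun x => (norm_exp_mul_ofReal_mul_I t x).le)
    · exact Integrable.mono' (integrable_const 1) (by fun_prop)
        (.of_forall fun x => (norm_exp_mul_ofReal_mul_I t x).le)
  have hG0 : G ≠ 0 := by
    intro hG
    have h2 := hcharG 0
    rw [hG] at h2
    have h3 : (∫ x, Complex.exp (((0 : ℝ) : ℂ) * x * Complex.I) * (w x : ℂ) ∂L)
        = ((∫ x, w x ∂L : ℝ) : ℂ) := by
      rw [← integral_complex_ofReal]; simp
    rw [h3, ← Complex.ofReal_add] at h2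
    simp only [charFun_zero] at h2
    have h4 := Complex.ofReal_injective h2
    rw [← h4] at hpos
    simp at hpos
  have hweak : Tendsto F atTop (𝓝 G) := by
    refine tendsto_finiteMeasure_of_tendsto_charFun hG0 fun t => ?_
    rw [hcharG]
    refine (havg t).congr fun n => ?_
    rw [charFun_apply_real, hF, hdens]
    refine integral_congr_ae (.of_forall fun x => ?_)
    simp only [Complex.real_smul]; ring
  -- test against `f / w`, which is bounded and continuous since `f` vanishes near `0`
  set η : ℝ := min 1 ((h * r) ^ 2) / 20 with hη
  have hη0 : 0 < η := by positivity
  have hwη : ∀ x, r ≤ |x| → η ≤ w x := by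
    intro x hx
    have h2 := min_one_sq_le_sinc (h * x)
    have h3 : min 1 ((h * r) ^ 2) ≤ min 1 ((h * x) ^ 2) := by
      rw [← sq_abs (h * x), abs_mul, abs_of_pos h0]
      gcongr
    simp only [hw, hη]
    linarith
  have hgc : Continuous fun x => f x / max (w x) η :=
    hf.div (hwc.max continuous_const) fun x => (lt_max_of_lt_right hη0).ne'
  have hB0 : 0 ≤ B := (abs_nonneg _).trans (hB 0)
  let g : BoundedContinuousFunction ℝ ℝ := BoundedContinuousFunction.ofNormedAddCommGroup
    (fun x => f x / max (w x) η) hgc (B / η) fun x => by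
      rw [Real.norm_eq_abs, abs_div, abs_of_pos (lt_max_of_lt_right hη0 : 0 < max (w x) η)]
      gcongr
      · exact hB x
      · exact le_max_right _ _
  have hwg : ∀ x, w x • (f x / max (w x) η) = f x := by
    intro x
    rcases le_total |x| r with hx | hx
    · rw [hfr x hx]; simp
    · rw [max_eq_left (hwη x hx), smul_eq_mul, mul_div_cancel₀]
      exact (hη0.trans_le (hwη x hx)).ne'
  have hfin2 := FiniteMeasure.tendsto_iff_forall_integral_tendsto.1 hweak g
  have e1 : ∫ x, g x ∂(G : Measure ℝ) = ∫ x, f x ∂L := by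
    rw [hGdef, integral_add_measure, hdens, integral_smul_nnreal_measure, integral_dirac]
    · have : g 0 = 0 := by
        change f 0 / _ = 0
        rw [hfr 0 (by simpa using hr.le), zero_div]
      rw [this, smul_zero, add_zero]
      exact integral_congr_ae (.of_forall hwg)
    · exact g.integrable _
    · exact g.integrable _
  rw [e1] at hfin2
  refine hfin2.congr fun n => ?_
  rw [hF, hdens]
  exact integral_congr_ae (.of_forall hwg)

/-! ### Tightness of the rescaled laws -/

/-- For nonnegative numbers, convergence of `x n ^ n` to a positive limit linearises. -/
theorem tendsto_nat_mul_one_sub {x : ℕ → ℝ} {c : ℝ} (h0 : ∀ n, 0 ≤ x n)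
    (h : Tendsto (fun n => x n ^ n) atTop (𝓝 (Real.exp (-c)))) :
    Tendsto (fun n : ℕ => (n : ℝ) * (1 - x n)) atTop (𝓝 c) := by
  have hpos : ∀ᶠ n : ℕ in atTop, 0 < x n := by
    filter_upwards [h.eventually_const_lt (Real.exp_pos _), eventually_ne_atTop 0] with n hn hn0
    refine (h0 n).lt_of_ne fun he => ?_
    rw [← he, zero_pow hn0] at hn
    exact lt_irrefl _ hn
  have hlog : Tendsto (fun n : ℕ => (n : ℝ) * Real.log (x n)) atTop (𝓝 (-c)) := by
    have := (Real.continuousAt_log (Real.exp_pos (-c)).ne').tendsto.comp h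
    rw [Real.log_exp] at this
    refine this.congr fun n => ?_
    simp
  have hx1 : Tendsto x atTop (𝓝 1) := by
    have hl : Tendsto (fun n => Real.log (x n)) atTop (𝓝 0) := by
      have := hlog.div_atTop tendsto_natCast_atTop_atTop
      refine this.congr' ?_
      filter_upwards [eventually_ne_atTop 0] with n hn
      have : (n : ℝ) ≠ 0 := by exact_mod_cast hn
      field_simp
    have := (Real.continuous_exp.tendsto 0).comp hl
    rw [Real.exp_zero] at this
    refine this.congr' ?_
    filter_upwards [hpos] with n hn
    exact Real.exp_log hn
  have hlow : Tendsto (fun n : ℕ => x n * -((n : ℝ) * Real.log (x n))) atTop (𝓝 c) := by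
    simpa using hx1.mul hlog.neg
  have hup : Tendsto (fun n : ℕ => -((n : ℝ) * Real.log (x n))) atTop (𝓝 c) := by
    simpa using hlog.neg
  refine tendsto_of_tendsto_of_tendsto_of_le_of_le' hlow hup ?_ ?_
  · filter_upwards [hpos] with n hn
    have h3 := Real.one_sub_inv_le_log_of_pos hn
    have h4 : x n * -Real.log (x n) ≤ 1 - x n := by
      have : x n * (1 - (x n)⁻¹) ≤ x n * Real.log (x n) := by gcongr
      rw [mul_sub, mul_inv_cancel₀ hn.ne'] at this
      linarith
    calc x n * -((n : ℝ) * Real.log (x n)) = n * (x n * -Real.log (x n)) := by ring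
      _ ≤ n * (1 - x n) := by gcongr
  · filter_upwards [hpos] with n hn
    have h3 := Real.log_le_sub_one_of_pos hn
    have : (n : ℝ) * Real.log (x n) ≤ n * (x n - 1) := by gcongr
    linarith

theorem one_sub_cos_sub_le (u v : ℝ) :
    1 - Real.cos (u - v) ≤ 2 * (1 - Real.cos u) + 2 * (1 - Real.cos v) := by
  have key : ∀ y : ℝ, 1 - Real.cos y = 2 * Real.sin (y / 2) ^ 2 := by
    intro y
    have := Real.cos_sq' (y / 2)
    have h2 := Real.cos_two_mul (y / 2)
    rw [mul_div_cancel₀ _ (two_ne_zero)] at h2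
    linarith
  rw [key, key u, key v, sub_div, Real.sin_sub]
  nlinarith [sq_nonneg (Real.sin (u / 2) * Real.cos (v / 2) + Real.cos (u / 2) * Real.sin (v / 2)),
    Real.sin_sq_add_cos_sq (u / 2), Real.sin_sq_add_cos_sq (v / 2),
    mul_nonneg (sq_nonneg (Real.sin (u / 2))) (sq_nonneg (Real.sin (v / 2)))]

theorem integrable_one_sub_cos_of_finite (M : Measure ℝ) [IsFiniteMeasure M] (t : ℝ) :
    Integrable (fun x => 1 - Real.cos (t * x)) M :=
  Integrable.mono' (integrable_const 2) (by fun_prop) (.of_forall fun x => by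
    rw [Real.norm_of_nonneg (by linarith [Real.cos_le_one (t * x)])]
    linarith [Real.neg_one_le_cos (t * x)])

theorem integrable_min_one_sq' (M : Measure ℝ) [IsFiniteMeasure M] :
    Integrable (fun x : ℝ => min 1 (x ^ 2)) M := by
  simpa using integrable_min_one_sq M 1

/-- If `∫ (1 - cos(tx)) M n (dx)` converges for every `t`, then the `M n` integrate `min 1 x²`
boundedly. By Baire's theorem these integrals are bounded uniformly in `n` and in `t` in some
interval, hence, being almost subadditive in `t`, in a neighbourhood of `0`. -/
theorem exists_integral_min_le {M : ℕ → Measure ℝ} [∀ n, IsFiniteMeasure (M n)] {c : ℝ → ℝ}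
    (h : ∀ t, Tendsto (fun n => ∫ x, (1 - Real.cos (t * x)) ∂(M n)) atTop (𝓝 (c t))) :
    ∃ C, ∀ n, ∫ x, min 1 (x ^ 2) ∂(M n) ≤ C := by
  set g : ℕ → ℝ → ℝ := fun n t => ∫ x, (1 - Real.cos (t * x)) ∂(M n) with hg
  have hgc : ∀ n, Continuous (g n) := fun n => by
    refine continuous_of_dominated (bound := fun _ => 2) (fun t => by fun_prop)
      (fun t => .of_forall fun x => ?_) (integrable_const _) (.of_forall fun x => by fun_prop)
    rw [Real.norm_of_nonneg (by linarith [Real.cos_le_one (t * x)])]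
    linarith [Real.neg_one_le_cos (t * x)]
  set E : ℕ → Set ℝ := fun k => {t | ∀ n, g n t ≤ k} with hE
  have hEc : ∀ k, IsClosed (E k) := fun k => by
    simp only [hE, Set.ofPred_forall]
    exact isClosed_iInter fun n => isClosed_le (hgc n) continuous_const
  have hEu : ⋃ k, E k = Set.univ := by
    refine Set.eq_univ_of_forall fun t => Set.mem_iUnion.2 ?_
    obtain ⟨B, hB⟩ := (h t).bddAbove_range
    obtain ⟨k, hk⟩ := exists_nat_ge B
    exact ⟨k, fun n => (hB (Set.mem_range_self n)).trans hk⟩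
  obtain ⟨k, x₀, hx₀⟩ := nonempty_interior_of_iUnion_of_closed hEc hEu
  obtain ⟨e, he, hball⟩ := Metric.isOpen_iff.1 isOpen_interior x₀ hx₀
  set r : ℝ := min 1 (e / 2) with hr
  have hr0 : 0 < r := by positivity
  have hr1 : r ≤ 1 := min_le_left _ _
  have hre : r < e := (min_le_right _ _).trans_lt (by linarith)
  have hgs : ∀ n, ∀ s, 0 ≤ s → s ≤ r → g n s ≤ 4 * k := by
    intro n s hs0 hsr
    have h1 : g n (x₀ + s) ≤ k := interior_subset (hball (by
      rw [Metric.mem_ball, Real.dist_eq, add_sub_cancel_left, abs_of_nonneg hs0]; linarith)) n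
    have h2 : g n x₀ ≤ k := interior_subset hx₀ n
    have h3 : g n s ≤ 2 * g n (x₀ + s) + 2 * g n x₀ := by
      simp only [hg]
      rw [← integral_const_mul, ← integral_const_mul, ← integral_add
        ((integrable_one_sub_cos_of_finite _ _).const_mul 2)
        ((integrable_one_sub_cos_of_finite _ _).const_mul 2)]
      refine integral_mono (integrable_one_sub_cos_of_finite _ _)
        (((integrable_one_sub_cos_of_finite _ _).const_mul 2).add
        ((integrable_one_sub_cos_of_finite _ _).const_mul 2)) fun x => ?_
      have := one_sub_cos_sub_le ((x₀ + s) * x) (x₀ * x)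
      rwa [show (x₀ + s) * x - x₀ * x = s * x by ring] at this
    linarith
  refine ⟨20 / r ^ 2 * (4 * k), fun n => ?_⟩
  have h1 := integral_secondDiff (integrable_min_one_sq' (M n)) hr0 hr1 0
  have h2 : ‖∫ s in (0 : ℝ)..r, secondDiff (M n) s 0‖ ≤ 4 * k * |r - 0| := by
    refine intervalIntegral.norm_integral_le_of_norm_le_const fun s hs => ?_
    rw [Set.uIoc_of_le hr0.le] at hs
    exact (norm_secondDiff_le s 0).trans (hgs n s hs.1.le hs.2)
  have h3 : (∫ x, Complex.exp (((0 : ℝ) : ℂ) * x * Complex.I)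
      * ((1 - Real.sinc (r * x) : ℝ) : ℂ) ∂(M n)) = ((∫ x, (1 - Real.sinc (r * x)) ∂(M n) : ℝ) : ℂ) := by
    rw [← integral_complex_ofReal]; simp
  have h4 : 0 ≤ ∫ x, (1 - Real.sinc (r * x)) ∂(M n) :=
    integral_nonneg fun x => one_sub_sinc_nonneg _
  rw [h1, h3, ← Complex.ofReal_mul, Complex.norm_real, Real.norm_of_nonneg (by positivity), sub_zero,
    abs_of_pos hr0, mul_comm] at h2
  have h5 := le_of_mul_le_mul_right h2 hr0
  refine le_trans ?_ (mul_le_mul_of_nonneg_left h5 (by positivity))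
  rw [← integral_const_mul]
  refine integral_mono (integrable_min_one_sq' _)
    ((integrable_one_sub_sinc (integrable_min_one_sq' _) hr0 hr1).const_mul _) fun x => ?_
  have h6 := min_one_sq_le_sinc (r * x)
  have h7 : r ^ 2 * min 1 (x ^ 2) ≤ min 1 ((r * x) ^ 2) := by
    refine le_min ?_ ?_
    · have : r ^ 2 ≤ 1 := pow_le_one₀ hr0.le hr1
      have h8 : min 1 (x ^ 2) ≤ 1 := min_le_left _ _
      have h9 : 0 ≤ min 1 (x ^ 2) := by positivity
      nlinarith
    · rw [mul_pow]; gcongr; exact min_le_right _ _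
  simp only
  rw [div_mul_eq_mul_div, le_div_iff₀ (by positivity)]
  linarith

/-- The measure `n` times the image of `μ` under division by `a`: the expected number of summands,
among `n` rescaled independent ones, with values in a given set. -/
noncomputable def rescaledLaw (μ : Measure ℝ) (n : ℕ) (a : ℝ) : Measure ℝ :=
  (n : NNReal) • μ.map fun x => x / a

instance (μ : Measure ℝ) [IsFiniteMeasure μ] (n : ℕ) (a : ℝ) :
    IsFiniteMeasure (rescaledLaw μ n a) := by
  unfold rescaledLaw; infer_instance

theorem integral_rescaledLaw {E : Type*} [NormedAddCommGroup E] [NormedSpace ℝ E]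
    [SecondCountableTopology E] {μ : Measure ℝ} {n : ℕ} {a : ℝ} {f : ℝ → E}
    (hf : Continuous f) : ∫ x, f x ∂(rescaledLaw μ n a) = (n : ℝ) • ∫ x, f (x / a) ∂μ := by
  rw [rescaledLaw, integral_smul_nnreal_measure, integral_map (by fun_prop)
    hf.aestronglyMeasurable, NNReal.smul_def]
  simp

theorem integral_min_rescaledLaw {μ : Measure ℝ} {n : ℕ} {a : ℝ} :
    ∫ x, min 1 (x ^ 2) ∂(rescaledLaw μ n a) = n * scaledMoment μ a := by
  rw [integral_rescaledLaw (by fun_prop), smul_eq_mul, scaledMoment]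

/-- The law of the difference of two independent variables of law `μ`. -/
noncomputable def symmetrization (μ : Measure ℝ) : Measure ℝ :=
  (μ.prod μ).map fun z => z.1 - z.2

section Symmetrization

variable (μ : Measure ℝ) [IsProbabilityMeasure μ]

instance : IsProbabilityMeasure (symmetrization μ) :=
  Measure.isProbabilityMeasure_map (by fun_prop)

/-- The characteristic function of the symmetrization is `|φ|²`, which does not see the centring. -/
theorem integral_one_sub_cos_symmetrization (t : ℝ) :
    ∫ x, (1 - Real.cos (t * x)) ∂(symmetrization μ) = 1 - ‖charFun μ t‖ ^ 2 := by
  have h1 : charFun (symmetrization μ) t = charFun μ t * charFun μ (-t) := by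
    rw [charFun_apply_real, charFun_apply_real, charFun_apply_real, ← integral_prod_mul,
      symmetrization, integral_map (by fun_prop) (by fun_prop)]
    refine integral_congr_ae (.of_forall fun z => ?_)
    simp only
    rw [← Complex.exp_add]
    congr 1
    push_cast; ring
  rw [charFun_neg, Complex.mul_conj, Complex.normSq_eq_norm_sq] at h1
  have h2 : (charFun (symmetrization μ) t).re = ∫ x, Real.cos (t * x) ∂(symmetrization μ) := by
    rw [charFun_apply_real]
    have hi : Integrable (fun x : ℝ => Complex.exp ((t : ℂ) * x * Complex.I)) (symmetrization μ) :=
      integrable_exp_mul_I t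
    have := integral_re hi
    simp only [RCLike.re_eq_complex_re] at this
    rw [← this]
    refine integral_congr_ae (.of_forall fun x => ?_)
    simp only
    rw [← Complex.ofReal_mul, Complex.exp_ofReal_mul_I_re]
  rw [integral_sub (integrable_const 1) (Integrable.mono' (integrable_const 1) (by fun_prop)
    (.of_forall fun x => Real.abs_cos_le_one _)), ← h2, h1, Complex.ofReal_re]
  simp

/-- Truncated second moments of `μ` are controlled by those of its symmetrization, since the second
variable lies in some fixed interval with probability at least `1 / 2`. -/
theorem exists_scaledMoment_le_symmetrization : ∃ K, ∀ a, 0 < a →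
    scaledMoment μ a ≤ 4 * scaledMoment (symmetrization μ) a + K / a ^ 2 := by
  obtain ⟨K, hK, hK0⟩ := (((tendsto_absTail μ).eventually_lt_const
    (show (0 : ℝ) < 1 / 2 by norm_num)).and (eventually_ge_atTop 0)).exists
  refine ⟨4 * K ^ 2, fun a ha => ?_⟩
  set A : Set ℝ := {x | |x| ≤ K} with hA
  have hAm : MeasurableSet A := measurableSet_abs_le K
  have hAμ : 1 / 2 ≤ μ.real A := by
    have : μ.real Aᶜ = absTail μ K := by
      rw [absTail]; congr 1; ext x; simp [hA]
    have h2 := probReal_compl_eq_one_sub (μ := μ) hAm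
    linarith
  have hint : Integrable (fun z : ℝ × ℝ => min 1 (((z.1 - z.2) / a) ^ 2)) (μ.prod μ) :=
    Integrable.mono' (integrable_const 1) (by fun_prop) (.of_forall fun x => by
      rw [Real.norm_of_nonneg (by positivity)]
      exact min_le_left _ _)
  have h1 : scaledMoment (symmetrization μ) a = ∫ z, min 1 (((z.1 - z.2) / a) ^ 2) ∂(μ.prod μ) := by
    rw [scaledMoment, symmetrization, integral_map (by fun_prop)]
    exact Continuous.aestronglyMeasurable (by fun_prop)
  have hindA : Integrable (A.indicator fun _ => (1 : ℝ)) μ := (integrable_const 1).indicator hAm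
  have hprod : Integrable (fun z : ℝ × ℝ => min 1 ((z.1 / a) ^ 2) * A.indicator (fun _ => (1 : ℝ)) z.2)
      (μ.prod μ) := (integrable_min_one_sq μ a).mul_prod hindA
  have h2 : scaledMoment μ a * μ.real A
      = ∫ z : ℝ × ℝ, min 1 ((z.1 / a) ^ 2) * A.indicator (fun _ => (1 : ℝ)) z.2 ∂(μ.prod μ) := by
    have := integral_prod_mul (μ := μ) (ν := μ) (fun x => min 1 ((x / a) ^ 2))
      (A.indicator fun _ => (1 : ℝ))
    rw [this, integral_indicator hAm, setIntegral_one_eq_measureReal, scaledMoment]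
  have h3 : scaledMoment μ a * μ.real A
      ≤ ∫ z : ℝ × ℝ, (2 * min 1 (((z.1 - z.2) / a) ^ 2) + 2 * (K ^ 2 / a ^ 2)) ∂(μ.prod μ) := by
    rw [h2]
    refine integral_mono hprod ((hint.const_mul 2).add (integrable_const _)) fun z => ?_
    simp only
    by_cases hz : z.2 ∈ A
    · rw [Set.indicator_of_mem hz, mul_one]
      have hz : |z.2| ≤ K := hz
      have h4 : (z.2 / a) ^ 2 ≤ K ^ 2 / a ^ 2 := by
        rw [div_pow, ← sq_abs z.2]; gcongr
      have h5 : (z.1 / a) ^ 2 ≤ 2 * ((z.1 - z.2) / a) ^ 2 + 2 * (K ^ 2 / a ^ 2) := by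
        have : z.1 / a = (z.1 - z.2) / a + z.2 / a := by ring
        rw [this]
        nlinarith [sq_nonneg ((z.1 - z.2) / a - z.2 / a)]
      have h6 : 0 ≤ K ^ 2 / a ^ 2 := by positivity
      rcases le_total 1 (((z.1 - z.2) / a) ^ 2) with h | h
      · rw [min_eq_left h]
        linarith [min_le_left 1 ((z.1 / a) ^ 2)]
      · rw [min_eq_right h]
        exact (min_le_right _ _).trans h5
    · rw [Set.indicator_of_notMem hz, mul_zero]
      positivity
  rw [integral_add (hint.const_mul 2) (integrable_const _), integral_const_mul, ← h1] at h3
  simp only [integral_const, probReal_univ, one_smul] at h3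
  have h7 := scaledMoment_nonneg μ a
  have h8 : 4 * K ^ 2 / a ^ 2 = 4 * (K ^ 2 / a ^ 2) := by ring
  nlinarith

end Symmetrization

/-- Quadratic behaviour of `∫ (1 - cos)` at `0` when the second moment is finite. -/
theorem tendsto_sq_mul_integral_one_sub_cos {ν : Measure ℝ} (hν : Integrable (fun x : ℝ => x ^ 2) ν)
    {a : ℕ → ℝ} (ha : Tendsto a atTop atTop) (t : ℝ) :
    Tendsto (fun n => a n ^ 2 * ∫ x, (1 - Real.cos (t * (x / a n))) ∂ν) atTop
      (𝓝 (t ^ 2 / 2 * ∫ x, x ^ 2 ∂ν)) := by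
  simp_rw [← integral_const_mul]
  refine tendsto_integral_filter_of_dominated_convergence (fun x => t ^ 2 / 2 * x ^ 2)
    (.of_forall fun n => by fun_prop) ?_ (hν.const_mul _) (.of_forall fun x => ?_)
  · filter_upwards [ha.eventually_gt_atTop 0] with n hn
    refine .of_forall fun x => ?_
    have h1 := Real.one_sub_sq_div_two_le_cos (x := t * (x / a n))
    have h2 := Real.cos_le_one (t * (x / a n))
    rw [Real.norm_of_nonneg (mul_nonneg (sq_nonneg _) (by linarith))]
    calc a n ^ 2 * (1 - Real.cos (t * (x / a n))) ≤ a n ^ 2 * ((t * (x / a n)) ^ 2 / 2) := by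
          gcongr; linarith
      _ = t ^ 2 / 2 * x ^ 2 := by field_simp
  · have hs : Tendsto (fun n => t * (x / a n)) atTop (𝓝 0) := by
      simpa using (tendsto_const_nhds.div_atTop ha).const_mul t
    have h3 : Tendsto (fun n => t ^ 2 / 2 * x ^ 2 - t ^ 2 * x ^ 2 * (t * (x / a n)) ^ 2) atTop
        (𝓝 (t ^ 2 / 2 * x ^ 2)) := by
      simpa using tendsto_const_nhds.sub ((hs.pow 2).const_mul (t ^ 2 * x ^ 2))
    refine tendsto_of_tendsto_of_tendsto_of_le_of_le' h3 tendsto_const_nhds ?_ ?_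
    · filter_upwards [ha.eventually_gt_atTop 0,
        hs.eventually_mem (Metric.ball_mem_nhds 0 one_pos)] with n hn hn1
      rw [mem_ball_zero_iff, Real.norm_eq_abs] at hn1
      have h4 := (abs_le.1 (Real.cos_bound hn1.le)).2
      have h5 : |t * (x / a n)| ^ 4 = (t * (x / a n)) ^ 4 := by
        rw [show (4 : ℕ) = 2 * 2 from rfl, pow_mul, pow_mul, sq_abs]
      calc t ^ 2 / 2 * x ^ 2 - t ^ 2 * x ^ 2 * (t * (x / a n)) ^ 2
          = a n ^ 2 * ((t * (x / a n)) ^ 2 / 2 - (t * (x / a n)) ^ 4) := by field_simp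
        _ ≤ a n ^ 2 * (1 - Real.cos (t * (x / a n))) := by
          refine mul_le_mul_of_nonneg_left ?_ (sq_nonneg _)
          rw [h5] at h4
          nlinarith [pow_nonneg (sq_nonneg (t * (x / a n))) 2]
    · filter_upwards [ha.eventually_gt_atTop 0] with n hn
      have h1 := Real.one_sub_sq_div_two_le_cos (x := t * (x / a n))
      calc a n ^ 2 * (1 - Real.cos (t * (x / a n))) ≤ a n ^ 2 * ((t * (x / a n)) ^ 2 / 2) := by
            gcongr; linarith
        _ = t ^ 2 / 2 * x ^ 2 := by field_simp

/-! ### Consequences of attraction to a stable law -/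

theorem re_stableExponent {α σ β δ : ℝ} (h0 : 0 < α) (t : ℝ) :
    (stableExponent α σ β δ t).re = -(σ * |t|) ^ α := by
  unfold stableExponent
  split_ifs with h
  · subst h
    simp
  · have h1 : (1 - Complex.I * ((β * Real.sign t * Real.tan (Real.pi * α / 2) : ℝ) : ℂ)).re = 1 := by
      simp [-Complex.ofReal_mul]
    rw [Complex.add_re, ← Complex.ofReal_neg, Complex.re_ofReal_mul, h1]
    simp [-Complex.ofReal_mul]

section Necessity

variable {μ : Measure ℝ} [IsProbabilityMeasure μ] {ψ : ℝ → ℂ} {a θ : ℕ → ℝ}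

/-- Taking absolute values removes the centring constants. -/
theorem tendsto_integral_one_sub_cos_symmetrization
    (hconv : ∀ t : ℝ, Tendsto (fun n => charFun μ (t / a n) ^ n
      * Complex.exp (-(Complex.I * ((t * θ n : ℝ) : ℂ)))) atTop (𝓝 (Complex.exp (ψ t)))) (t : ℝ) :
    Tendsto (fun n => ∫ x, (1 - Real.cos (t * x)) ∂(rescaledLaw (symmetrization μ) n (a n))) atTop
      (𝓝 (-2 * (ψ t).re)) := by
  have h1 : Tendsto (fun n => (‖charFun μ (t / a n)‖ ^ 2) ^ n) atTop
      (𝓝 (Real.exp (-(-2 * (ψ t).re)))) := by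
    have := (hconv t).norm.pow 2
    rw [Complex.norm_exp, ← Real.exp_nat_mul] at this
    rw [show -(-2 * (ψ t).re) = ((2 : ℕ) : ℝ) * (ψ t).re by push_cast; ring]
    refine this.congr fun n => ?_
    have h2 : ‖Complex.exp (-(Complex.I * ((t * θ n : ℝ) : ℂ)))‖ = 1 := by
      rw [← mul_neg, ← Complex.ofReal_neg, mul_comm, Complex.norm_exp_ofReal_mul_I]
    rw [norm_mul, h2, mul_one, norm_pow, ← pow_mul, ← pow_mul, mul_comm]
  refine (tendsto_nat_mul_one_sub (fun n => by positivity) h1).congr fun n => ?_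
  rw [integral_rescaledLaw (by fun_prop), smul_eq_mul, ← integral_one_sub_cos_symmetrization]
  congr 1
  refine integral_congr_ae (.of_forall fun x => ?_)
  simp only
  congr 2; ring

theorem not_ae_eq_zero_symmetrization (hre : (ψ 1).re < 0)
    (hconv : ∀ t : ℝ, Tendsto (fun n => charFun μ (t / a n) ^ n
      * Complex.exp (-(Complex.I * ((t * θ n : ℝ) : ℂ)))) atTop (𝓝 (Complex.exp (ψ t)))) :
    ¬ ∀ᵐ x ∂(symmetrization μ), x = 0 := by
  intro hae
  have h1 := tendsto_integral_one_sub_cos_symmetrization hconv 1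
  have h2 : Tendsto (fun n => ∫ x, (1 - Real.cos (1 * x))
      ∂(rescaledLaw (symmetrization μ) n (a n))) atTop (𝓝 0) := by
    refine tendsto_const_nhds.congr fun n => ?_
    rw [integral_rescaledLaw (by fun_prop), eq_comm, smul_eq_mul]
    refine mul_eq_zero_of_right _ (integral_eq_zero_of_ae ?_)
    filter_upwards [hae] with x hx
    simp [hx]
  have := tendsto_nhds_unique h1 h2
  linarith

/-- The law is not degenerate. -/
theorem not_ae_eq_const (hre : (ψ 1).re < 0)
    (hconv : ∀ t : ℝ, Tendsto (fun n => charFun μ (t / a n) ^ n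
      * Complex.exp (-(Complex.I * ((t * θ n : ℝ) : ℂ)))) atTop (𝓝 (Complex.exp (ψ t)))) (c : ℝ) :
    ¬ ∀ᵐ x ∂μ, x = c := by
  intro hae
  refine not_ae_eq_zero_symmetrization hre hconv ?_
  have hm : AEMeasurable (fun z : ℝ × ℝ => z.1 - z.2) (μ.prod μ) := by fun_prop
  refine (ae_map_iff (p := fun x : ℝ => x = 0) hm (measurableSet_singleton (0 : ℝ))).2 ?_
  have h1 := Measure.quasiMeasurePreserving_fst (μ := μ) (ν := μ) |>.ae hae
  have h2 := Measure.quasiMeasurePreserving_snd (μ := μ) (ν := μ) |>.ae hae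
  filter_upwards [h1, h2] with z hz1 hz2
  rw [hz1, hz2, sub_self]

/-- The norming constants diverge, and the rescaled laws integrate `min 1 x²` boundedly. -/
theorem norming_tendsto_and_bounded (hre : (ψ 1).re < 0) (ha : ∀ n, 0 < a n)
    (hconv : ∀ t : ℝ, Tendsto (fun n => charFun μ (t / a n) ^ n
      * Complex.exp (-(Complex.I * ((t * θ n : ℝ) : ℂ)))) atTop (𝓝 (Complex.exp (ψ t)))) :
    Tendsto a atTop atTop ∧ ∃ C, ∀ n : ℕ, n * scaledMoment μ (a n) ≤ C := by
  set ν := symmetrization μ with hν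
  obtain ⟨C, hC⟩ := exists_integral_min_le (tendsto_integral_one_sub_cos_symmetrization hconv)
  simp_rw [integral_min_rescaledLaw] at hC
  have hpos : ∀ b, 0 < b → 0 < scaledMoment ν b := by
    intro b hb
    refine (scaledMoment_nonneg ν b).lt_of_ne fun h0 => ?_
    have h1 := (integral_eq_zero_iff_of_nonneg (fun x => by positivity)
      (integrable_min_one_sq ν b)).1 h0.symm
    refine not_ae_eq_zero_symmetrization hre hconv ?_
    filter_upwards [h1] with x hx
    by_contra hne
    have h2 : 0 < min 1 ((x / b) ^ 2) := by positivity
    exact h2.ne' hx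
  have hanti : ∀ b b', 0 < b → b ≤ b' → scaledMoment ν b' ≤ scaledMoment ν b := by
    intro b b' hb hbb
    have hb' := hb.trans_le hbb
    refine integral_mono (integrable_min_one_sq ν b') (integrable_min_one_sq ν b) fun x => ?_
    simp only
    refine min_le_min le_rfl ?_
    rw [← sq_abs (x / b'), ← sq_abs (x / b), abs_div, abs_div, abs_of_pos hb,
      abs_of_pos hb']
    gcongr
  have hlim0 : Tendsto (fun n => scaledMoment ν (a n)) atTop (𝓝 0) := by
    refine squeeze_zero' (.of_forall fun n => scaledMoment_nonneg ν _) ?_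
      (tendsto_const_nhds (x := C).div_atTop tendsto_natCast_atTop_atTop)
    filter_upwards [eventually_gt_atTop 0] with n hn
    have : (0 : ℝ) < n := by exact_mod_cast hn
    rw [le_div_iff₀ this, mul_comm]
    exact hC n
  have hatop : Tendsto a atTop atTop := by
    refine tendsto_atTop.2 fun B => ?_
    have hB : 0 < max B 1 := by positivity
    filter_upwards [hlim0.eventually_lt_const (hpos _ hB)] with n hn
    by_contra! hcon
    exact not_le.2 hn (hanti _ _ (ha n) (hcon.le.trans (le_max_left _ _)))
  refine ⟨hatop, ?_⟩
  obtain ⟨K, hK⟩ := exists_scaledMoment_le_symmetrization μ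
  -- `n / a n ^ 2` is bounded since `scaledMoment ν (a n)` is at least of order `a n ^ (-2)`
  have hev : ∀ᶠ n : ℕ in atTop, n * scaledMoment μ (a n) ≤ 4 * C + |K| * (C / scaledMoment ν 1) := by
    filter_upwards [hatop.eventually_ge_atTop 1] with n hn
    have h1 : scaledMoment ν 1 / a n ^ 2 ≤ scaledMoment ν (a n) := by
      unfold scaledMoment
      rw [← integral_div]
      refine integral_mono ((integrable_min_one_sq ν 1).div_const _)
        (integrable_min_one_sq ν (a n)) fun x => ?_
      simp only [div_one]
      rw [div_le_iff₀ (by have := ha n; positivity), min_mul_of_nonneg _ _ (by positivity), one_mul,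
        div_pow, div_mul_cancel₀ _ (by have := ha n; positivity)]
      gcongr
      exact one_le_pow₀ hn
    have h2 : n / a n ^ 2 ≤ C / scaledMoment ν 1 := by
      rw [le_div_iff₀ (hpos 1 one_pos), div_mul_eq_mul_div, mul_div_assoc]
      exact (mul_le_mul_of_nonneg_left h1 (by positivity)).trans (hC n)
    have h3 := mul_le_mul_of_nonneg_left (hK (a n) (ha n)) (Nat.cast_nonneg (α := ℝ) n)
    have h4 : (n : ℝ) * (4 * scaledMoment ν (a n) + K / a n ^ 2)
        = 4 * (n * scaledMoment ν (a n)) + K * (n / a n ^ 2) := by ring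
    have h5 : K * (n / a n ^ 2) ≤ |K| * (C / scaledMoment ν 1) := by
      refine (mul_le_mul_of_nonneg_right (le_abs_self K) (by positivity)).trans ?_
      gcongr
    rw [h4] at h3
    linarith [hC n]
  obtain ⟨N, hN⟩ := eventually_atTop.1 hev
  obtain ⟨B, hB⟩ := ((Set.finite_lt_nat N).image fun n : ℕ => n * scaledMoment μ (a n)).bddAbove
  refine ⟨max B (4 * C + |K| * (C / scaledMoment ν 1)), fun n => ?_⟩
  rcases lt_or_ge n N with h | h
  · exact (hB ⟨n, h, rfl⟩).trans (le_max_left _ _)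
  · exact (hN n h).trans (le_max_right _ _)

/-- A square integrable law can only be attracted to a limit with quadratic exponent. -/
theorem re_exponent_eq_sq_mul (hre : (ψ 1).re < 0) (ha : ∀ n, 0 < a n)
    (hconv : ∀ t : ℝ, Tendsto (fun n => charFun μ (t / a n) ^ n
      * Complex.exp (-(Complex.I * ((t * θ n : ℝ) : ℂ)))) atTop (𝓝 (Complex.exp (ψ t))))
    (hμ : Integrable (fun x : ℝ => x ^ 2) μ) (t : ℝ) : (ψ t).re = t ^ 2 * (ψ 1).re := by
  obtain ⟨hatop, -⟩ := norming_tendsto_and_bounded hre ha hconv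
  set ν := symmetrization μ with hν
  have hint : Integrable (fun x : ℝ => x ^ 2) ν := by
    rw [hν, symmetrization, integrable_map_measure (by fun_prop) (by fun_prop)]
    have h1 : Integrable (fun z : ℝ × ℝ => 2 * z.1 ^ 2 + 2 * z.2 ^ 2) (μ.prod μ) :=
      ((hμ.comp_fst μ).const_mul 2).add ((hμ.comp_snd μ).const_mul 2)
    refine h1.mono' (by fun_prop) (.of_forall fun z => ?_)
    simp only [Function.comp]
    rw [Real.norm_of_nonneg (by positivity)]
    nlinarith [sq_nonneg (z.1 + z.2)]
  set s := ∫ x, x ^ 2 ∂ν with hs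
  have hs0 : s ≠ 0 := by
    intro h0
    have h1 := (integral_eq_zero_iff_of_nonneg (fun x => sq_nonneg x) hint).1 h0
    refine not_ae_eq_zero_symmetrization hre hconv ?_
    filter_upwards [h1] with x hx
    exact pow_eq_zero_iff (two_ne_zero) |>.1 hx
  have key : ∀ u, Tendsto (fun n => ∫ x, (1 - Real.cos (u * x)) ∂(rescaledLaw ν n (a n))) atTop
      (𝓝 (-2 * (ψ u).re)) := tendsto_integral_one_sub_cos_symmetrization hconv
  have hq := fun u => tendsto_sq_mul_integral_one_sub_cos hint hatop u
  have h1 := (key t).mul (hq 1)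
  have h2 := (key 1).mul (hq t)
  have h3 := tendsto_nhds_unique h1 (h2.congr fun n => by
    rw [integral_rescaledLaw (by fun_prop), integral_rescaledLaw (by fun_prop), smul_eq_mul,
      smul_eq_mul]
    ring)
  rw [← hs] at h3
  have h4 : s * ((ψ t).re - t ^ 2 * (ψ 1).re) = 0 := by linarith
  have := (mul_eq_zero.1 h4).resolve_left hs0
  linarith

/-- For a law without second moment, the powers of the characteristic function can be replaced
by exponentials, that is, by the characteristic functions of compound Poisson laws. -/
theorem tendsto_exp_charFun_sub_one (hre : (ψ 1).re < 0) (ha : ∀ n, 0 < a n)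
    (hconv : ∀ t : ℝ, Tendsto (fun n => charFun μ (t / a n) ^ n
      * Complex.exp (-(Complex.I * ((t * θ n : ℝ) : ℂ)))) atTop (𝓝 (Complex.exp (ψ t))))
    (hμ : ¬ Integrable (fun x : ℝ => x ^ 2) μ) (t : ℝ) :
    Tendsto (fun n : ℕ => Complex.exp (n * (charFun μ (t / a n) - 1)
      - Complex.I * ((t * θ n : ℝ) : ℂ))) atTop (𝓝 (Complex.exp (ψ t))) := by
  obtain ⟨hatop, C, hC⟩ := norming_tendsto_and_bounded hre ha hconv
  have hC0 : 0 ≤ C := le_trans (by simp) (hC 0)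
  have hsq : Tendsto (fun n : ℕ => (n : ℝ) * ‖charFun μ (t / a n) - 1‖ ^ 2) atTop (𝓝 0) := by
    have h1 := ((tendsto_sq_integral_min_div μ hμ).comp hatop).const_mul ((|t| + 2) ^ 2 * C)
    rw [mul_zero] at h1
    refine squeeze_zero (fun n => by positivity) (fun n => ?_) h1
    set A := ∫ x, min 1 |x / a n| ∂μ with hA
    have h2 := norm_charFun_sub_one_le μ t (a n)
    have h3 : ‖charFun μ (t / a n) - 1‖ ^ 2 ≤ (|t| + 2) ^ 2 * A ^ 2 := by
      rw [← mul_pow]; gcongr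
    have h4 : A ^ 2 = A ^ 2 / scaledMoment μ (a n) * scaledMoment μ (a n) := by
      rcases (scaledMoment_nonneg μ (a n)).eq_or_lt with h0 | h0
      · have h5 := (integral_eq_zero_iff_of_nonneg (fun x => by positivity)
          (integrable_min_one_sq μ (a n))).1 h0.symm
        have h6 : A = 0 := by
          refine integral_eq_zero_of_ae ?_
          filter_upwards [h5] with x hx
          by_contra hne
          have hx0 : x / a n ≠ 0 := by rintro h; simp [h] at hne
          have h2 : 0 < min 1 ((x / a n) ^ 2) := by positivity
          exact h2.ne' hx
        rw [h6]; simp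
      · rw [div_mul_cancel₀ _ h0.ne']
    simp only [Function.comp]
    calc (n : ℝ) * ‖charFun μ (t / a n) - 1‖ ^ 2 ≤ n * ((|t| + 2) ^ 2 * A ^ 2) := by gcongr
      _ = (|t| + 2) ^ 2 * (A ^ 2 / scaledMoment μ (a n)) * (n * scaledMoment μ (a n)) := by
        nth_rewrite 1 [h4]; ring
      _ ≤ (|t| + 2) ^ 2 * (A ^ 2 / scaledMoment μ (a n)) * C := by
        gcongr
        · have := scaledMoment_nonneg μ (a n); positivity
        · exact hC n
      _ = _ := by ring
  have h1 := tendsto_one_add_pow_mul_exp hsq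
  have h2 := (hconv t).div h1 one_ne_zero
  rw [div_one] at h2
  refine h2.congr' ?_
  have hne : ∀ᶠ n : ℕ in atTop, charFun μ (t / a n) ^ n * Complex.exp (-(Complex.I * ((t * θ n : ℝ) : ℂ))) ≠ 0 :=
    (hconv t).eventually_ne (Complex.exp_ne_zero _)
  filter_upwards [hne] with n hn
  have hφ : charFun μ (t / a n) ^ n ≠ 0 := left_ne_zero_of_mul hn
  rw [Pi.div_apply, add_sub_cancel, mul_div_mul_left _ _ hφ, ← Complex.exp_sub]
  congr 1; ring

theorem tendsto_integral_one_sub_cos (hre : (ψ 1).re < 0) (ha : ∀ n, 0 < a n)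
    (hconv : ∀ t : ℝ, Tendsto (fun n => charFun μ (t / a n) ^ n
      * Complex.exp (-(Complex.I * ((t * θ n : ℝ) : ℂ)))) atTop (𝓝 (Complex.exp (ψ t))))
    (hμ : ¬ Integrable (fun x : ℝ => x ^ 2) μ) (t : ℝ) :
    Tendsto (fun n => ∫ x, (1 - Real.cos (t * x)) ∂(rescaledLaw μ n (a n))) atTop
      (𝓝 (-(ψ t).re)) := by
  have h1 := (tendsto_exp_charFun_sub_one hre ha hconv hμ t).norm
  simp_rw [Complex.norm_exp] at h1
  have h2 := ((Real.continuousAt_log (Real.exp_pos (ψ t).re).ne').tendsto.comp h1).neg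
  rw [Real.log_exp] at h2
  refine h2.congr fun n => ?_
  simp only [Function.comp, Real.log_exp]
  rw [integral_rescaledLaw (by fun_prop), smul_eq_mul]
  have hi : Integrable (fun x : ℝ => Complex.exp (((t / a n : ℝ) : ℂ) * x * Complex.I)) μ :=
    integrable_exp_mul_I _
  have h3 : (charFun μ (t / a n)).re = ∫ x, Real.cos (t * (x / a n)) ∂μ := by
    have := integral_re hi
    simp only [RCLike.re_eq_complex_re] at this
    rw [charFun_apply_real, ← this]
    refine integral_congr_ae (.of_forall fun x => ?_)
    simp only
    rw [← Complex.ofReal_mul, Complex.exp_ofReal_mul_I_re]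
    congr 1; ring
  rw [integral_sub (integrable_const 1) (Integrable.mono' (integrable_const 1) (by fun_prop)
    (.of_forall fun x => Real.abs_cos_le_one _)), ← h3]
  simp
  ring

/-- Second differences remove every linear term, in particular the centring `c`. -/
theorem two_mul_secondDiff_rescaledLaw (n : ℕ) (b c h t : ℝ) :
    2 * secondDiff (rescaledLaw μ n b) h t
      = 2 * (n * (charFun μ (t / b) - 1) - Complex.I * ((t * c : ℝ) : ℂ))
        - (n * (charFun μ ((t + h) / b) - 1) - Complex.I * (((t + h) * c : ℝ) : ℂ))
        - (n * (charFun μ ((t - h) / b) - 1) - Complex.I * (((t - h) * c : ℝ) : ℂ)) := by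
  have hi : ∀ u : ℝ, Integrable (fun x : ℝ => Complex.exp ((u : ℂ) * x * Complex.I)) μ :=
    fun u => integrable_exp_mul_I u
  have h1 : 2 * ∫ x : ℝ, Complex.exp ((t : ℂ) * ((x / b : ℝ) : ℂ) * Complex.I)
      * ((1 - Real.cos (h * (x / b)) : ℝ) : ℂ) ∂μ
      = 2 * charFun μ (t / b) - charFun μ ((t + h) / b) - charFun μ ((t - h) / b) := by
    simp_rw [charFun_apply_real]
    have e0 := integral_sub (((hi (t / b)).const_mul 2).sub (hi ((t + h) / b))) (hi ((t - h) / b))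
    have e00 := integral_sub ((hi (t / b)).const_mul 2) (hi ((t + h) / b))
    simp only [Pi.sub_apply] at e0
    rw [← integral_const_mul, ← integral_const_mul, ← e00, ← e0]
    refine integral_congr_ae (.of_forall fun x => ?_)
    simp only
    have e1 : Complex.exp ((((t + h) / b : ℝ) : ℂ) * x * Complex.I)
        = Complex.exp (((t / b : ℝ) : ℂ) * x * Complex.I)
          * Complex.exp (((h * (x / b) : ℝ) : ℂ) * Complex.I) := by
      rw [← Complex.exp_add]; congr 1; push_cast; ring
    have e2 : Complex.exp ((((t - h) / b : ℝ) : ℂ) * x * Complex.I)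
        = Complex.exp (((t / b : ℝ) : ℂ) * x * Complex.I)
          * Complex.exp (-((h * (x / b) : ℝ) : ℂ) * Complex.I) := by
      rw [← Complex.exp_add]; congr 1; push_cast; ring
    have e3 : Complex.exp ((t : ℂ) * ((x / b : ℝ) : ℂ) * Complex.I)
        = Complex.exp (((t / b : ℝ) : ℂ) * x * Complex.I) := by
      congr 1; push_cast; ring
    rw [e1, e2, e3]
    have := Complex.two_cos ((h * (x / b) : ℝ) : ℂ)
    rw [Complex.ofReal_sub, Complex.ofReal_one, Complex.ofReal_cos]
    linear_combination (-Complex.exp (((t / b : ℝ) : ℂ) * x * Complex.I)) * this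
  rw [secondDiff, integral_rescaledLaw (by fun_prop), Complex.real_smul]
  push_cast at h1 ⊢
  linear_combination (n : ℂ) * h1

/-- **Convergence to the Lévy measure.** If a law without second moment is attracted to the law
with exponent `ψ`, whose second differences correspond to the Lévy measure `L` and the Gaussian
coefficient `s`, then its rescalings converge to `L` away from the origin.
The second differences are small for a small step, so no branch of the logarithm interferes. -/
theorem tendsto_integral_levyMeasure {L : Measure ℝ} [SFinite L] {s h₀ : ℝ}
    (hψ0 : ψ 0 = 0) (hψneg : ∀ t, ψ (-t) = starRingEnd ℂ (ψ t))
    (hL : Integrable (fun x : ℝ => min 1 (x ^ 2)) L) (hs : 0 ≤ s)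
    (hψ : ∀ h t, 2 * ψ t - ψ (t + h) - ψ (t - h)
      = 2 * (secondDiff L h t + ((s * h ^ 2 : ℝ) : ℂ)))
    (hh0 : 0 < h₀) (hh1 : h₀ ≤ 1) (hsmall : ∀ h ∈ Set.Ioc 0 h₀, -1 / 2 ≤ (ψ h).re) (hneg : (ψ h₀).re < 0)
    (hre : (ψ 1).re < 0) (ha : ∀ n, 0 < a n)
    (hconv : ∀ t : ℝ, Tendsto (fun n => charFun μ (t / a n) ^ n
      * Complex.exp (-(Complex.I * ((t * θ n : ℝ) : ℂ)))) atTop (𝓝 (Complex.exp (ψ t))))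
    (hμ : ¬ Integrable (fun x : ℝ => x ^ 2) μ)
    {f : ℝ → ℝ} {B r : ℝ} (hf : Continuous f) (hr : 0 < r) (hB : ∀ x, |f x| ≤ B)
    (hfr : ∀ x, |x| ≤ r → f x = 0) :
    Tendsto (fun n : ℕ => (n : ℝ) * ∫ x, f (x / a n) ∂μ) atTop (𝓝 (∫ x, f x ∂L)) := by
  obtain ⟨hatop, C, hC⟩ := norming_tendsto_and_bounded hre ha hconv
  have hreal : ∀ h, (∫ x, (1 - Real.cos (h * x)) ∂L) + s * h ^ 2 = -(ψ h).re := by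
    intro h
    have h1 := hψ h 0
    rw [hψ0, zero_add, zero_sub, hψneg, secondDiff_zero, ← Complex.ofReal_add] at h1
    have h2 := congrArg Complex.re h1
    rw [← Complex.ofReal_ofNat 2, Complex.re_ofReal_mul, Complex.ofReal_re] at h2
    simp only [mul_zero, zero_sub, Complex.sub_re, Complex.neg_re, Complex.conj_re] at h2
    linarith
  have key := tendsto_integral_of_tendsto_secondDiff (M := fun n => rescaledLaw μ n (a n)) (L := L)
    (C := C) (s := s) hh0 hh1 hs (fun n => integrable_min_one_sq' _) hL
    (fun n => by rw [integral_min_rescaledLaw]; exact hC n) ?_ ?_ hf hr hB hfr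
  · refine key.congr fun n => ?_
    rw [integral_rescaledLaw hf, smul_eq_mul]
  · intro u hu t
    have hexp : Tendsto (fun n => Complex.exp (2 * secondDiff (rescaledLaw μ n (a n)) u t)) atTop
        (𝓝 (Complex.exp (2 * (secondDiff L u t + ((s * u ^ 2 : ℝ) : ℂ))))) := by
      have hE := tendsto_exp_charFun_sub_one hre ha hconv hμ
      have h1 := (((hE t).pow 2).div (hE (t + u)) (Complex.exp_ne_zero _)).div (hE (t - u))
        (Complex.exp_ne_zero _)
      simp only [← Complex.exp_nat_mul, ← Complex.exp_sub, Pi.div_def] at h1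
      rw [← hψ]
      refine (h1.congr fun n => ?_)
      rw [two_mul_secondDiff_rescaledLaw n (a n) (θ n) u t]
      simp
    have hbL : ‖2 * (secondDiff L u t + ((s * u ^ 2 : ℝ) : ℂ))‖ ≤ 1 := by
      have h1 := norm_secondDiff_le (M := L) u t
      have h2 := hreal u
      have h3 := hsmall u hu
      have h4 : ‖((s * u ^ 2 : ℝ) : ℂ)‖ = s * u ^ 2 := by
        rw [Complex.norm_real, Real.norm_of_nonneg (by positivity)]
      have h5 := norm_add_le (secondDiff L u t) ((s * u ^ 2 : ℝ) : ℂ)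
      rw [norm_mul, Complex.norm_two]
      linarith
    -- both arguments of `exp` have imaginary part in `(-π, π)`, so the exponentials can be inverted
    have hpi := Real.pi_gt_three
    have hlog : Complex.exp (2 * (secondDiff L u t + ((s * u ^ 2 : ℝ) : ℂ))) ∈ Complex.slitPlane := by
      refine Or.inl ?_
      have him := (Complex.abs_im_le_norm _).trans hbL
      rw [abs_le] at him
      rw [Complex.exp_re]
      exact mul_pos (Real.exp_pos _) (Real.cos_pos_of_mem_Ioo ⟨by linarith, by linarith⟩)
    have hlim := (continuousAt_clog hlog).tendsto.comp hexp
    have him := (Complex.abs_im_le_norm _).trans hbL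
    rw [abs_le] at him
    rw [Complex.log_exp (by linarith) (by linarith)] at hlim
    have hev : ∀ᶠ n in atTop, ‖2 * secondDiff (rescaledLaw μ n (a n)) u t‖ < 3 := by
      have h1 := tendsto_integral_one_sub_cos hre ha hconv hμ u
      filter_upwards [h1.eventually_lt_const (show -(ψ u).re < 3 / 2 by linarith [hsmall u hu])]
        with n hn
      have := norm_secondDiff_le (M := rescaledLaw μ n (a n)) u t
      rw [norm_mul, Complex.norm_two]
      linarith
    have h2 := (hlim.congr' (f₂ := fun n => 2 * secondDiff (rescaledLaw μ n (a n)) u t) (by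
      filter_upwards [hev] with n hn
      have := (Complex.abs_im_le_norm _).trans_lt hn
      rw [abs_lt] at this
      exact Complex.log_exp (by linarith) (by linarith))).const_mul (1 / 2 : ℂ)
    rw [← mul_assoc] at h2
    norm_num at h2
    simpa using h2
  · have h1 := hreal h₀
    have h2 : ∫ x, (1 - Real.cos (h₀ * x)) ∂L ≤ ∫ x, 40 * (1 - Real.sinc (h₀ * x)) ∂L := by
      refine integral_mono (integrable_one_sub_cos hL hh0.le hh1)
        ((integrable_one_sub_sinc hL hh0 hh1).const_mul _) fun x => ?_
      have h3 := one_sub_cos_le_min (h₀ * x)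
      have h4 := min_one_sq_le_sinc (h₀ * x)
      simp only
      linarith
    rw [integral_const_mul] at h2
    have h3 : 0 ≤ s * h₀ ^ 2 := by positivity
    linarith

end Necessity

/-! ### The Lévy measure of a stable law -/

/-- The measure `x^(-α-1) dx` on `(0, ∞)`. -/
noncomputable def powerMeasure (α : ℝ) : Measure ℝ :=
  (volume.restrict (Set.Ioi (0 : ℝ))).withDensity fun x => ENNReal.ofReal (x ^ (-α - 1))

instance (α : ℝ) : SFinite (powerMeasure α) := by unfold powerMeasure; infer_instance

/-- The Lévy measure of a stable law of index `α < 2`, with weights `p` and `q` on the positive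
and on the negative half-line. -/
noncomputable def stableLevyMeasure (α : ℝ) (p q : NNReal) : Measure ℝ :=
  p • powerMeasure α + q • (powerMeasure α).map Neg.neg

instance (α : ℝ) (p q : NNReal) : SFinite (stableLevyMeasure α p q) := by
  unfold stableLevyMeasure; infer_instance

theorem map_neg_stableLevyMeasure (α : ℝ) (p q : NNReal) :
    (stableLevyMeasure α p q).map Neg.neg = stableLevyMeasure α q p := by
  unfold stableLevyMeasure
  rw [Measure.map_add _ _ measurable_neg, Measure.map_smul, Measure.map_smul,
    Measure.map_map measurable_neg measurable_neg]
  have : (Neg.neg ∘ Neg.neg : ℝ → ℝ) = id := by ext; simp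
  rw [this, Measure.map_id, add_comm]

theorem integral_powerMeasure {E : Type*} [NormedAddCommGroup E] [NormedSpace ℝ E] (α : ℝ)
    (f : ℝ → E) : ∫ x, f x ∂(powerMeasure α) = ∫ x in Set.Ioi (0 : ℝ), x ^ (-α - 1) • f x := by
  rw [powerMeasure, integral_withDensity_eq_integral_toReal_smul (by fun_prop)
    (.of_forall fun x => by simp)]
  refine setIntegral_congr_fun measurableSet_Ioi fun x hx => ?_
  have hx : 0 < x := hx
  rw [ENNReal.toReal_ofReal (by positivity)]

theorem integrable_min_powerMeasure {α : ℝ} (h0 : 0 < α) (h2 : α < 2) :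
    Integrable (fun x : ℝ => min 1 (x ^ 2)) (powerMeasure α) := by
  rw [powerMeasure, integrable_withDensity_iff_integrable_smul' (by fun_prop)
    (.of_forall fun x => by simp)]
  refine IntegrableOn.congr_fun (integrableOn_min_one_sq_mul_rpow h0 h2) (fun x hx => ?_)
    measurableSet_Ioi
  have hx : 0 < x := hx
  rw [ENNReal.toReal_ofReal (by positivity), smul_eq_mul, mul_comm]

theorem integrable_map_neg_powerMeasure {E : Type*} [NormedAddCommGroup E] {α : ℝ} {f : ℝ → E}
    (hf : Integrable (fun x => f (-x)) (powerMeasure α)) :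
    Integrable f ((powerMeasure α).map Neg.neg) :=
  (integrable_map_equiv (MeasurableEquiv.neg ℝ) f).2 hf

theorem integrable_min_stableLevyMeasure {α : ℝ} (h0 : 0 < α) (h2 : α < 2) (p q : NNReal) :
    Integrable (fun x : ℝ => min 1 (x ^ 2)) (stableLevyMeasure α p q) := by
  have h := integrable_min_powerMeasure h0 h2
  refine Integrable.add_measure (h.smul_measure_nnreal) (Integrable.smul_measure_nnreal ?_)
  exact integrable_map_neg_powerMeasure (by simpa using h)

theorem integral_stableLevyMeasure {E : Type*} [NormedAddCommGroup E] [NormedSpace ℝ E] {α : ℝ}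
    {p q : NNReal} {f : ℝ → E} (hf : Integrable f (powerMeasure α))
    (hf' : Integrable (fun x => f (-x)) (powerMeasure α)) :
    ∫ x, f x ∂(stableLevyMeasure α p q)
      = (p : ℝ) • ∫ x, f x ∂(powerMeasure α) + (q : ℝ) • ∫ x, f (-x) ∂(powerMeasure α) := by
  rw [stableLevyMeasure, integral_add_measure hf.smul_measure_nnreal
    (integrable_map_neg_powerMeasure hf').smul_measure_nnreal, integral_smul_nnreal_measure,
    integral_smul_nnreal_measure]
  rw [show ∫ x, f x ∂((powerMeasure α).map Neg.neg) = ∫ x, f (-x) ∂(powerMeasure α) from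
    integral_map_equiv (MeasurableEquiv.neg ℝ) f]
  rfl

theorem measure_Ioi_lt_top {L : Measure ℝ} (hL : Integrable (fun x : ℝ => min 1 (x ^ 2)) L)
    {y : ℝ} (hy : 0 < y) : L (Set.Ioi y) < ⊤ := by
  refine lt_of_le_of_lt (measure_mono fun x hx => ?_)
    (hL.measure_norm_ge_lt_top (ε := min 1 (y ^ 2)) (by positivity))
  have hx : y < x := hx
  change min 1 (y ^ 2) ≤ ‖min 1 (x ^ 2)‖
  rw [Real.norm_of_nonneg (by positivity)]
  gcongr

theorem upTail_powerMeasure {α : ℝ} (h0 : 0 < α) {x : ℝ} (hx : 0 < x) :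
    upTail (powerMeasure α) x = x ^ (-α) / α := by
  rw [← integral_levyWeight_Ioi h0 hx, upTail, ← setIntegral_one_eq_measureReal,
    ← integral_indicator measurableSet_Ioi, integral_powerMeasure]
  have : ∀ y : ℝ, y ^ (-α - 1) • (Set.Ioi x).indicator (fun _ => (1 : ℝ)) y
      = (Set.Ioi x).indicator (fun y => y ^ (-α - 1)) y := by
    intro y
    by_cases hy : y ∈ Set.Ioi x <;> simp [hy]
  simp_rw [this]
  rw [setIntegral_indicator measurableSet_Ioi, Set.Ioi_inter_Ioi, max_eq_right hx.le]

theorem upTail_stableLevyMeasure {α : ℝ} (h0 : 0 < α) (p q : NNReal) {x : ℝ}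
    (hx : 0 < x) : upTail (stableLevyMeasure α p q) x = p * (x ^ (-α) / α) := by
  have hneg : ((powerMeasure α).map Neg.neg) (Set.Ioi x) = 0 := by
    rw [Measure.map_apply measurable_neg measurableSet_Ioi]
    have h3 : (powerMeasure α) (Set.Iic 0) = 0 := by
      refine withDensity_absolutelyContinuous _ _ ?_
      rw [Measure.restrict_apply measurableSet_Iic, Set.Iic_inter_Ioi, Set.Ioc_self, measure_empty]
    refine measure_mono_null (fun y hy => ?_) h3
    have hy : x < -y := hy
    exact (by linarith : y ≤ 0)
  rw [← upTail_powerMeasure h0 hx, upTail, upTail, measureReal_def, stableLevyMeasure,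
    Measure.add_apply, Measure.smul_apply, Measure.smul_apply, hneg, smul_zero, add_zero,
    measureReal_def, ENNReal.smul_def, smul_eq_mul, ENNReal.toReal_mul, ENNReal.coe_toReal]

theorem levyExponent_eq_integral (α u : ℝ) :
    levyExponent α u = ∫ x, levyKernel u x ∂(powerMeasure α) := by
  rw [integral_powerMeasure, levyExponent, laplaceExponent]
  refine setIntegral_congr_fun measurableSet_Ioi fun x _ => ?_
  simp only [levyWeight, Complex.real_smul, levyKernel]
  ring

theorem integrable_levyKernel {α : ℝ} (h0 : 0 < α) (h2 : α < 2) (t : ℝ) :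
    Integrable (levyKernel t) (powerMeasure α) :=
  ((integrable_min_powerMeasure h0 h2).const_mul _).mono'
    (continuous_levyKernel t).aestronglyMeasurable (.of_forall (norm_levyKernel_le t))

theorem levyExponent_secondDiff {α : ℝ} (h0 : 0 < α) (h2 : α < 2) (h t : ℝ) :
    2 * levyExponent α t - levyExponent α (t + h) - levyExponent α (t - h)
      = 2 * secondDiff (powerMeasure α) h t := by
  simp_rw [levyExponent_eq_integral]
  have hi := integrable_levyKernel h0 h2
  have e0 := integral_sub (((hi t).const_mul 2).sub (hi (t + h))) (hi (t - h))
  have e00 := integral_sub ((hi t).const_mul 2) (hi (t + h))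
  simp only [Pi.sub_apply] at e0
  rw [secondDiff, ← integral_const_mul, ← integral_const_mul, ← e00, ← e0]
  refine integral_congr_ae (.of_forall fun x => ?_)
  simp only [levyKernel, laplaceKernel]
  have e1 : Complex.exp (-(-(Complex.I * ((t + h : ℝ) : ℂ)) * x))
      = Complex.exp ((t : ℂ) * x * Complex.I) * Complex.exp (((h * x : ℝ) : ℂ) * Complex.I) := by
    rw [← Complex.exp_add]; congr 1; push_cast; ring
  have e2 : Complex.exp (-(-(Complex.I * ((t - h : ℝ) : ℂ)) * x))
      = Complex.exp ((t : ℂ) * x * Complex.I) * Complex.exp (-((h * x : ℝ) : ℂ) * Complex.I) := by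
    rw [← Complex.exp_add]; congr 1; push_cast; ring
  have e3 : Complex.exp (-(-(Complex.I * (t : ℂ)) * x)) = Complex.exp ((t : ℂ) * x * Complex.I) := by
    congr 1; ring
  rw [e1, e2, e3]
  have := Complex.two_cos ((h * x : ℝ) : ℂ)
  rw [Complex.ofReal_sub 1, Complex.ofReal_one, Complex.ofReal_cos]
  push_cast at this ⊢
  linear_combination Complex.exp ((t : ℂ) * x * Complex.I) * this

theorem stableLevyMeasure_secondDiff {α : ℝ} (h0 : 0 < α) (h2 : α < 2) (p q : NNReal) (h t : ℝ) :
    secondDiff (stableLevyMeasure α p q) h t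
      = p * secondDiff (powerMeasure α) h t + q * secondDiff (powerMeasure α) h (-t) := by
  have hint : ∀ t : ℝ, Integrable (fun x : ℝ => Complex.exp ((t : ℂ) * x * Complex.I)
      * ((1 - Real.cos (h * x) : ℝ) : ℂ)) (powerMeasure α) := by
    intro t
    refine ((integrable_min_powerMeasure h0 h2).const_mul (2 * max 1 (h ^ 2))).mono' (by fun_prop)
      (.of_forall fun x => ?_)
    rw [norm_mul, norm_exp_mul_ofReal_mul_I, one_mul, Complex.norm_real,
      Real.norm_of_nonneg (by linarith [Real.cos_le_one (h * x)]), mul_assoc]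
    refine (one_sub_cos_le_min _).trans ?_
    gcongr
    rw [mul_min_of_nonneg _ _ (by positivity), mul_one, mul_pow]
    refine min_le_min (le_max_left _ _) ?_
    gcongr
    exact le_max_right _ _
  have hrefl : ∀ x : ℝ, Complex.exp ((t : ℂ) * ((-x : ℝ) : ℂ) * Complex.I)
      * ((1 - Real.cos (h * -x) : ℝ) : ℂ) = Complex.exp (((-t : ℝ) : ℂ) * x * Complex.I)
      * ((1 - Real.cos (h * x) : ℝ) : ℂ) := by
    intro x
    rw [mul_neg, Real.cos_neg]
    congr 2; push_cast; ring
  rw [secondDiff, integral_stableLevyMeasure (hint t) (by simp_rw [hrefl]; exact hint (-t))]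
  simp_rw [hrefl]
  rw [Complex.real_smul, Complex.real_smul]
  rfl

/-! ### Limits of the rescaled tails -/

/-- Convergence away from the origin gives convergence of the tails at continuity points, by
squeezing indicators between piecewise linear functions. -/
theorem tendsto_mul_upTail {μ L : Measure ℝ} [IsFiniteMeasure μ]
    (hL : Integrable (fun x : ℝ => min 1 (x ^ 2)) L) {a : ℕ → ℝ} (ha : ∀ n, 0 < a n)
    (h : ∀ {f : ℝ → ℝ} {B r : ℝ}, Continuous f → 0 < r → (∀ x, |f x| ≤ B) →
      (∀ x, |x| ≤ r → f x = 0) →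
      Tendsto (fun n : ℕ => (n : ℝ) * ∫ x, f (x / a n) ∂μ) atTop (𝓝 (∫ x, f x ∂L)))
    {x : ℝ} (hx : 0 < x) (hcont : ContinuousAt (upTail L) x) :
    Tendsto (fun n : ℕ => (n : ℝ) * upTail μ (x * a n)) atTop (𝓝 (upTail L x)) := by
  have ramp : ∀ y z : ℝ, 0 < y → y < z → ∃ c : ℝ,
      Tendsto (fun n : ℕ => (n : ℝ) * ∫ x, (max 0 (min 1 ((x / a n - y) / (z - y)))) ∂μ) atTop (𝓝 c) ∧
      upTail L z ≤ c ∧ c ≤ upTail L y ∧ ∀ n, upTail μ (z * a n)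
        ≤ (∫ x, (max 0 (min 1 ((x / a n - y) / (z - y)))) ∂μ) ∧
        (∫ x, (max 0 (min 1 ((x / a n - y) / (z - y)))) ∂μ) ≤ upTail μ (y * a n) := by
    intro y z hy hyz
    have hyz' : 0 < z - y := by linarith
    have hb : ∀ x, max 0 (min 1 ((x - y) / (z - y))) ≤ (Set.Ioi y).indicator (fun _ => (1 : ℝ)) x := by
      intro x
      by_cases hxy : y < x
      · rw [Set.indicator_of_mem (by exact hxy)]
        exact max_le zero_le_one (min_le_left _ _)
      · rw [Set.indicator_of_notMem (by exact hxy)]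
        refine max_le le_rfl ((min_le_right _ _).trans ?_)
        exact div_nonpos_of_nonpos_of_nonneg (by linarith) hyz'.le
    have hb' : ∀ x, (Set.Ioi z).indicator (fun _ => (1 : ℝ)) x ≤ max 0 (min 1 ((x - y) / (z - y))) := by
      intro x
      by_cases hxz : z < x
      · rw [Set.indicator_of_mem (by exact hxz)]
        refine le_max_of_le_right (le_min le_rfl ?_)
        rw [one_le_div hyz']; linarith
      · rw [Set.indicator_of_notMem (by exact hxz)]
        exact le_max_left _ _
    have habs : ∀ x, |max 0 (min 1 ((x - y) / (z - y)))| ≤ 1 := by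
      intro x
      rw [abs_of_nonneg (le_max_left _ _)]
      exact max_le zero_le_one (min_le_left _ _)
    have hIL : ∀ w, 0 < w → Integrable ((Set.Ioi w).indicator fun _ => (1 : ℝ)) L := fun w hw =>
      (integrable_indicator_iff measurableSet_Ioi).2
        (integrableOn_const (measure_Ioi_lt_top hL hw).ne)
    have hIμ : ∀ w, Integrable ((Set.Ioi w).indicator fun _ => (1 : ℝ)) μ := fun w =>
      (integrable_const 1).indicator measurableSet_Ioi
    have hIr : Integrable (fun x => max 0 (min 1 ((x - y) / (z - y)))) L :=
      (hIL y hy).mono' (Continuous.aestronglyMeasurable (by fun_prop)) (.of_forall fun x => by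
        rw [Real.norm_of_nonneg (le_max_left _ _)]; exact hb x)
    have hIrμ : ∀ n, Integrable (fun x => max 0 (min 1 ((x / a n - y) / (z - y)))) μ := fun n =>
      (integrable_const 1).mono' (Continuous.aestronglyMeasurable (by fun_prop))
        (.of_forall fun x => habs _)
    have hup : ∀ (m : Measure ℝ) w, upTail m w = ∫ x, (Set.Ioi w).indicator (fun _ => (1 : ℝ)) x ∂m := by
      intro m w
      rw [integral_indicator measurableSet_Ioi, setIntegral_one_eq_measureReal, upTail]
    refine ⟨_, h (f := fun x => max 0 (min 1 ((x - y) / (z - y)))) (by fun_prop) hy habs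
      fun x hxy => ?_, ?_, ?_, fun n => ⟨?_, ?_⟩⟩
    · refine max_eq_left ((min_le_right _ _).trans ?_)
      exact div_nonpos_of_nonpos_of_nonneg (by linarith [le_abs_self x]) hyz'.le
    · rw [hup]; exact integral_mono (hIL z (hy.trans hyz)) hIr hb'
    · rw [hup]; exact integral_mono hIr (hIL y hy) hb
    · rw [hup]
      refine integral_mono (hIμ _) (hIrμ n) fun x => ?_
      refine le_trans (le_of_eq ?_) (hb' (x / a n))
      simp only [Set.indicator, Set.mem_Ioi, lt_div_iff₀ (ha n)]
    · rw [hup]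
      refine integral_mono (hIrμ n) (hIμ _) fun x => ?_
      refine (hb (x / a n)).trans (le_of_eq ?_)
      simp only [Set.indicator, Set.mem_Ioi, lt_div_iff₀ (ha n)]
  refine tendsto_order.2 ⟨fun C hC => ?_, fun C hC => ?_⟩
  · have h1 : ∀ᶠ z in 𝓝[>] x, C < upTail L z :=
      (hcont.tendsto.mono_left nhdsWithin_le_nhds).eventually_const_lt hC
    obtain ⟨z, hz, hxz⟩ := (h1.and self_mem_nhdsWithin).exists
    obtain ⟨c, hc, hc1, -, hn⟩ := ramp x z hx hxz
    filter_upwards [hc.eventually_const_lt (hz.trans_le hc1)] with n hn1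
    exact hn1.trans_le (mul_le_mul_of_nonneg_left (hn n).2 (Nat.cast_nonneg n))
  · have h1 : ∀ᶠ z in 𝓝[<] x, upTail L z < C :=
      (hcont.tendsto.mono_left nhdsWithin_le_nhds).eventually_lt_const hC
    have h2 : ∀ᶠ z in 𝓝[<] x, 0 < z := nhdsWithin_le_nhds (lt_mem_nhds hx)
    obtain ⟨z, ⟨hz, hz0⟩, hxz⟩ := ((h1.and h2).and self_mem_nhdsWithin).exists
    obtain ⟨c, hc, -, hc1, hn⟩ := ramp z x hz0 hxz
    filter_upwards [hc.eventually_lt_const (hc1.trans_lt hz)] with n hn1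
    exact lt_of_le_of_lt (mul_le_mul_of_nonneg_left (hn n).1 (Nat.cast_nonneg n)) hn1

/-- Tail ratios from the limits along norming constants. For large `t`, the index
`n = ⌊κ / T t⌋` satisfies `a n ~ t`. -/
theorem tendsto_div_of_norming {F T : ℝ → ℝ} {a : ℕ → ℝ} {α P κ : ℝ} (hα : 0 < α) (hκ : 0 < κ)
    (hT : Antitone T) (hTlim : Tendsto T atTop (𝓝 0)) (hF : Antitone F)
    (hatop : Tendsto a atTop atTop)
    (hTn : ∀ x, 0 < x → Tendsto (fun n : ℕ => (n : ℝ) * T (x * a n)) atTop (𝓝 (κ * x ^ (-α))))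
    (hFn : ∀ x, 0 < x → Tendsto (fun n : ℕ => (n : ℝ) * F (x * a n)) atTop (𝓝 (P * x ^ (-α))))
    {c : ℝ} (hc : 0 < c) : Tendsto (fun t => F (c * t) / T t) atTop (𝓝 (P / κ * c ^ (-α))) := by
  have hpos : ∀ t, 0 < T t := by
    intro t
    have h1 := hTn 1 one_pos
    simp only [one_mul, Real.one_rpow, mul_one] at h1
    obtain ⟨n, hn, hn2⟩ := ((h1.eventually_const_lt hκ).and (hatop.eventually_ge_atTop t)).exists
    have h2 : 0 < T (a n) := by
      by_contra! hcon
      exact not_lt.2 (mul_nonpos_of_nonneg_of_nonpos (Nat.cast_nonneg n) hcon) hn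
    exact h2.trans_le (hT hn2)
  set N : ℝ → ℕ := fun t => ⌊κ / T t⌋₊ with hN
  have hinv : Tendsto (fun t => κ / T t) atTop atTop := by
    refine Tendsto.const_mul_atTop hκ (Tendsto.inv_tendsto_nhdsGT_zero ?_)
    exact tendsto_nhdsWithin_iff.2 ⟨hTlim, .of_forall hpos⟩
  have hNtop : Tendsto N atTop atTop := tendsto_nat_floor_atTop.comp hinv
  have hNT : Tendsto (fun t => (N t : ℝ) * T t) atTop (𝓝 κ) := by
    have h1 : Tendsto (fun t => κ - T t) atTop (𝓝 κ) := by simpa using hTlim.const_sub κ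
    refine tendsto_of_tendsto_of_tendsto_of_le_of_le h1 tendsto_const_nhds (fun t => ?_) fun t => ?_
    · have := Nat.lt_floor_add_one (κ / T t)
      rw [div_lt_iff₀ (hpos t)] at this
      simp only [hN]
      linarith
    · have := Nat.floor_le (div_pos hκ (hpos t)).le
      rwa [le_div_iff₀ (hpos t)] at this
  have hup : ∀ x, 1 < x → ∀ᶠ t in atTop, t ≤ x * a (N t) := by
    intro x hx
    have h1 := (hTn x (by linarith)).comp hNtop
    have h2 : κ * x ^ (-α) < κ := by
      have := Real.rpow_lt_one_of_one_lt_of_neg hx (neg_lt_zero.2 hα)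
      nlinarith
    filter_upwards [h1.eventually_lt hNT h2] with t ht
    by_contra! hcon
    exact not_le.2 ht (mul_le_mul_of_nonneg_left (hT hcon.le) (Nat.cast_nonneg _))
  have hdown : ∀ x, 0 < x → x < 1 → ∀ᶠ t in atTop, x * a (N t) ≤ t := by
    intro x hx0 hx
    have h1 := (hTn x hx0).comp hNtop
    have h2 : κ < κ * x ^ (-α) := by
      have := Real.one_lt_rpow_of_pos_of_lt_one_of_neg hx0 hx (neg_lt_zero.2 hα)
      nlinarith
    filter_upwards [hNT.eventually_lt h1 h2] with t ht
    by_contra! hcon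
    exact not_le.2 ht (mul_le_mul_of_nonneg_left (hT hcon.le) (Nat.cast_nonneg _))
  have hlim : Tendsto (fun t => (N t : ℝ) * F (c * t)) atTop (𝓝 (P * c ^ (-α))) := by
    have hcont : Tendsto (fun x : ℝ => P * (c * x) ^ (-α)) (𝓝 1) (𝓝 (P * c ^ (-α))) := by
      have : ContinuousAt (fun x : ℝ => P * (c * x) ^ (-α)) 1 := by
        refine continuousAt_const.mul (ContinuousAt.rpow_const (by fun_prop) (Or.inl ?_))
        simpa using hc.ne'
      simpa using this.tendsto
    refine tendsto_order.2 ⟨fun C hC => ?_, fun C hC => ?_⟩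
    · have h1 : ∀ᶠ x in 𝓝[>] (1 : ℝ), C < P * (c * x) ^ (-α) :=
        (hcont.mono_left nhdsWithin_le_nhds).eventually_const_lt hC
      obtain ⟨x, hx, hx1⟩ := (h1.and self_mem_nhdsWithin).exists
      have hx1 : 1 < x := hx1
      filter_upwards [((hFn (c * x) (by positivity)).comp hNtop).eventually_const_lt hx, hup x hx1]
        with t ht ht1
      refine ht.trans_le (mul_le_mul_of_nonneg_left (hF ?_) (Nat.cast_nonneg _))
      rw [mul_assoc]; gcongr
    · have h1 : ∀ᶠ x in 𝓝[<] (1 : ℝ), P * (c * x) ^ (-α) < C :=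
        (hcont.mono_left nhdsWithin_le_nhds).eventually_lt_const hC
      have h2 : ∀ᶠ x in 𝓝[<] (1 : ℝ), 0 < x := nhdsWithin_le_nhds (lt_mem_nhds one_pos)
      obtain ⟨x, ⟨hx, hx0⟩, hx1⟩ := ((h1.and h2).and self_mem_nhdsWithin).exists
      have hx1 : x < 1 := hx1
      filter_upwards [((hFn (c * x) (by positivity)).comp hNtop).eventually_lt_const hx,
        hdown x hx0 hx1] with t ht ht1
      refine lt_of_le_of_lt (mul_le_mul_of_nonneg_left (hF ?_) (Nat.cast_nonneg _)) ht
      rw [mul_assoc]; gcongr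
  have h3 := hlim.div hNT hκ.ne'
  rw [div_mul_eq_mul_div]
  refine h3.congr' ?_
  filter_upwards [hNtop.eventually_gt_atTop 0] with t ht
  have : (N t : ℝ) ≠ 0 := by exact_mod_cast ht.ne'
  rw [Pi.div_apply, mul_div_mul_left _ _ this]

/-- A step below which the real part of the exponent is small enough to invert exponentials. -/
theorem exists_small_step (σ : ℝ) {α : ℝ} (hα : 0 < α) :
    ∃ h₀ : ℝ, 0 < h₀ ∧ h₀ ≤ 1 ∧ ∀ h ∈ Set.Ioc 0 h₀, (σ * |h|) ^ α ≤ 1 / 2 := by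
  have h1 : Tendsto (fun h : ℝ => (σ * |h|) ^ α) (𝓝 0) (𝓝 0) := by
    have : Continuous fun h : ℝ => (σ * |h|) ^ α :=
      (by fun_prop : Continuous fun h : ℝ => σ * |h|).rpow_const fun _ => Or.inr hα.le
    have := this.tendsto 0
    simpa [Real.zero_rpow hα.ne'] using this
  obtain ⟨e, he, hb⟩ := Metric.eventually_nhds_iff.1
    (h1.eventually_lt_const (show (0 : ℝ) < 1 / 2 by norm_num))
  refine ⟨min 1 (e / 2), by positivity, min_le_left _ _, fun h hh => (hb ?_).le⟩
  rw [Real.dist_eq, sub_zero, abs_of_pos hh.1]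
  exact (hh.2.trans (min_le_right _ _)).trans_lt (by linarith)

/-- **Necessity, index below two.** A law attracted to an `α`-stable law has a regularly varying
two-sided tail, and balanced tails. -/
theorem regVar_of_tendsto_charFun {μ : Measure ℝ} [IsProbabilityMeasure μ] {α σ β δ : ℝ}
    {a θ : ℕ → ℝ} (h0 : 0 < α) (h2 : α < 2) (hσ : 0 < σ) (hβ : β ∈ Set.Icc (-1 : ℝ) 1)
    (ha : ∀ n, 0 < a n)
    (hconv : ∀ t : ℝ, Tendsto (fun n => charFun μ (t / a n) ^ n
      * Complex.exp (-(Complex.I * ((t * θ n : ℝ) : ℂ)))) atTop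
      (𝓝 (Complex.exp (stableExponent α σ β δ t)))) :
    RegVar (absTail μ) (-α) ∧ ∃ p : ℝ,
      Tendsto (fun t => upTail μ t / absTail μ t) atTop (𝓝 p) := by
  have hre : ∀ t, t ≠ 0 → (stableExponent α σ β δ t).re < 0 := fun t ht => by
    rw [re_stableExponent h0]
    have : 0 < σ * |t| := by positivity
    simpa using Real.rpow_pos_of_pos this α
  -- a square integrable law would force `2 ^ α = 2 ^ 2`
  have hμ : ¬ Integrable (fun x : ℝ => x ^ 2) μ := by
    intro hμ
    have h1 := re_exponent_eq_sq_mul (hre 1 one_ne_zero) ha hconv hμ 2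
    rw [re_stableExponent h0, re_stableExponent h0, abs_two, abs_one, mul_one,
      Real.mul_rpow hσ.le zero_le_two] at h1
    have h3 : 0 < σ ^ α := Real.rpow_pos_of_pos hσ α
    have h4 : (2 : ℝ) ^ α < 2 ^ (2 : ℝ) := Real.rpow_lt_rpow_of_exponent_lt one_lt_two h2
    rw [Real.rpow_two] at h4
    nlinarith
  obtain ⟨p, q, d, hp, hq, hpq, hψ⟩ := exists_stableExponent_eq_levyExponent δ h0 h2 hσ hβ
  obtain ⟨h₀, hh0, hh1, hsmall⟩ := exists_small_step σ h0
  lift p to NNReal using hp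
  lift q to NNReal using hq
  obtain ⟨hatop, -⟩ := norming_tendsto_and_bounded (hre 1 one_ne_zero) ha hconv
  have hL := integrable_min_stableLevyMeasure h0 h2 p q
  have key : ∀ {f : ℝ → ℝ} {B r : ℝ}, Continuous f → 0 < r → (∀ x, |f x| ≤ B) →
      (∀ x, |x| ≤ r → f x = 0) → Tendsto (fun n : ℕ => (n : ℝ) * ∫ x, f (x / a n) ∂μ) atTop
        (𝓝 (∫ x, f x ∂(stableLevyMeasure α p q))) := by
    intro f B r hf hr hB hfr
    refine tendsto_integral_levyMeasure (s := 0) (h₀ := h₀) (stableExponent_zero h0)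
      (stableExponent_neg α σ β δ) hL le_rfl (fun h t => ?_) hh0 hh1
      (fun h hh => ?_) (hre h₀ hh0.ne') (hre 1 one_ne_zero) ha hconv hμ hf hr hB hfr
    · rw [stableLevyMeasure_secondDiff h0 h2, hψ, hψ, hψ]
      have e1 := levyExponent_secondDiff h0 h2 h t
      have e2 := levyExponent_secondDiff h0 h2 h (-t)
      rw [show -(t + h) = -t - h by ring, show -(t - h) = -t + h by ring]
      push_cast
      linear_combination (p : ℂ) * e1 + (q : ℂ) * e2
    · rw [re_stableExponent h0]
      linarith [hsmall h hh]
  have hcont : ∀ (p q : NNReal) {x : ℝ}, 0 < x → ContinuousAt (upTail (stableLevyMeasure α p q)) x := by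
    intro p q x hx
    have h3 : ContinuousAt (fun x : ℝ => p * (x ^ (-α) / α)) x :=
      ((Real.continuousAt_rpow_const x (-α) (Or.inl hx.ne')).div_const α).const_mul (p : ℝ)
    refine h3.congr ?_
    filter_upwards [lt_mem_nhds hx] with y hy
    rw [upTail_stableLevyMeasure h0 p q hy]
  have hup : ∀ x, 0 < x → Tendsto (fun n : ℕ => (n : ℝ) * upTail μ (x * a n)) atTop
      (𝓝 (p / α * x ^ (-α))) := by
    intro x hx
    have := tendsto_mul_upTail hL ha key hx (hcont p q hx)
    rw [upTail_stableLevyMeasure h0 p q hx] at this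
    convert this using 2; ring
  have hlo : ∀ x, 0 < x → Tendsto (fun n : ℕ => (n : ℝ) * loTail μ (x * a n)) atTop
      (𝓝 (q / α * x ^ (-α))) := by
    intro x hx
    have hfin : IsFiniteMeasure (μ.map Neg.neg) := inferInstance
    have := tendsto_mul_upTail (μ := μ.map Neg.neg)
      (integrable_min_stableLevyMeasure h0 h2 q p) ha (fun {f B r} hf hr hB hfr => ?_) hx
      (hcont q p hx)
    · rw [upTail_stableLevyMeasure h0 q p hx] at this
      simp_rw [upTail_map_neg] at this
      convert this using 2; ring
    · have h3 := key (f := fun x => f (-x)) (hf.comp continuous_neg) hr (fun x => hB _)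
        (fun x hxr => hfr _ (by rwa [abs_neg]))
      rw [← map_neg_stableLevyMeasure, show ∫ x, f x ∂((stableLevyMeasure α p q).map Neg.neg)
        = ∫ x, f (-x) ∂(stableLevyMeasure α p q) from
          integral_map_equiv (MeasurableEquiv.neg ℝ) f]
      refine h3.congr fun n => ?_
      rw [integral_map (by fun_prop) (Continuous.aestronglyMeasurable (by fun_prop))]
      simp_rw [neg_div]
  have hκ : (0 : ℝ) < (p + q) / α := by positivity
  have habs : ∀ x, 0 < x → Tendsto (fun n : ℕ => (n : ℝ) * absTail μ (x * a n)) atTop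
      (𝓝 ((p + q) / α * x ^ (-α))) := by
    intro x hx
    have := (hup x hx).add (hlo x hx)
    rw [← add_mul, ← add_div] at this
    refine this.congr fun n => ?_
    rw [absTail_eq_add μ (by have := ha n; positivity), mul_add]
  have hratio := fun {F : ℝ → ℝ} {P : ℝ} (hF : Antitone F) hFn {c : ℝ} (hc : 0 < c) =>
    tendsto_div_of_norming (F := F) (P := P) h0 hκ (antitone_absTail μ) (tendsto_absTail μ) hF hatop
      habs hFn hc
  refine ⟨⟨(antitone_absTail μ).measurable, ?_, fun c hc => ?_⟩, ?_⟩
  · refine .of_forall fun t => (measureReal_nonneg (μ := μ)).lt_of_ne fun h => ?_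
    have hz : ∀ n, t ≤ a n → absTail μ (1 * a n) = 0 := fun n hn =>
      le_antisymm ((antitone_absTail μ (by rwa [one_mul])).trans h.ge) measureReal_nonneg
    have h3 := habs 1 one_pos
    have h4 : Tendsto (fun n : ℕ => (n : ℝ) * absTail μ (1 * a n)) atTop (𝓝 0) := by
      refine tendsto_const_nhds.congr' ?_
      filter_upwards [hatop.eventually_ge_atTop t] with n hn
      rw [hz n hn, mul_zero]
    have := tendsto_nhds_unique h3 h4
    simp only [Real.one_rpow, mul_one] at this
    exact hκ.ne' this
  · have := hratio (antitone_absTail μ) habs hc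
    rwa [div_self hκ.ne', one_mul] at this
  · have := hratio (antitone_upTail μ) hup one_pos
    simp only [one_mul] at this
    exact ⟨_, this⟩

/-- **Necessity, index two.** For a law without second moment attracted to a normal law, the tail
is negligible with respect to the truncated second moment. -/
theorem tendsto_sq_mul_absTail_div {μ : Measure ℝ} [IsProbabilityMeasure μ] {σ β δ : ℝ}
    {a θ : ℕ → ℝ} (hσ : 0 < σ) (ha : ∀ n, 0 < a n)
    (hconv : ∀ t : ℝ, Tendsto (fun n => charFun μ (t / a n) ^ n
      * Complex.exp (-(Complex.I * ((t * θ n : ℝ) : ℂ)))) atTop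
      (𝓝 (Complex.exp (stableExponent 2 σ β δ t))))
    (hμ : ¬ Integrable (fun x : ℝ => x ^ 2) μ) :
    Tendsto (fun t => t ^ 2 * absTail μ t / lawMoment μ t) atTop (𝓝 0) := by
  have h0 : (0 : ℝ) < 2 := two_pos
  have hre : ∀ t, t ≠ 0 → (stableExponent 2 σ β δ t).re < 0 := fun t ht => by
    rw [re_stableExponent h0]
    have : 0 < σ * |t| := by positivity
    simpa using Real.rpow_pos_of_pos this 2
  have hψ : ∀ t, stableExponent 2 σ β δ t = -((σ ^ 2 * t ^ 2 : ℝ) : ℂ) + Complex.I * ((δ * t : ℝ) : ℂ) := by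
    intro t
    unfold stableExponent
    rw [if_neg (by norm_num), mul_div_assoc, div_self two_ne_zero, mul_one, Real.tan_pi,
      Real.rpow_two, mul_pow, sq_abs]
    simp
  obtain ⟨h₀, hh0, hh1, hsmall⟩ := exists_small_step σ h0
  obtain ⟨hatop, -⟩ := norming_tendsto_and_bounded (hre 1 one_ne_zero) ha hconv
  -- the rescaled tails vanish, since the limit has no Lévy measure
  have htail : Tendsto (fun n : ℕ => (n : ℝ) * absTail μ (a n)) atTop (𝓝 0) := by
    have habs : ∀ x : ℝ, |max 0 (min 1 (2 * |x| - 1))| ≤ 1 := by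
      intro x
      rw [abs_of_nonneg (le_max_left _ _)]
      exact max_le zero_le_one (min_le_left _ _)
    have h1 := tendsto_integral_levyMeasure (L := 0) (s := σ ^ 2) (h₀ := h₀) (stableExponent_zero h0)
      (stableExponent_neg 2 σ β δ) (by simp) (by positivity) (fun h t => ?_) hh0 hh1
      (fun h hh => ?_) (hre h₀ hh0.ne') (hre 1 one_ne_zero) ha hconv hμ
      (f := fun x => max 0 (min 1 (2 * |x| - 1))) (B := 1) (r := 1 / 2) (by fun_prop) (by norm_num)
      habs (fun x hx => max_eq_left ((min_le_right _ _).trans (by linarith)))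
    · rw [integral_zero_measure] at h1
      refine squeeze_zero (fun n => mul_nonneg (Nat.cast_nonneg n) measureReal_nonneg)
        (fun n => ?_) h1
      gcongr
      rw [absTail, ← setIntegral_one_eq_measureReal, ← integral_indicator (measurableSet_lt_abs _)]
      refine integral_mono ((integrable_const 1).indicator (measurableSet_lt_abs _))
        ((integrable_const 1).mono' (Continuous.aestronglyMeasurable (by fun_prop))
          (.of_forall fun x => habs _)) fun x => ?_
      by_cases hx : a n < |x|
      · rw [Set.indicator_of_mem (by exact hx)]
        refine le_max_of_le_right (le_min le_rfl ?_)
        have : 1 ≤ |x / a n| := by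
          rw [abs_div, abs_of_pos (ha n), one_le_div (ha n)]; exact hx.le
        linarith
      · rw [Set.indicator_of_notMem (by exact hx)]
        exact le_max_left _ _
    · rw [hψ, hψ, hψ, secondDiff, integral_zero_measure]
      push_cast; ring
    · rw [re_stableExponent h0]
      linarith [hsmall h hh]
  set c : ℝ := σ ^ 2 / 4 with hc
  have hc0 : 0 < c := by positivity
  have hlow : ∀ᶠ n : ℕ in atTop, c ≤ n * scaledMoment μ (a n) := by
    have h1 := tendsto_integral_one_sub_cos (hre 1 one_ne_zero) ha hconv hμ 1
    rw [re_stableExponent h0, neg_neg, abs_one, mul_one, Real.rpow_two] at h1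
    filter_upwards [h1.eventually_const_lt (show σ ^ 2 / 2 < σ ^ 2 by nlinarith [sq_pos_of_pos hσ])]
      with n hn
    have h2 : ∫ x, (1 - Real.cos (1 * x)) ∂(rescaledLaw μ n (a n))
        ≤ ∫ x, 2 * min 1 (x ^ 2) ∂(rescaledLaw μ n (a n)) := by
      refine integral_mono (integrable_one_sub_cos_of_finite _ _)
        ((integrable_min_one_sq' _).const_mul 2) fun x => ?_
      have := one_sub_cos_le_min x
      simpa using this
    rw [integral_const_mul, integral_min_rescaledLaw] at h2
    linarith
  have hVtop := tendsto_lawMoment_atTop μ hμ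
  set H := scaledMoment μ with hH
  have hHpos : ∀ᶠ t in atTop, 0 < H t := by
    filter_upwards [hVtop.eventually_gt_atTop 0, eventually_gt_atTop 0] with t ht ht0
    rw [hH, scaledMoment_eq μ ht0]
    have : 0 ≤ absTail μ t := measureReal_nonneg
    positivity
  have hHlim : Tendsto H atTop (𝓝 0) := by
    have := tendsto_integral_filter_of_dominated_convergence (μ := μ) (l := atTop)
      (F := fun (t : ℝ) x => min 1 ((x / t) ^ 2)) (f := fun _ => (0 : ℝ)) (fun _ => 1)
      (.of_forall fun t => by fun_prop) (.of_forall fun t => .of_forall fun x => by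
        rw [Real.norm_of_nonneg (by positivity)]; exact min_le_left _ _) (integrable_const 1)
      (.of_forall fun x => ?_)
    · simp only [integral_zero] at this
      exact this
    · have h1 : Tendsto (fun t : ℝ => (x / t) ^ 2) atTop (𝓝 0) := by
        simpa using (tendsto_const_nhds (x := x).div_atTop tendsto_id).pow 2
      simpa using (tendsto_const_nhds (x := (1 : ℝ))).min h1
  have hHanti : ∀ s t, 0 < s → s ≤ t → H t ≤ H s := by
    intro s t hs hst
    have ht := hs.trans_le hst
    refine integral_mono (integrable_min_one_sq μ t) (integrable_min_one_sq μ s) fun x => ?_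
    refine min_le_min le_rfl ?_
    rw [← sq_abs (x / t), ← sq_abs (x / s), abs_div, abs_div, abs_of_pos hs, abs_of_pos ht]
    gcongr
  -- with `n = ⌊c / (2 H t)⌋` one has `H t < H (a n)`, hence `a n < t`
  have hTH : Tendsto (fun t => absTail μ t / H t) atTop (𝓝 0) := by
    set N : ℝ → ℕ := fun t => ⌊c / 2 / H t⌋₊ with hN
    have hinv : Tendsto (fun t => c / 2 / H t) atTop atTop := by
      refine Tendsto.const_mul_atTop (by positivity) (Tendsto.inv_tendsto_nhdsGT_zero ?_)
      exact tendsto_nhdsWithin_iff.2 ⟨hHlim, hHpos⟩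
    have hNtop : Tendsto N atTop atTop := tendsto_nat_floor_atTop.comp hinv
    have h3 : Tendsto (fun t => 2 / c * ((N t : ℝ) * absTail μ (a (N t)) + absTail μ (a (N t)))) atTop
        (𝓝 0) := by
      have := ((htail.add ((tendsto_absTail μ).comp hatop)).comp hNtop).const_mul (2 / c)
      simpa using this
    refine squeeze_zero' (hHpos.mono fun t ht => div_nonneg measureReal_nonneg ht.le) ?_ h3
    filter_upwards [hHpos, hNtop.eventually hlow, eventually_gt_atTop 0] with t ht hn ht0
    have h4 : N t * H t ≤ c / 2 := by
      have := Nat.floor_le (div_pos (half_pos hc0) ht).le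
      rwa [le_div_iff₀ ht] at this
    have h5 : c / 2 < (N t + 1) * H t := by
      have := Nat.lt_floor_add_one (c / 2 / H t)
      rwa [div_lt_iff₀ ht] at this
    have h6 : a (N t) ≤ t := by
      by_contra! hcon
      have := mul_le_mul_of_nonneg_left (hHanti _ _ ht0 hcon.le) (Nat.cast_nonneg (α := ℝ) (N t))
      linarith
    have h7 := antitone_absTail μ h6
    have h8 : 0 ≤ absTail μ t := measureReal_nonneg
    rw [div_le_iff₀ ht]
    have h9 : 0 ≤ absTail μ (a (N t)) := measureReal_nonneg
    calc absTail μ t ≤ absTail μ (a (N t)) := h7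
      _ = 2 / c * (c / 2) * absTail μ (a (N t)) := by field_simp
      _ ≤ 2 / c * ((N t + 1) * H t) * absTail μ (a (N t)) := by gcongr
      _ = _ := by ring
  have h4 : Tendsto (fun t => (absTail μ t / H t) / (1 - absTail μ t / H t)) atTop (𝓝 (0 / (1 - 0))) :=
    hTH.div (tendsto_const_nhds.sub hTH) (by norm_num)
  rw [zero_div] at h4
  refine h4.congr' ?_
  filter_upwards [hHpos, hVtop.eventually_gt_atTop 0, eventually_gt_atTop 0] with t ht hV ht0
  have h5 : H t - absTail μ t = lawMoment μ t / t ^ 2 := by rw [hH, scaledMoment_eq μ ht0]; ring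
  have h6 : 1 - absTail μ t / H t = (lawMoment μ t / t ^ 2) / H t := by
    rw [← h5]; field_simp
  rw [h6, div_div_div_cancel_right₀ ht.ne']
  field_simp

/-! ### Tails of differences and sums of independent nonnegative variables -/

theorem RegVar.of_tendsto_div {f g : ℝ → ℝ} {ρ κ : ℝ} (hg : RegVar g ρ) (hf : Measurable f)
    (hκ : 0 < κ) (h : Tendsto (fun t => f t / g t) atTop (𝓝 κ)) : RegVar f ρ := by
  have hpos : ∀ᶠ t in atTop, 0 < f t := by
    filter_upwards [h.eventually_const_lt hκ, hg.eventually_pos] with t h1 h2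
    have := mul_pos h1 h2
    rwa [div_mul_cancel₀ _ h2.ne'] at this
  refine ⟨hf, hpos, fun c hc => ?_⟩
  have hct : Tendsto (fun t : ℝ => c * t) atTop atTop := tendsto_id.const_mul_atTop hc
  have h1 := ((h.comp hct).mul (hg.2.2 c hc)).mul (h.inv₀ hκ.ne')
  rw [mul_comm κ, mul_assoc, mul_inv_cancel₀ hκ.ne', mul_one] at h1
  refine h1.congr' ?_
  filter_upwards [hpos, hg.eventually_pos, hct.eventually hpos, hct.eventually hg.eventually_pos]
    with t h1 h2 h3 h4
  simp only [Function.comp]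
  field_simp

/-- Relations between the tails `u`, `d` of two independent nonnegative variables and the upper
and lower tails `up`, `lo` of their difference. -/
structure IsDifferenceTails (u d up lo : ℝ → ℝ) : Prop where
  anti_u : Antitone u
  anti_d : Antitone d
  anti_up : Antitone up
  anti_lo : Antitone lo
  lim_u : Tendsto u atTop (𝓝 0)
  lim_d : Tendsto d atTop (𝓝 0)
  nonneg_u : ∀ t, 0 ≤ u t
  nonneg_d : ∀ t, 0 ≤ d t
  up_le : ∀ t, 0 ≤ t → up t ≤ u t
  lo_le : ∀ t, 0 ≤ t → lo t ≤ d t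
  le_up : ∀ t s, 0 ≤ t → 0 ≤ s → u (t + s) * (1 - d s) ≤ up t
  le_lo : ∀ t s, 0 ≤ t → 0 ≤ s → d (t + s) * (1 - u s) ≤ lo t

section DifferenceTails

variable {u d up lo : ℝ → ℝ}

/-- With a shift `s` that neither variable is likely to exceed, the tail of the difference is nearly
bounded below by the shifted sum of the tails. -/
theorem IsDifferenceTails.exists_shift (h : IsDifferenceTails u d up lo) {C : ℝ} (hC : C < 1) :
    ∃ s, 0 ≤ s ∧ ∃ e, C < e ∧ 0 < e ∧ ∀ t, 0 ≤ t → (u (t + s) + d (t + s)) * e ≤ up t + lo t := by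
  have h1 : Tendsto (fun s => 1 - (u s + d s)) atTop (𝓝 1) := by
    simpa using (h.lim_u.add h.lim_d).const_sub 1
  obtain ⟨s, ⟨hs, hs1⟩, hs0⟩ := (((h1.eventually_const_lt hC).and
    (h1.eventually_const_lt one_pos)).and (eventually_ge_atTop 0)).exists
  refine ⟨s, hs0, _, hs, hs1, fun t ht => ?_⟩
  have h2 := h.le_up t s ht hs0
  have h3 := h.le_lo t s ht hs0
  have h4 := h.nonneg_u s
  have h5 := h.nonneg_d s
  nlinarith [mul_nonneg (h.nonneg_u (t + s)) h4, mul_nonneg (h.nonneg_d (t + s)) h5]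

theorem IsDifferenceTails.le (h : IsDifferenceTails u d up lo) {t : ℝ} (ht : 0 ≤ t) :
    up t + lo t ≤ u t + d t := add_le_add (h.up_le t ht) (h.lo_le t ht)

/-- It suffices that one of the two sums of tails is regularly varying, as this absorbs the
shift. -/
theorem IsDifferenceTails.tendsto_div (h : IsDifferenceTails u d up lo) {ρ : ℝ}
    (hrv : RegVar (fun t => u t + d t) ρ ∨ RegVar (fun t => up t + lo t) ρ) :
    Tendsto (fun t => (up t + lo t) / (u t + d t)) atTop (𝓝 1) := by
  have hpos : ∀ᶠ t in atTop, 0 < u t + d t := by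
    rcases hrv with hS | hT
    · exact hS.eventually_pos
    · filter_upwards [hT.eventually_pos, eventually_ge_atTop 0] with t ht ht0
      exact ht.trans_le (h.le ht0)
  refine tendsto_order.2 ⟨fun C hC => ?_, fun C hC => ?_⟩
  · obtain ⟨s, hs0, e, he, he0, hb⟩ := h.exists_shift hC
    rcases hrv with hS | hT
    · have h1 := (hS.tendsto_shift (h.anti_u.add h.anti_d) s).mul_const e
      rw [one_mul] at h1
      filter_upwards [h1.eventually_const_lt he, hpos, eventually_ge_atTop 0] with t ht htp ht0
      refine ht.trans_le ?_
      rw [div_mul_eq_mul_div]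
      gcongr
      exact hb t ht0
    · have h1 := ((hT.tendsto_shift (h.anti_up.add h.anti_lo) (-s)).inv₀ one_ne_zero).mul_const e
      rw [inv_one, one_mul] at h1
      filter_upwards [h1.eventually_const_lt he, hpos, hT.eventually_pos, eventually_ge_atTop s]
        with t ht htp htT hts
      have h2 := hb (t - s) (by linarith)
      rw [sub_add_cancel] at h2
      refine ht.trans_le ?_
      rw [← sub_eq_add_neg, inv_div, div_mul_eq_mul_div, div_le_div_iff₀ _ htp]
      · have := mul_le_mul_of_nonneg_left h2 htT.le
        linarith
      · exact (mul_pos htp he0).trans_le h2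
  · filter_upwards [hpos, eventually_ge_atTop 0] with t ht ht0
    exact ((div_le_one ht).2 (h.le ht0)).trans_lt hC

/-- The tails of two independent nonnegative variables are regularly varying and balanced if and
only if those of their difference are. -/
theorem IsDifferenceTails.balanced_iff (h : IsDifferenceTails u d up lo) {ρ p : ℝ} :
    (RegVar (fun t => up t + lo t) ρ ∧ Tendsto (fun t => up t / (up t + lo t)) atTop (𝓝 p)) ↔
      (RegVar (fun t => u t + d t) ρ ∧ Tendsto (fun t => u t / (u t + d t)) atTop (𝓝 p)) := by
  have key : (RegVar (fun t => up t + lo t) ρ ∨ RegVar (fun t => u t + d t) ρ) →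
      (RegVar (fun t => up t + lo t) ρ ∧ RegVar (fun t => u t + d t) ρ) ∧
      (Tendsto (fun t => up t / (up t + lo t)) atTop (𝓝 p) ↔
        Tendsto (fun t => u t / (u t + d t)) atTop (𝓝 p)) := by
    intro hrv
    have hlim := h.tendsto_div hrv.symm
    have hm1 : Measurable fun t => up t + lo t := (h.anti_up.add h.anti_lo).measurable
    have hm2 : Measurable fun t => u t + d t := (h.anti_u.add h.anti_d).measurable
    have hT : RegVar (fun t => up t + lo t) ρ := by
      rcases hrv with hT | hS
      · exact hT
      · exact hS.of_tendsto_div hm1 one_pos hlim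
    have hS : RegVar (fun t => u t + d t) ρ := by
      refine hT.of_tendsto_div hm2 one_pos ?_
      have := hlim.inv₀ one_ne_zero
      rw [inv_one] at this
      exact this.congr fun t => by rw [inv_div]
    have hdiff : Tendsto (fun t => u t / (u t + d t) - up t / (u t + d t)) atTop (𝓝 0) := by
      have h1 : Tendsto (fun t => 1 - (up t + lo t) / (u t + d t)) atTop (𝓝 0) := by
        simpa using hlim.const_sub 1
      refine squeeze_zero' ?_ ?_ h1
      · filter_upwards [hS.eventually_pos, eventually_ge_atTop 0] with t ht ht0
        rw [← sub_div]
        exact div_nonneg (sub_nonneg.2 (h.up_le t ht0)) ht.le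
      · filter_upwards [hS.eventually_pos, eventually_ge_atTop 0] with t ht ht0
        have : 1 - (up t + lo t) / (u t + d t) = (u t + d t - (up t + lo t)) / (u t + d t) := by
          field_simp
        rw [this, ← sub_div]
        refine div_le_div_of_nonneg_right ?_ ht.le
        linarith [h.lo_le t ht0]
    refine ⟨⟨hT, hS⟩, fun hp => ?_, fun hp => ?_⟩
    · have h1 := (hp.mul hlim).add hdiff
      rw [mul_one, add_zero] at h1
      refine h1.congr' ?_
      filter_upwards [hT.eventually_pos, hS.eventually_pos] with t ht ht1
      field_simp
      ring
    · have h1 := (hp.sub hdiff).div hlim one_ne_zero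
      rw [div_one, sub_zero] at h1
      refine h1.congr' ?_
      filter_upwards [hT.eventually_pos, hS.eventually_pos] with t ht ht1
      simp only [Pi.div_apply, sub_sub_cancel]
      field_simp
  exact ⟨fun hp => ⟨(key (.inl hp.1)).1.2, (key (.inl hp.1)).2.1 hp.2⟩,
    fun hp => ⟨(key (.inr hp.1)).1.1, (key (.inr hp.1)).2.2 hp.2⟩⟩

end DifferenceTails

/-- Rescaling two balanced tails by different factors. -/
theorem balanced_rescale {f g : ℝ → ℝ} {α p A B : ℝ} (hf : Antitone f) (hg : Antitone g)
    (hf0 : ∀ t, 0 ≤ f t) (hg0 : ∀ t, 0 ≤ g t) (hA : 0 < A) (hB : 0 < B)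
    (hrv : RegVar (fun t => f t + g t) (-α))
    (hp : Tendsto (fun t => f t / (f t + g t)) atTop (𝓝 p)) :
    0 < A ^ α * p + B ^ α * (1 - p) ∧
    Tendsto (fun t => (f (t / A) + g (t / B)) / (f t + g t)) atTop
      (𝓝 (A ^ α * p + B ^ α * (1 - p))) ∧
    RegVar (fun t => f (t / A) + g (t / B)) (-α) ∧
    Tendsto (fun t => f (t / A) / (f (t / A) + g (t / B))) atTop
      (𝓝 (A ^ α * p / (A ^ α * p + B ^ α * (1 - p)))) := by
  have hq : Tendsto (fun t => g t / (f t + g t)) atTop (𝓝 (1 - p)) := by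
    refine (hp.const_sub 1).congr' ?_
    filter_upwards [hrv.eventually_pos] with t ht
    field_simp
    ring
  have hsum : ∀ t, 0 ≤ f t + g t := fun t => add_nonneg (hf0 t) (hg0 t)
  have hp0 : 0 ≤ p := ge_of_tendsto hp (.of_forall fun t => div_nonneg (hf0 t) (hsum t))
  have hq0 : 0 ≤ 1 - p := ge_of_tendsto hq (.of_forall fun t => div_nonneg (hg0 t) (hsum t))
  have hAα : 0 < A ^ α := Real.rpow_pos_of_pos hA α
  have hBα : 0 < B ^ α := Real.rpow_pos_of_pos hB α
  have hκ : 0 < A ^ α * p + B ^ α * (1 - p) := by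
    rcases hp0.eq_or_lt with h | h
    · rw [← h]; simpa using hBα
    · have : 0 ≤ B ^ α * (1 - p) := by positivity
      have : 0 < A ^ α * p := by positivity
      linarith
  have hscale : ∀ (w : ℝ → ℝ) (C r : ℝ), 0 < C → Tendsto (fun t => w t / (f t + g t)) atTop (𝓝 r) →
      Tendsto (fun t => w (t / C) / (f t + g t)) atTop (𝓝 (C ^ α * r)) := by
    intro w C r hC hw
    have hct : Tendsto (fun t : ℝ => C⁻¹ * t) atTop atTop :=
      tendsto_id.const_mul_atTop (inv_pos.2 hC)
    have h1 := (hw.comp hct).mul (hrv.2.2 C⁻¹ (inv_pos.2 hC))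
    rw [Real.inv_rpow hC.le, Real.rpow_neg hC.le, inv_inv, mul_comm r] at h1
    refine h1.congr' ?_
    filter_upwards [hct.eventually hrv.eventually_pos] with t ht
    simp only [Function.comp]
    rw [div_mul_div_cancel₀ ht.ne', inv_mul_eq_div]
  have h1 := hscale f A p hA hp
  have h2 := hscale g B (1 - p) hB hq
  have h3 : Tendsto (fun t => (f (t / A) + g (t / B)) / (f t + g t)) atTop
      (𝓝 (A ^ α * p + B ^ α * (1 - p))) := (h1.add h2).congr fun t => by rw [add_div]
  have hm : Measurable fun t => f (t / A) + g (t / B) :=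
    (hf.measurable.comp (by fun_prop)).add (hg.measurable.comp (by fun_prop))
  refine ⟨hκ, h3, hrv.of_tendsto_div hm hκ h3, ?_⟩
  refine (h1.div h3 hκ.ne').congr' ?_
  filter_upwards [hrv.eventually_pos] with t ht
  rw [Pi.div_apply, div_div_div_cancel_right₀ ht.ne']

theorem balanced_rescale_iff {f g : ℝ → ℝ} {α A B : ℝ} (hf : Antitone f) (hg : Antitone g)
    (hf0 : ∀ t, 0 ≤ f t) (hg0 : ∀ t, 0 ≤ g t) (hA : 0 < A) (hB : 0 < B) :
    (RegVar (fun t => f (t / A) + g (t / B)) (-α) ∧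
      ∃ p, Tendsto (fun t => f (t / A) / (f (t / A) + g (t / B))) atTop (𝓝 p)) ↔
    (RegVar (fun t => f t + g t) (-α) ∧ ∃ p, Tendsto (fun t => f t / (f t + g t)) atTop (𝓝 p)) := by
  constructor
  · rintro ⟨h1, p, hp⟩
    have hmono : ∀ {w : ℝ → ℝ} {C : ℝ}, Antitone w → 0 < C → Antitone fun t => w (t / C) :=
      fun hw hC s t hst => hw (by gcongr)
    obtain ⟨-, -, h3, h4⟩ := balanced_rescale (f := fun t => f (t / A)) (g := fun t => g (t / B))
      (hmono hf hA) (hmono hg hB) (fun t => hf0 _) (fun t => hg0 _) (inv_pos.2 hA) (inv_pos.2 hB)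
      h1 hp
    simp only [div_inv_eq_mul, mul_div_assoc, div_self hA.ne', div_self hB.ne', mul_one] at h3 h4
    exact ⟨h3, _, h4⟩
  · rintro ⟨h1, p, hp⟩
    obtain ⟨-, -, h3, h4⟩ := balanced_rescale hf hg hf0 hg0 hA hB h1 hp
    exact ⟨h3, _, h4⟩

/-- The tail of a sum of two independent nonnegative variables, by the principle of one big
jump. -/
theorem tendsto_sum_tail_div {u d w : ℝ → ℝ} {ρ : ℝ}
    (hd0 : ∀ t, 0 ≤ d t) (hd : Tendsto d atTop (𝓝 0))
    (hrv : RegVar (fun t => u t + d t) ρ)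
    (hlow : ∀ t, 0 ≤ t → u t + d t - u t * d t ≤ w t)
    (hup : ∀ t ε, 0 ≤ t → 0 < ε → ε < 1 →
      w t ≤ u ((1 - ε) * t) + d ((1 - ε) * t) + u (ε * t) * d (ε * t)) :
    Tendsto (fun t => w t / (u t + d t)) atTop (𝓝 1) := by
  refine tendsto_order.2 ⟨fun C hC => ?_, fun C hC => ?_⟩
  · have h1 : Tendsto (fun t => 1 - d t) atTop (𝓝 1) := by simpa using hd.const_sub 1
    filter_upwards [h1.eventually_const_lt hC, hrv.eventually_pos, eventually_ge_atTop 0]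
      with t ht htp ht0
    refine ht.trans_le ?_
    rw [le_div_iff₀ htp]
    nlinarith [hlow t ht0, mul_nonneg (hd0 t) (hd0 t)]
  · have hc : Tendsto (fun ε : ℝ => (1 - ε) ^ ρ) (𝓝 0) (𝓝 1) := by
      have : ContinuousAt (fun ε : ℝ => (1 - ε) ^ ρ) 0 :=
        ContinuousAt.rpow_const (by fun_prop) (Or.inl (by norm_num))
      simpa using this.tendsto
    have h1 : ∀ᶠ ε in 𝓝[>] (0 : ℝ), (1 - ε) ^ ρ < C :=
      (hc.mono_left nhdsWithin_le_nhds).eventually_lt_const hC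
    have h2 : ∀ᶠ ε in 𝓝[>] (0 : ℝ), ε < 1 := nhdsWithin_le_nhds (gt_mem_nhds one_pos)
    obtain ⟨ε, ⟨hε, hε1⟩, hε0⟩ := ((h1.and h2).and self_mem_nhdsWithin).exists
    have hε0 : 0 < ε := hε0
    have h3 := (hrv.2.2 (1 - ε) (by linarith)).add ((hrv.2.2 ε hε0).mul
      (hd.comp (tendsto_id.const_mul_atTop hε0)))
    rw [mul_zero, add_zero] at h3
    filter_upwards [h3.eventually_lt_const hε, hrv.eventually_pos, eventually_ge_atTop 0]
      with t ht htp ht0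
    refine lt_of_le_of_lt ?_ ht
    simp only [Function.comp, id]
    rw [div_mul_eq_mul_div, ← add_div]
    gcongr
    refine (hup t ε ht0 hε0 hε1).trans ?_
    have := hd0 (ε * t)
    nlinarith [mul_nonneg this this]

/-- Proportional regularly varying tails have proportional truncated second moments. -/
theorem IsTailMoment.tendsto_moment_div {T V T' V' : ℝ → ℝ} (h : IsTailMoment T V)
    (h' : IsTailMoment T' V') {α κ : ℝ} (h0 : 0 < α) (h2 : α < 2) (hT : RegVar T (-α)) (hκ : 0 < κ)
    (hlim : Tendsto (fun t => T' t / T t) atTop (𝓝 κ)) :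
    Tendsto (fun t => V' t / V t) atTop (𝓝 κ) := by
  have hT' : RegVar T' (-α) := hT.of_tendsto_div h'.tail_anti.measurable hκ hlim
  have h1 := h.karamata_direct h0 h2 hT
  have h3 := h'.karamata_direct h0 h2 hT'
  have hc : 0 < α / (2 - α) := div_pos h0 (by linarith)
  have h4 := (h3.mul hlim).div h1 hc.ne'
  rw [mul_div_cancel_left₀ _ hc.ne'] at h4
  refine h4.congr' ?_
  filter_upwards [hT.eventually_pos, hT'.eventually_pos, eventually_gt_atTop 0,
    h1.eventually_const_lt hc] with t ht ht' ht0 h5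
  have hV : V t ≠ 0 := by
    intro h6; rw [h6, zero_div] at h5; exact lt_irrefl _ h5
  simp only [Pi.div_apply]
  field_simp

/-! ### Domains of attraction of index below two -/

section Attraction

variable {Ω : Type*} [MeasurableSpace Ω] {P : Measure Ω}

/-- **The domain of attraction of the stable laws of index below two**: the two-sided tail is
regularly varying and the tails are balanced. -/
theorem inDomainOfAttraction_iff [IsProbabilityMeasure P] {X : Ω → ℝ} (hX : Measurable X) {α : ℝ} (h0 : 0 < α) (h2 : α < 2) :
    InDomainOfAttraction P X α ↔
      RegVar (fun t => upTail (P.map X) t + loTail (P.map X) t) (-α) ∧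
      ∃ p, Tendsto (fun t => upTail (P.map X) t / (upTail (P.map X) t + loTail (P.map X) t))
        atTop (𝓝 p) := by
  have hprob : IsProbabilityMeasure (P.map X) := Measure.isProbabilityMeasure_map hX.aemeasurable
  set μ := P.map X with hμ
  have hm : Measurable fun t => upTail μ t + loTail μ t :=
    ((antitone_upTail μ).add (antitone_loTail μ)).measurable
  have he : ∀ᶠ t in atTop, absTail μ t = upTail μ t + loTail μ t := by
    filter_upwards [eventually_ge_atTop 0] with t ht using absTail_eq_add μ ht
  have hiff : RegVar (absTail μ) (-α) ↔ RegVar (fun t => upTail μ t + loTail μ t) (-α) := by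
    constructor
    · intro h
      refine h.of_tendsto_div hm one_pos (tendsto_const_nhds.congr' ?_)
      filter_upwards [he, h.eventually_pos] with t ht hp
      rw [← ht, div_self hp.ne']
    · intro h
      refine h.of_tendsto_div (antitone_absTail μ).measurable one_pos (tendsto_const_nhds.congr' ?_)
      filter_upwards [he, h.eventually_pos] with t ht hp
      rw [ht, div_self hp.ne']
  constructor
  · intro h
    obtain ⟨σ, β, δ, a, θ, hσ, hβ, ha, hconv⟩ := h.tendsto_charFun hX
    obtain ⟨h1, p, hp⟩ := regVar_of_tendsto_charFun h0 h2 hσ hβ ha hconv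
    refine ⟨hiff.1 h1, p, hp.congr' ?_⟩
    filter_upwards [he] with t ht
    rw [ht]
  · rintro ⟨h1, p, hp⟩
    have hp' : Tendsto (fun t => upTail μ t / absTail μ t) atTop (𝓝 p) := by
      refine hp.congr' ?_
      filter_upwards [he] with t ht
      rw [ht]
    have hq' : Tendsto (fun t => loTail μ t / absTail μ t) atTop (𝓝 (1 - p)) := by
      refine (hp'.const_sub 1).congr' ?_
      filter_upwards [he, h1.eventually_pos] with t ht hpos
      rw [ht]
      field_simp
      ring
    obtain ⟨σ, β, δ, a, θ, hσ, hβ, ha, hcont, hconv⟩ :=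
      exists_tendsto_charFun_of_regVar h0 h2 (hiff.2 h1) hp' hq'
    exact inDomainOfAttraction_of_tendsto_charFun hX hσ hβ ha hcont hconv

theorem tail_eq_absTail {X : Ω → ℝ} (hX : Measurable X) : tail P X = absTail (P.map X) := by
  ext t
  rw [tail, absTail, map_measureReal_apply hX (measurableSet_lt_abs t)]
  rfl

theorem truncSecondMoment_eq_lawMoment {X : Ω → ℝ} (hX : Measurable X) :
    truncSecondMoment P X = lawMoment (P.map X) := by
  ext t
  have hm : MeasurableSet {ω | |X ω| ≤ t} := measurableSet_le (by fun_prop) (by fun_prop)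
  rw [truncSecondMoment, lawMoment, integral_indicator hm, setIntegral_map (measurableSet_abs_le t)
    (by fun_prop) hX.aemeasurable]
  rfl

theorem isTailMoment_tail [IsProbabilityMeasure P] {X : Ω → ℝ} (hX : Measurable X) :
    IsTailMoment (tail P X) (truncSecondMoment P X) := by
  have := Measure.isProbabilityMeasure_map (μ := P) hX.aemeasurable
  rw [tail_eq_absTail hX, truncSecondMoment_eq_lawMoment hX]
  exact isTailMoment _

theorem IsTailMoment.add {T V T' V' : ℝ → ℝ} (h : IsTailMoment T V) (h' : IsTailMoment T' V') :
    IsTailMoment (fun t => T t + T' t) (fun t => V t + V' t) where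
  tail_nonneg t := add_nonneg (h.tail_nonneg t) (h'.tail_nonneg t)
  tail_anti := h.tail_anti.add h'.tail_anti
  tail_lim := by simpa using h.tail_lim.add h'.tail_lim
  moment_nonneg t := add_nonneg (h.moment_nonneg t) (h'.moment_nonneg t)
  moment_mono := h.moment_mono.add h'.moment_mono
  lower s t hs hst := by
    have h1 := h.lower s t hs hst
    have h2 := h'.lower s t hs hst
    linarith
  upper s t hs hst := by
    have h1 := h.upper s t hs hst
    have h2 := h'.upper s t hs hst
    linarith

/-- The relative difference of the tails converges to `b` iff the share of `U` converges to
`(1 + b) / 2`. -/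
theorem isTailBalance_iff {U D : Ω → ℝ} {b : ℝ} (hpos : ∀ᶠ t in atTop, 0 < tail P U t + tail P D t) :
    IsTailBalance P U D b ↔
      Tendsto (fun t => tail P U t / (tail P U t + tail P D t)) atTop (𝓝 ((1 + b) / 2)) := by
  unfold IsTailBalance
  constructor
  · intro h
    refine ((h.const_add 1).div_const 2).congr' ?_
    filter_upwards [hpos] with t ht
    field_simp
    ring
  · intro h
    have h1 := (h.const_mul 2).sub_const 1
    rw [mul_div_cancel₀ _ two_ne_zero, add_sub_cancel_left] at h1
    refine h1.congr' ?_
    filter_upwards [hpos] with t ht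
    field_simp
    ring

end Attraction

section Independent

variable {Ω : Type*} [MeasurableSpace Ω] {P : Measure Ω} {U D : Ω → ℝ}

theorem measureReal_lt_and_le [IsProbabilityMeasure P] (hD : Measurable D) (hind : IndepFun U D P)
    (x y : ℝ) : P.real {ω | x < U ω ∧ D ω ≤ y} = P.real {ω | x < U ω} * (1 - P.real {ω | y < D ω}) := by
  have h1 := congrArg ENNReal.toReal (IndepFun.measure_inter_preimage_eq_mul hind (s := Set.Ioi x)
    (t := Set.Iic y) measurableSet_Ioi measurableSet_Iic)
  rw [ENNReal.toReal_mul, ← measureReal_def, ← measureReal_def, ← measureReal_def] at h1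
  have h2 : P.real (D ⁻¹' Set.Iic y) = 1 - P.real {ω | y < D ω} := by
    rw [← probReal_compl_eq_one_sub (measurableSet_lt (by fun_prop) (by fun_prop))]
    congr 1; ext ω; simp
  rw [h2] at h1
  exact h1

theorem measureReal_lt_and_lt (hind : IndepFun U D P)
    (x y : ℝ) : P.real {ω | x < U ω ∧ y < D ω} = P.real {ω | x < U ω} * P.real {ω | y < D ω} := by
  have h1 := congrArg ENNReal.toReal (IndepFun.measure_inter_preimage_eq_mul hind (s := Set.Ioi x)
    (t := Set.Ioi y) measurableSet_Ioi measurableSet_Ioi)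
  rwa [ENNReal.toReal_mul] at h1

theorem tail_eq_of_nonneg (hU0 : ∀ᵐ ω ∂P, 0 ≤ U ω) (t : ℝ) : tail P U t = P.real {ω | t < U ω} := by
  refine measureReal_congr ?_
  filter_upwards [hU0] with ω h
  exact propext (by change t < |U ω| ↔ t < U ω; rw [abs_of_nonneg h])

theorem tail_const_mul {A : ℝ} (hA : 0 < A) (X : Ω → ℝ) (t : ℝ) :
    tail P (fun ω => A * X ω) t = tail P X (t / A) := by
  unfold tail
  congr 1; ext ω
  simp only [Set.mem_ofPred_eq, abs_mul, abs_of_pos hA, div_lt_iff₀ hA, mul_comm]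

theorem measureReal_le_of_ae [IsProbabilityMeasure P] {s t : Set Ω} (h : ∀ᵐ ω ∂P, ω ∈ s → ω ∈ t) : P.real s ≤ P.real t :=
  ENNReal.toReal_mono (measure_ne_top _ _) (measure_mono_ae h)

/-- Tails of the difference of two independent nonnegative variables. -/
theorem isDifferenceTails [IsProbabilityMeasure P] (hU : Measurable U) (hD : Measurable D) (hind : IndepFun U D P)
    (hU0 : ∀ᵐ ω ∂P, 0 ≤ U ω) (hD0 : ∀ᵐ ω ∂P, 0 ≤ D ω) :
    IsDifferenceTails (tail P U) (tail P D) (upTail (P.map fun ω => U ω - D ω))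
      (loTail (P.map fun ω => U ω - D ω)) := by
  have hX : Measurable fun ω => U ω - D ω := hU.sub hD
  have hprob : IsProbabilityMeasure (P.map fun ω => U ω - D ω) :=
    Measure.isProbabilityMeasure_map hX.aemeasurable
  have hup : ∀ t, upTail (P.map fun ω => U ω - D ω) t = P.real {ω | t < U ω - D ω} := fun t => by
    rw [upTail, map_measureReal_apply hX measurableSet_Ioi]; rfl
  have hlo : ∀ t, loTail (P.map fun ω => U ω - D ω) t = P.real {ω | t < D ω - U ω} := fun t => by
    rw [loTail, map_measureReal_apply hX measurableSet_Iio]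
    congr 1; ext ω
    simp only [Set.mem_preimage, Set.mem_Iio, Set.mem_ofPred_eq]
    rw [lt_neg, neg_sub]
  have iU := isTailMoment_tail (P := P) hU
  have iD := isTailMoment_tail (P := P) hD
  refine ⟨iU.tail_anti, iD.tail_anti, antitone_upTail _, antitone_loTail _, iU.tail_lim, iD.tail_lim,
    iU.tail_nonneg, iD.tail_nonneg, fun t ht => ?_, fun t ht => ?_, fun t s ht hs => ?_,
    fun t s ht hs => ?_⟩
  · rw [hup, tail_eq_of_nonneg hU0]
    refine measureReal_le_of_ae ?_
    filter_upwards [hD0] with ω h1 h2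
    have h2 : t < U ω - D ω := h2
    change t < U ω
    linarith
  · rw [hlo, tail_eq_of_nonneg hD0]
    refine measureReal_le_of_ae ?_
    filter_upwards [hU0] with ω h1 h2
    have h2 : t < D ω - U ω := h2
    change t < D ω
    linarith
  · rw [hup, tail_eq_of_nonneg hU0, tail_eq_of_nonneg hD0, ← measureReal_lt_and_le hD hind]
    refine measureReal_mono fun ω h => ?_
    have h1 : t + s < U ω := h.1
    have h2 : D ω ≤ s := h.2
    change t < U ω - D ω
    linarith
  · rw [hlo, tail_eq_of_nonneg hU0, tail_eq_of_nonneg hD0, ← measureReal_lt_and_le hU hind.symm]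
    refine measureReal_mono fun ω h => ?_
    have h1 : t + s < D ω := h.1
    have h2 : U ω ≤ s := h.2
    change t < D ω - U ω
    linarith

theorem tendsto_tail_add_div [IsProbabilityMeasure P] (hU : Measurable U) (hD : Measurable D) (hind : IndepFun U D P)
    (hU0 : ∀ᵐ ω ∂P, 0 ≤ U ω) (hD0 : ∀ᵐ ω ∂P, 0 ≤ D ω) {ρ : ℝ}
    (hrv : RegVar (fun t => tail P U t + tail P D t) ρ) :
    Tendsto (fun t => tail P (fun ω => U ω + D ω) t / (tail P U t + tail P D t)) atTop (𝓝 1) := by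
  have iU := isTailMoment_tail (P := P) hU
  have iD := isTailMoment_tail (P := P) hD
  have h0 : ∀ᵐ ω ∂P, 0 ≤ U ω + D ω := by
    filter_upwards [hU0, hD0] with ω h1 h2 using add_nonneg h1 h2
  refine tendsto_sum_tail_div iD.tail_nonneg iD.tail_lim hrv (fun t ht => ?_)
    fun t ε ht hε hε1 => ?_
  · rw [tail_eq_of_nonneg h0, tail_eq_of_nonneg hU0, tail_eq_of_nonneg hD0,
      ← measureReal_lt_and_lt hind]
    have h1 := measureReal_union_add_inter (μ := P) (s := {ω | t < U ω}) (t := {ω | t < D ω})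
      (measurableSet_lt (by fun_prop) (by fun_prop))
    have h2 : {ω | t < U ω} ∩ {ω | t < D ω} = {ω | t < U ω ∧ t < D ω} := rfl
    rw [h2] at h1
    have h3 : P.real ({ω | t < U ω} ∪ {ω | t < D ω}) ≤ P.real {ω | t < U ω + D ω} := by
      refine measureReal_le_of_ae ?_
      filter_upwards [hU0, hD0] with ω h4 h5 h6
      rcases h6 with h6 | h6
      · have h6 : t < U ω := h6
        linarith
      · have h6 : t < D ω := h6
        linarith
    linarith
  · rw [tail_eq_of_nonneg h0, tail_eq_of_nonneg hU0, tail_eq_of_nonneg hD0,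
      tail_eq_of_nonneg hU0, tail_eq_of_nonneg hD0, ← measureReal_lt_and_lt hind]
    have h3 : P.real {ω | t < U ω + D ω} ≤ P.real ({ω | (1 - ε) * t < U ω} ∪ {ω | (1 - ε) * t < D ω}
        ∪ {ω | ε * t < U ω ∧ ε * t < D ω}) := by
      refine measureReal_mono fun ω h => ?_
      have h : t < U ω + D ω := h
      by_contra hcon
      simp only [Set.mem_union, Set.mem_ofPred_eq, not_or, not_lt, not_and] at hcon
      obtain ⟨⟨h4, h5⟩, h6⟩ := hcon
      rcases lt_or_ge (ε * t) (U ω) with h7 | h7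
      · have := h6 h7
        linarith
      · linarith
    refine h3.trans ((measureReal_union_le _ _).trans ?_)
    gcongr
    exact measureReal_union_le _ _

end Independent

/-! ### Linear combinations with opposite signs -/

section Combination

variable {Ω : Type*} [MeasurableSpace Ω] {P : Measure Ω} [IsProbabilityMeasure P] {U D : Ω → ℝ}
  {A B α b : ℝ}

theorem isDifferenceTails_mul (hU : Measurable U) (hD : Measurable D) (hind : IndepFun U D P)
    (hU0 : ∀ᵐ ω ∂P, 0 ≤ U ω) (hD0 : ∀ᵐ ω ∂P, 0 ≤ D ω) (hA : 0 < A) (hB : 0 < B) :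
    IsDifferenceTails (fun t => tail P U (t / A)) (fun t => tail P D (t / B))
      (upTail (P.map fun ω => A * U ω - B * D ω)) (loTail (P.map fun ω => A * U ω - B * D ω)) := by
  have h := isDifferenceTails (P := P) (U := fun ω => A * U ω) (D := fun ω => B * D ω)
    (hU.const_mul A) (hD.const_mul B)
    (hind.comp (φ := fun x => A * x) (ψ := fun x => B * x) (by fun_prop) (by fun_prop))
    (by filter_upwards [hU0] with ω h using by positivity)
    (by filter_upwards [hD0] with ω h using by positivity)
  rwa [show tail P (fun ω => A * U ω) = fun t => tail P U (t / A) from funext (tail_const_mul hA U),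
    show tail P (fun ω => B * D ω) = fun t => tail P D (t / B) from funext (tail_const_mul hB D)] at h

/-- The domain of attraction to which `A U - B D` belongs does not depend on the positive
coefficients `A` and `B`. -/
theorem inDomainOfAttraction_sub_iff (hU : Measurable U) (hD : Measurable D) (hind : IndepFun U D P)
    (hU0 : ∀ᵐ ω ∂P, 0 ≤ U ω) (hD0 : ∀ᵐ ω ∂P, 0 ≤ D ω) (hA : 0 < A) (hB : 0 < B)
    (h0 : 0 < α) (h2 : α < 2) :
    InDomainOfAttraction P (fun ω => A * U ω - B * D ω) α ↔
      RegVar (sumTail P U D) (-α) ∧ ∃ b, IsTailBalance P U D b := by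
  have hX : Measurable fun ω => A * U ω - B * D ω := (hU.const_mul A).sub (hD.const_mul B)
  have iU := isTailMoment_tail (P := P) hU
  have iD := isTailMoment_tail (P := P) hD
  have hdiff := isDifferenceTails_mul (P := P) hU hD hind hU0 hD0 hA hB
  have h1 : InDomainOfAttraction P (fun ω => A * U ω - B * D ω) α ↔
      RegVar (fun t => tail P U t + tail P D t) (-α) ∧
      ∃ p, Tendsto (fun t => tail P U t / (tail P U t + tail P D t)) atTop (𝓝 p) := by
    rw [inDomainOfAttraction_iff hX h0 h2, ← balanced_rescale_iff iU.tail_anti iD.tail_anti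
      iU.tail_nonneg iD.tail_nonneg hA hB]
    constructor
    · rintro ⟨h, p, hp⟩
      have := hdiff.balanced_iff.1 ⟨h, hp⟩
      exact ⟨this.1, p, this.2⟩
    · rintro ⟨h, p, hp⟩
      have := hdiff.balanced_iff.2 ⟨h, hp⟩
      exact ⟨this.1, p, this.2⟩
  rw [h1]
  refine and_congr_right fun hrv => ⟨fun ⟨p, hp⟩ => ⟨2 * p - 1, ?_⟩, fun ⟨b, hb⟩ => ⟨(1 + b) / 2, ?_⟩⟩
  · rw [isTailBalance_iff hrv.eventually_pos]
    convert hp using 2; ring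
  · exact (isTailBalance_iff hrv.eventually_pos).1 hb

/-- Tails of `A U - B D` when the tails of `U` and `D` are regularly varying and balanced. -/
theorem sub_tail_asymptotics (hU : Measurable U) (hD : Measurable D) (hind : IndepFun U D P)
    (hU0 : ∀ᵐ ω ∂P, 0 ≤ U ω) (hD0 : ∀ᵐ ω ∂P, 0 ≤ D ω) (hA : 0 < A) (hB : 0 < B)
    (hrv : RegVar (sumTail P U D) (-α)) (hb : IsTailBalance P U D b) :
    0 < A ^ α * ((1 + b) / 2) + B ^ α * ((1 - b) / 2) ∧
    Tendsto (fun t => tail P (fun ω => A * U ω - B * D ω) t / sumTail P U D t) atTop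
      (𝓝 (A ^ α * ((1 + b) / 2) + B ^ α * ((1 - b) / 2))) ∧
    Tendsto (tailBalance P fun ω => A * U ω - B * D ω) atTop
      (𝓝 ((A ^ α * (1 + b) - B ^ α * (1 - b)) / (A ^ α * (1 + b) + B ^ α * (1 - b)))) := by
  have hX : Measurable fun ω => A * U ω - B * D ω := (hU.const_mul A).sub (hD.const_mul B)
  have hprob : IsProbabilityMeasure (P.map fun ω => A * U ω - B * D ω) :=
    Measure.isProbabilityMeasure_map hX.aemeasurable
  set μ := P.map fun ω => A * U ω - B * D ω with hμ
  have iU := isTailMoment_tail (P := P) hU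
  have iD := isTailMoment_tail (P := P) hD
  have hdiff := isDifferenceTails_mul (P := P) hU hD hind hU0 hD0 hA hB
  rw [← hμ] at hdiff
  obtain ⟨hκ, h1, h2, h3⟩ := balanced_rescale iU.tail_anti iD.tail_anti iU.tail_nonneg iD.tail_nonneg
    hA hB hrv ((isTailBalance_iff hrv.eventually_pos).1 hb)
  rw [show 1 - (1 + b) / 2 = (1 - b) / 2 by ring] at hκ h1 h3
  have h4 := hdiff.tendsto_div (.inl h2)
  obtain ⟨h5, h6⟩ := hdiff.balanced_iff.2 ⟨h2, h3⟩
  refine ⟨hκ, ?_, ?_⟩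
  · have h7 := h4.mul h1
    rw [one_mul] at h7
    refine h7.congr' ?_
    filter_upwards [h2.eventually_pos, eventually_ge_atTop 0] with t ht ht0
    rw [tail_eq_absTail hX, absTail_eq_add _ ht0, div_mul_div_cancel₀ ht.ne']
    rfl
  · have h7 := (h6.const_mul 2).sub_const 1
    have e : 2 * (A ^ α * ((1 + b) / 2) / (A ^ α * ((1 + b) / 2) + B ^ α * ((1 - b) / 2))) - 1
        = (A ^ α * (1 + b) - B ^ α * (1 - b)) / (A ^ α * (1 + b) + B ^ α * (1 - b)) := by
      have h8 : A ^ α * (1 + b) + B ^ α * (1 - b) ≠ 0 := by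
        intro h; apply hκ.ne'; linarith
      have h9 : A ^ α * ((1 + b) / 2) + B ^ α * ((1 - b) / 2)
          = (A ^ α * (1 + b) + B ^ α * (1 - b)) / 2 := by ring
      rw [h9]
      field_simp
      ring
    rw [e] at h7
    refine h7.congr' ?_
    filter_upwards [h5.eventually_pos] with t ht
    have e1 : P.real {ω | t < A * U ω - B * D ω} = upTail μ t := by
      rw [upTail, hμ, map_measureReal_apply hX measurableSet_Ioi]; rfl
    have e2 : P.real {ω | A * U ω - B * D ω < -t} = loTail μ t := by
      rw [loTail, hμ, map_measureReal_apply hX measurableSet_Iio]; rfl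
    rw [tailBalance, e1, e2]
    field_simp
    ring

end Combination

theorem isEquivalent_const_mul_of_tendsto_div {f g : ℝ → ℝ} {κ : ℝ} (hκ : κ ≠ 0)
    (hg : ∀ᶠ t in atTop, 0 < g t) (h : Tendsto (fun t => f t / g t) atTop (𝓝 κ)) :
    f ~[atTop] fun t => κ * g t := by
  refine (isEquivalent_iff_tendsto_one (hg.mono fun t ht => mul_ne_zero hκ ht.ne')).2 ?_
  have h1 := h.div_const κ
  rw [div_self hκ] at h1
  refine h1.congr fun t => ?_
  rw [Pi.div_apply, div_div, mul_comm]

theorem isEquivalent_of_tendsto_div_one {f g : ℝ → ℝ} (hg : ∀ᶠ t in atTop, 0 < g t)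
    (h : Tendsto (fun t => f t / g t) atTop (𝓝 1)) : f ~[atTop] g := by
  simpa using isEquivalent_const_mul_of_tendsto_div one_ne_zero hg h

/-- The characterisations of attraction to a stable law of index below two, with the resulting
asymptotics. -/
theorem attraction_below_two {Ω : Type*} [MeasurableSpace Ω] {P : Measure Ω}
    [IsProbabilityMeasure P] {U D : Ω → ℝ} (hU : Measurable U) (hD : Measurable D)
    (hind : IndepFun U D P) (hU0 : ∀ᵐ ω ∂P, 0 ≤ U ω) (hD0 : ∀ᵐ ω ∂P, 0 ≤ D ω)
    {m : ℝ} (hm : m ∈ Set.Ioo (-1 : ℝ) 1) {α : ℝ} (hα : α ∈ Set.Ioo (0 : ℝ) 2) :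
    [InDomainOfAttraction P (central m U D) α,
      InDomainOfAttraction P (fun ω => U ω - D ω) α,
      RegVar (sumTruncSecondMoment P U D) (2 - α) ∧ ∃ b, IsTailBalance P U D b,
      RegVar (sumTail P U D) (-α) ∧ ∃ b, IsTailBalance P U D b].TFAE ∧
    (InDomainOfAttraction P (central m U D) α →
      ∃ b, IsTailBalance P U D b ∧
        tail P (fun ω => U ω - D ω) ~[atTop] sumTail P U D ∧
        tail P (fun ω => U ω + D ω) ~[atTop] sumTail P U D ∧
        truncSecondMoment P (fun ω => U ω - D ω) ~[atTop] sumTruncSecondMoment P U D ∧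
        truncSecondMoment P (fun ω => U ω + D ω) ~[atTop] sumTruncSecondMoment P U D ∧
        tail P (central m U D) ~[atTop]
          (fun t => ((1 - m) ^ α * ((1 + b) / 2) + (1 + m) ^ α * ((1 - b) / 2)) *
            sumTail P U D t) ∧
        truncSecondMoment P (central m U D) ~[atTop]
          (fun t => ((1 - m) ^ α * ((1 + b) / 2) + (1 + m) ^ α * ((1 - b) / 2)) *
            sumTruncSecondMoment P U D t) ∧
        Tendsto (tailBalance P (central m U D)) atTop
          (𝓝 (((1 - m) ^ α * (1 + b) - (1 + m) ^ α * (1 - b)) /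
            ((1 - m) ^ α * (1 + b) + (1 + m) ^ α * (1 - b))))) := by
  obtain ⟨h0, h2⟩ := hα
  have hA : 0 < 1 - m := by linarith [hm.2]
  have hB : 0 < 1 + m := by linarith [hm.1]
  have iU := isTailMoment_tail (P := P) hU
  have iD := isTailMoment_tail (P := P) hD
  have iS : IsTailMoment (sumTail P U D) (sumTruncSecondMoment P U D) := iU.add iD
  have h14 : InDomainOfAttraction P (central m U D) α ↔ _ :=
    inDomainOfAttraction_sub_iff hU hD hind hU0 hD0 hA hB h0 h2
  have h24 := inDomainOfAttraction_sub_iff hU hD hind hU0 hD0 one_pos one_pos h0 h2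
  simp only [one_mul] at h24
  refine ⟨?_, fun h => ?_⟩
  · tfae_have 1 ↔ 4 := h14
    tfae_have 2 ↔ 4 := h24
    tfae_have 3 ↔ 4 := by rw [iS.regVar_iff h0 h2]
    tfae_finish
  obtain ⟨hrv, b, hb⟩ := h14.1 h
  obtain ⟨hκ, hc1, hc2⟩ := sub_tail_asymptotics hU hD hind hU0 hD0 hA hB hrv hb
  obtain ⟨-, hd1, -⟩ := sub_tail_asymptotics hU hD hind hU0 hD0 one_pos one_pos hrv hb
  simp only [one_mul, Real.one_rpow] at hd1
  rw [show (1 + b) / 2 + (1 - b) / 2 = 1 by ring] at hd1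
  have hs1 : Tendsto (fun t => tail P (fun ω => U ω + D ω) t / sumTail P U D t) atTop (𝓝 1) :=
    tendsto_tail_add_div hU hD hind hU0 hD0 hrv
  have hVpos : ∀ᶠ t in atTop, 0 < sumTruncSecondMoment P U D t :=
    ((iS.regVar_iff h0 h2).1 hrv).eventually_pos
  have hTpos := hrv.eventually_pos
  refine ⟨b, hb, isEquivalent_of_tendsto_div_one hTpos hd1,
    isEquivalent_of_tendsto_div_one hTpos hs1,
    isEquivalent_of_tendsto_div_one hVpos ?_, isEquivalent_of_tendsto_div_one hVpos ?_,
    isEquivalent_const_mul_of_tendsto_div hκ.ne' hTpos hc1,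
    isEquivalent_const_mul_of_tendsto_div hκ.ne' hVpos ?_, hc2⟩
  · exact iS.tendsto_moment_div (isTailMoment_tail (hU.sub hD)) h0 h2 hrv one_pos hd1
  · exact iS.tendsto_moment_div (isTailMoment_tail (hU.add hD)) h0 h2 hrv one_pos hs1
  · exact iS.tendsto_moment_div (isTailMoment_tail ((hU.const_mul _).sub (hD.const_mul _)))
      h0 h2 hrv hκ hc1

/-! ### Truncated variances -/

section Variance

variable {Ω : Type*} [MeasurableSpace Ω] {P : Measure Ω}

/-- The truncated mean `E[X 1_{|X| ≤ t}]`. -/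
noncomputable def truncMean (P : Measure Ω) (X : Ω → ℝ) (t : ℝ) : ℝ :=
  ∫ ω, {ω | |X ω| ≤ t}.indicator X ω ∂P

theorem measurableSet_abs_le_const {X : Ω → ℝ} (hX : Measurable X) (t : ℝ) :
    MeasurableSet {ω | |X ω| ≤ t} := measurableSet_le (by fun_prop) (by fun_prop)

theorem abs_indicator_abs_le {Ω : Type*} (X : Ω → ℝ) (t : ℝ) (ω : Ω) :
    |{ω | |X ω| ≤ t}.indicator X ω| ≤ |t| := by
  by_cases h : |X ω| ≤ t
  · rw [Set.indicator_of_mem (by exact h)]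
    exact h.trans (le_abs_self t)
  · rw [Set.indicator_of_notMem (by exact h), abs_zero]
    exact abs_nonneg t

theorem memLp_truncation [IsFiniteMeasure P] {X : Ω → ℝ} (hX : Measurable X) (t : ℝ) :
    MemLp ({ω | |X ω| ≤ t}.indicator X) 2 P :=
  MemLp.of_bound (hX.indicator (measurableSet_abs_le_const hX t)).aestronglyMeasurable |t|
    (.of_forall fun ω => abs_indicator_abs_le X t ω)

theorem indicator_pow_two {Ω : Type*} (X : Ω → ℝ) (s : Set Ω) (ω : Ω) :
    s.indicator X ω ^ 2 = s.indicator (fun ω => X ω ^ 2) ω := by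
  by_cases h : ω ∈ s <;> simp [h]

theorem truncVariance_eq [IsProbabilityMeasure P] {X : Ω → ℝ} (hX : Measurable X) (t : ℝ) :
    truncVariance P X t = truncSecondMoment P X t - truncMean P X t ^ 2 := by
  rw [truncVariance, variance_eq_sub (memLp_truncation hX t), truncSecondMoment, truncMean]
  congr 1
  refine integral_congr_ae (.of_forall fun ω => ?_)
  exact indicator_pow_two X _ ω

theorem truncMean_sq_le [IsProbabilityMeasure P] {X : Ω → ℝ} (hX : Measurable X) (t : ℝ) :
    truncMean P X t ^ 2 ≤ truncSecondMoment P X t := by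
  have h1 := truncVariance_eq (P := P) hX t
  have h2 : 0 ≤ truncVariance P X t := variance_nonneg _ _
  linarith

theorem integrable_sq_map_iff {X : Ω → ℝ} (hX : Measurable X) :
    Integrable (fun x : ℝ => x ^ 2) (P.map X) ↔ MemLp X 2 P := by
  rw [memLp_two_iff_integrable_sq hX.aestronglyMeasurable,
    integrable_map_measure (by fun_prop) hX.aemeasurable]
  rfl

theorem tendsto_truncSecondMoment_atTop [IsProbabilityMeasure P] {X : Ω → ℝ} (hX : Measurable X)
    (h : ¬ MemLp X 2 P) : Tendsto (truncSecondMoment P X) atTop atTop := by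
  have := Measure.isProbabilityMeasure_map (μ := P) hX.aemeasurable
  rw [truncSecondMoment_eq_lawMoment hX]
  exact tendsto_lawMoment_atTop _ (mt (integrable_sq_map_iff hX).1 h)

theorem tendsto_truncMean_sq_div_self [IsProbabilityMeasure P] {X : Ω → ℝ} (hX : Measurable X)
    (h : ¬ MemLp X 2 P) :
    Tendsto (fun t => truncMean P X t ^ 2 / truncSecondMoment P X t) atTop (𝓝 0) := by
  have hprob := Measure.isProbabilityMeasure_map (μ := P) hX.aemeasurable
  set f : ℝ → ℝ → ℝ := fun t x => {x : ℝ | |x| ≤ t}.indicator (fun x => |x|) x with hf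
  have hf0 : ∀ t x, 0 ≤ f t x := fun t x => Set.indicator_nonneg (fun x _ => abs_nonneg x) x
  have hsq : ∀ t x, f t x ^ 2 = {x : ℝ | |x| ≤ t}.indicator (fun x => x ^ 2) x := fun t x => by
    simp only [hf]
    rw [indicator_pow_two]
    simp only [sq_abs]
  have hint : ∀ t, Integrable (f t) (P.map X) := fun t => by
    have := (memLp_truncation (P := P.map X) measurable_id t).integrable one_le_two
    refine this.abs.congr (.of_forall fun x => ?_)
    by_cases hx : |x| ≤ t <;> simp [hf, hx]
  have hint2 : ∀ t, ∫ x, f t x ^ 2 ∂(P.map X) = lawMoment (P.map X) t := fun t => by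
    simp_rw [hsq]
    rw [integral_indicator (measurableSet_abs_le t), lawMoment]
  have key := tendsto_sq_integral_div (P.map X) (f := f) hf0
    (fun t x => Set.indicator_le_self' (fun _ _ => abs_nonneg _) x) hint
    (fun t => by
      simp_rw [hsq]
      exact (integrable_indicator_iff (measurableSet_abs_le t)).2 (integrableOn_sq_abs_le _ t))
    (by
      simp_rw [hint2]
      exact tendsto_lawMoment_atTop _ (mt (integrable_sq_map_iff hX).1 h))
  simp_rw [hint2, ← truncSecondMoment_eq_lawMoment hX] at key
  refine squeeze_zero (fun t => div_nonneg (sq_nonneg _) ((isTailMoment_tail hX).moment_nonneg t))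
    (fun t => ?_) key
  refine div_le_div_of_nonneg_right ?_ ((isTailMoment_tail hX).moment_nonneg t)
  rw [← sq_abs]
  refine pow_le_pow_left₀ (abs_nonneg _) ?_ 2
  rw [truncMean, integral_map hX.aemeasurable (hint t).aestronglyMeasurable]
  refine abs_integral_le_integral_abs.trans (le_of_eq ?_)
  refine integral_congr_ae (.of_forall fun ω => ?_)
  by_cases hx : |X ω| ≤ t <;> simp [hf, hx]

/-- The squared truncated mean is negligible with respect to any diverging upper bound of the
truncated second moment. -/
theorem tendsto_truncMean_sq_div [IsProbabilityMeasure P] {X : Ω → ℝ} (hX : Measurable X)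
    {R : ℝ → ℝ} (hR : Tendsto R atTop atTop) (hle : ∀ t, truncSecondMoment P X t ≤ R t) :
    Tendsto (fun t => truncMean P X t ^ 2 / R t) atTop (𝓝 0) := by
  by_cases h : MemLp X 2 P
  · have hint : Integrable (fun ω => X ω ^ 2) P :=
      (memLp_two_iff_integrable_sq hX.aestronglyMeasurable).1 h
    have hb : ∀ t, truncMean P X t ^ 2 ≤ ∫ ω, X ω ^ 2 ∂P := fun t => by
      refine (truncMean_sq_le hX t).trans ?_
      rw [truncSecondMoment]
      exact integral_mono (hint.indicator (measurableSet_abs_le_const hX t)) hint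
        fun ω => Set.indicator_le_self' (fun _ _ => sq_nonneg _) ω
    refine squeeze_zero' ?_ ?_ (tendsto_const_nhds (x := ∫ ω, X ω ^ 2 ∂P).div_atTop hR)
    · filter_upwards [hR.eventually_ge_atTop 0] with t ht using by positivity
    · filter_upwards [hR.eventually_ge_atTop 0] with t ht
      exact div_le_div_of_nonneg_right (hb t) ht
  · refine squeeze_zero' ?_ ?_ (tendsto_truncMean_sq_div_self hX h)
    · filter_upwards [hR.eventually_ge_atTop 0] with t ht using by positivity
    · filter_upwards [(tendsto_truncSecondMoment_atTop hX h).eventually_gt_atTop 0] with t ht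
      exact div_le_div_of_nonneg_left (sq_nonneg _) ht (hle t)

variable [IsProbabilityMeasure P] {U D : Ω → ℝ}

/-- The second moment of the difference of the two variables on the event that both are at most `t`
in absolute value. -/
theorem integral_sub_sq_truncated (hU : Measurable U) (hD : Measurable D) (hind : IndepFun U D P)
    (t : ℝ) : ∫ ω, ({ω | |U ω| ≤ t} ∩ {ω | |D ω| ≤ t}).indicator (fun ω => (U ω - D ω) ^ 2) ω ∂P
      = truncSecondMoment P U t * (1 - tail P D t) + truncSecondMoment P D t * (1 - tail P U t)
        - 2 * (truncMean P U t * truncMean P D t) := by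
  set I : Set ℝ := {x | |x| ≤ t} with hI
  have hIm : MeasurableSet I := measurableSet_abs_le t
  set i : ℝ → ℝ := I.indicator fun _ => 1 with hi
  set l : ℝ → ℝ := I.indicator id with hl
  set q : ℝ → ℝ := I.indicator fun x => x ^ 2 with hq
  have mi : Measurable i := measurable_const.indicator hIm
  have ml : Measurable l := measurable_id.indicator hIm
  have mq : Measurable q := (measurable_id.pow_const 2).indicator hIm
  have bi : ∀ x, ‖i x‖ ≤ 1 := fun x => by
    by_cases hx : x ∈ I <;> simp [hi, hx]
  have bl : ∀ x, ‖l x‖ ≤ |t| := fun x => abs_indicator_abs_le id t x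
  have bq : ∀ x, ‖q x‖ ≤ |t| ^ 2 := fun x => by
    have h1 : q x = l x ^ 2 := (indicator_pow_two id I x).symm
    rw [h1, norm_pow]
    exact pow_le_pow_left₀ (norm_nonneg _) (bl x) 2
  have hprod : ∀ {f g : ℝ → ℝ} {b c : ℝ}, Measurable f → Measurable g → (∀ x, ‖f x‖ ≤ b) →
      (∀ x, ‖g x‖ ≤ c) → Integrable (fun ω => f (U ω) * g (D ω)) P ∧
      ∫ ω, f (U ω) * g (D ω) ∂P = (∫ ω, f (U ω) ∂P) * ∫ ω, g (D ω) ∂P := by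
    intro f g b c hf hg hb hc
    refine ⟨(integrable_const (b * c)).mono' (by fun_prop) (.of_forall fun ω => ?_),
      hind.integral_fun_comp_mul_comp hU.aemeasurable hD.aemeasurable hf.aestronglyMeasurable
        hg.aestronglyMeasurable⟩
    rw [norm_mul]
    exact mul_le_mul (hb _) (hc _) (norm_nonneg _) ((norm_nonneg _).trans (hb 0))
  obtain ⟨i1, e1⟩ := hprod mq mi bq bi
  obtain ⟨i2, e2⟩ := hprod mi mq bi bq
  obtain ⟨i3, e3⟩ := hprod ml ml bl bl
  have hpt : ∀ ω, ({ω | |U ω| ≤ t} ∩ {ω | |D ω| ≤ t}).indicator (fun ω => (U ω - D ω) ^ 2) ω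
      = q (U ω) * i (D ω) + i (U ω) * q (D ω) - 2 * (l (U ω) * l (D ω)) := by
    intro ω
    have mem : ∀ x : ℝ, x ∈ I ↔ |x| ≤ t := fun x => Iff.rfl
    by_cases h1 : |U ω| ≤ t <;> by_cases h2 : |D ω| ≤ t <;>
      simp [Set.indicator, hi, hl, hq, mem, h1, h2]
    ring
  simp_rw [hpt]
  have E1 := integral_sub (i1.add i2) (i3.const_mul 2)
  have E2 := integral_add i1 i2
  simp only [Pi.add_apply] at E1
  rw [E1, E2, integral_const_mul, e1, e2, e3]
  have hsec : ∀ X : Ω → ℝ, ∫ ω, q (X ω) ∂P = truncSecondMoment P X t := fun X => rfl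
  have hmean : ∀ X : Ω → ℝ, ∫ ω, l (X ω) ∂P = truncMean P X t := fun X => rfl
  have hone : ∀ X : Ω → ℝ, Measurable X → ∫ ω, i (X ω) ∂P = 1 - tail P X t := fun X hX => by
    have h1 : ∀ ω, i (X ω) = {ω | |X ω| ≤ t}.indicator (fun _ => (1 : ℝ)) ω := fun ω => rfl
    simp_rw [h1]
    rw [integral_indicator (measurableSet_abs_le_const hX t), setIntegral_one_eq_measureReal, tail,
      ← probReal_compl_eq_one_sub (measurableSet_lt (by fun_prop) (by fun_prop))]
    congr 1; ext ω; simp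
  rw [hsec, hsec, hmean, hmean, hone U hU, hone D hD]
  ring

/-- For nonnegative variables, truncating the difference and truncating both variables differ only
where one of the variables exceeds `t`, and there the truncated square is at most `t²`. -/
theorem abs_truncSecondMoment_sub_le (hU : Measurable U) (hD : Measurable D)
    (hU0 : ∀ᵐ ω ∂P, 0 ≤ U ω) (hD0 : ∀ᵐ ω ∂P, 0 ≤ D ω) (t : ℝ) :
    |truncSecondMoment P (fun ω => U ω - D ω) t
      - ∫ ω, ({ω | |U ω| ≤ t} ∩ {ω | |D ω| ≤ t}).indicator (fun ω => (U ω - D ω) ^ 2) ω ∂P|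
      ≤ t ^ 2 * (tail P U t + tail P D t) := by
  have hX : Measurable fun ω => U ω - D ω := hU.sub hD
  have hUs : MeasurableSet {ω | t < |U ω|} := measurableSet_lt (by fun_prop) (by fun_prop)
  have hDs : MeasurableSet {ω | t < |D ω|} := measurableSet_lt (by fun_prop) (by fun_prop)
  have hsq : Integrable ({ω | |U ω - D ω| ≤ t}.indicator fun ω => (U ω - D ω) ^ 2) P := by
    refine (memLp_truncation (P := P) hX t).integrable_sq.congr (.of_forall fun ω => ?_)
    exact indicator_pow_two _ _ ω
  have hpt : ∀ᵐ ω ∂P, 0 ≤ {ω | |U ω - D ω| ≤ t}.indicator (fun ω => (U ω - D ω) ^ 2) ω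
      - ({ω | |U ω| ≤ t} ∩ {ω | |D ω| ≤ t}).indicator (fun ω => (U ω - D ω) ^ 2) ω ∧
      {ω | |U ω - D ω| ≤ t}.indicator (fun ω => (U ω - D ω) ^ 2) ω
      - ({ω | |U ω| ≤ t} ∩ {ω | |D ω| ≤ t}).indicator (fun ω => (U ω - D ω) ^ 2) ω
      ≤ t ^ 2 * {ω | t < |U ω|}.indicator (fun _ => (1 : ℝ)) ω
        + t ^ 2 * {ω | t < |D ω|}.indicator (fun _ => (1 : ℝ)) ω := by
    filter_upwards [hU0, hD0] with ω h1 h2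
    have h3 : |U ω| = U ω := abs_of_nonneg h1
    have h4 : |D ω| = D ω := abs_of_nonneg h2
    have n1 : 0 ≤ {ω | t < |U ω|}.indicator (fun _ => (1 : ℝ)) ω :=
      Set.indicator_nonneg (fun _ _ => zero_le_one) ω
    have n2 : 0 ≤ {ω | t < |D ω|}.indicator (fun _ => (1 : ℝ)) ω :=
      Set.indicator_nonneg (fun _ _ => zero_le_one) ω
    by_cases hin : |U ω| ≤ t ∧ |D ω| ≤ t
    · have hx : |U ω - D ω| ≤ t := by
        rw [abs_le]
        constructor <;> linarith [hin.1, hin.2]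
      rw [Set.indicator_of_mem (by exact hx), Set.indicator_of_mem (by exact hin), sub_self]
      exact ⟨le_rfl, by positivity⟩
    · rw [Set.indicator_of_notMem (s := {ω | |U ω| ≤ t} ∩ {ω | |D ω| ≤ t}) (by exact hin), sub_zero]
      refine ⟨Set.indicator_nonneg (fun _ _ => sq_nonneg _) ω, ?_⟩
      have h5 : {ω | |U ω - D ω| ≤ t}.indicator (fun ω => (U ω - D ω) ^ 2) ω ≤ t ^ 2 := by
        by_cases hx : |U ω - D ω| ≤ t
        · rw [Set.indicator_of_mem (by exact hx), ← sq_abs]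
          exact pow_le_pow_left₀ (abs_nonneg _) hx 2
        · rw [Set.indicator_of_notMem (by exact hx)]
          exact sq_nonneg t
      refine h5.trans ?_
      by_cases hu : |U ω| ≤ t
      · have hd : t < |D ω| := not_le.1 fun hd => hin ⟨hu, hd⟩
        rw [Set.indicator_of_mem (s := {ω | t < |D ω|}) (by exact hd), mul_one]
        nlinarith [sq_nonneg t]
      · rw [Set.indicator_of_mem (s := {ω | t < |U ω|}) (by exact not_le.1 hu), mul_one]
        nlinarith [sq_nonneg t]
  have hIX : Integrable (({ω | |U ω| ≤ t} ∩ {ω | |D ω| ≤ t}).indicator fun ω => (U ω - D ω) ^ 2) P := by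
    have h1 := ((integrable_const (1 : ℝ)).indicator hUs).const_mul (t ^ 2) |>.add
      (((integrable_const (1 : ℝ)).indicator hDs).const_mul (t ^ 2)) (μ := P)
    refine (hsq.norm.add h1.norm).mono' ((Measurable.indicator (by fun_prop)
      ((measurableSet_abs_le_const hU t).inter
        (measurableSet_abs_le_const hD t))).aestronglyMeasurable) ?_
    filter_upwards [hpt] with ω h
    rw [Real.norm_of_nonneg (Set.indicator_nonneg (fun _ _ => sq_nonneg _) ω)]
    simp only [Pi.add_apply, Real.norm_eq_abs]
    refine le_trans ?_ (le_add_of_nonneg_right (abs_nonneg _))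
    refine le_trans ?_ (le_abs_self _)
    linarith [h.1]
  rw [truncSecondMoment, ← integral_sub hsq hIX, abs_of_nonneg (integral_nonneg_of_ae (by
    filter_upwards [hpt] with ω h using h.1))]
  have h1 := ((integrable_const (1 : ℝ)).indicator hUs).const_mul (t ^ 2) (μ := P)
  have h2 := ((integrable_const (1 : ℝ)).indicator hDs).const_mul (t ^ 2) (μ := P)
  have E := integral_add h1 h2
  refine (integral_mono_ae (hsq.sub hIX) (h1.add h2) (by
    filter_upwards [hpt] with ω h using h.2)).trans (le_of_eq ?_)
  refine E.trans ?_
  rw [integral_const_mul, integral_const_mul, integral_indicator hUs, integral_indicator hDs,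
    setIntegral_one_eq_measureReal, setIntegral_one_eq_measureReal, mul_add]
  rfl

/-- Truncated second moments of the difference of two independent nonnegative variables, when the
tail of the difference is negligible. Both are compared with the second moment `W` of the
difference on the event that both variables are at most `t`. -/
theorem tendsto_truncSecondMoment_sub_div (hU : Measurable U) (hD : Measurable D)
    (hind : IndepFun U D P) (hU0 : ∀ᵐ ω ∂P, 0 ≤ U ω) (hD0 : ∀ᵐ ω ∂P, 0 ≤ D ω)
    (hXL : ¬ MemLp (fun ω => U ω - D ω) 2 P)
    (hT : Tendsto (fun t => t ^ 2 * tail P (fun ω => U ω - D ω) t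
      / truncSecondMoment P (fun ω => U ω - D ω) t) atTop (𝓝 0)) :
    Tendsto (sumTruncSecondMoment P U D) atTop atTop ∧
    Tendsto (fun t => truncSecondMoment P (fun ω => U ω - D ω) t / sumTruncSecondMoment P U D t)
      atTop (𝓝 1) := by
  set X : Ω → ℝ := fun ω => U ω - D ω with hXdef
  have hX : Measurable X := hU.sub hD
  have iU := isTailMoment_tail (P := P) hU
  have iD := isTailMoment_tail (P := P) hD
  have iX := isTailMoment_tail (P := P) hX
  have hdiff := isDifferenceTails (P := P) hU hD hind hU0 hD0
  set V := truncSecondMoment P X with hV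
  set R := sumTruncSecondMoment P U D with hRdef
  have hR : Tendsto R atTop atTop := by
    by_cases h : MemLp U 2 P
    · have h' : ¬ MemLp D 2 P := fun h' => hXL (h.sub h')
      exact tendsto_atTop_mono (fun t => le_add_of_nonneg_left (iU.moment_nonneg t))
        (tendsto_truncSecondMoment_atTop hD h')
    · exact tendsto_atTop_mono (fun t => le_add_of_nonneg_right (iD.moment_nonneg t))
        (tendsto_truncSecondMoment_atTop hU h)
  refine ⟨hR, ?_⟩
  have hVtop := tendsto_truncSecondMoment_atTop hX hXL
  set W : ℝ → ℝ := fun t => ∫ ω, ({ω | |U ω| ≤ t} ∩ {ω | |D ω| ≤ t}).indicator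
    (fun ω => (U ω - D ω) ^ 2) ω ∂P with hW
  -- the tails of `U` and `D` are bounded by a shifted tail of `U - D`, hence also negligible
  have hSV : Tendsto (fun t => t ^ 2 * (tail P U t + tail P D t) / V t) atTop (𝓝 0) := by
    obtain ⟨s, hs0, e, -, he, hb⟩ := hdiff.exists_shift (show (0 : ℝ) < 1 by norm_num)
    have hst : Tendsto (fun t : ℝ => t - s) atTop atTop := tendsto_atTop_add_const_right _ (-s) tendsto_id
    have h1 := (hT.comp hst).const_mul (4 / e)
    rw [mul_zero] at h1
    refine squeeze_zero' ?_ ?_ h1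
    · filter_upwards [hVtop.eventually_gt_atTop 0] with t ht
      have := iU.tail_nonneg t
      have := iD.tail_nonneg t
      positivity
    · filter_upwards [(hVtop.comp hst).eventually_gt_atTop 0, eventually_ge_atTop (2 * s),
        eventually_ge_atTop s] with t ht hts hts'
      have h2 := hb (t - s) (by linarith)
      rw [sub_add_cancel, ← absTail_eq_add _ (by linarith), ← tail_eq_absTail hX] at h2
      have h3 : V (t - s) ≤ V t := iX.moment_mono (by linarith)
      simp only [Function.comp] at ht ⊢
      have h4 : tail P U t + tail P D t ≤ tail P X (t - s) / e := by rwa [le_div_iff₀ he]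
      have h5 : t ^ 2 ≤ 4 * (t - s) ^ 2 := by nlinarith
      have h6 := iX.tail_nonneg (t - s)
      have h7 : 0 ≤ tail P U t + tail P D t := add_nonneg (iU.tail_nonneg t) (iD.tail_nonneg t)
      calc t ^ 2 * (tail P U t + tail P D t) / V t
          ≤ t ^ 2 * (tail P U t + tail P D t) / V (t - s) :=
            div_le_div_of_nonneg_left (by positivity) ht h3
        _ ≤ (4 * (t - s) ^ 2) * (tail P X (t - s) / e) / V (t - s) := by gcongr
        _ = 4 / e * ((t - s) ^ 2 * tail P X (t - s) / V (t - s)) := by ring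
  have hWV : Tendsto (fun t => W t / V t) atTop (𝓝 1) := by
    have h1 : Tendsto (fun t => (V t - W t) / V t) atTop (𝓝 0) := by
      refine squeeze_zero_norm' ?_ hSV
      filter_upwards [hVtop.eventually_gt_atTop 0] with t ht
      rw [norm_div, Real.norm_of_nonneg ht.le]
      exact div_le_div_of_nonneg_right (abs_truncSecondMoment_sub_le hU hD hU0 hD0 t) ht.le
    have h2 := h1.const_sub 1
    rw [sub_zero] at h2
    refine h2.congr' ?_
    filter_upwards [hVtop.eventually_gt_atTop 0] with t ht
    have ht : V t ≠ 0 := ht.ne'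
    field_simp
    ring
  have hmU := tendsto_truncMean_sq_div hU hR fun t => le_add_of_nonneg_right (iD.moment_nonneg t)
  have hmD := tendsto_truncMean_sq_div hD hR fun t => le_add_of_nonneg_left (iU.moment_nonneg t)
  have hWR : Tendsto (fun t => W t / R t) atTop (𝓝 1) := by
    have h1 : Tendsto (fun t => (R t - W t) / R t) atTop (𝓝 0) := by
      have h2 := (iU.tail_lim.add iD.tail_lim).add (hmU.add hmD)
      simp only [add_zero] at h2
      refine squeeze_zero_norm' ?_ h2
      filter_upwards [hR.eventually_gt_atTop 0] with t ht
      have e : R t - W t = truncSecondMoment P U t * tail P D t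
          + truncSecondMoment P D t * tail P U t + 2 * (truncMean P U t * truncMean P D t) := by
        simp only [hW, integral_sub_sq_truncated hU hD hind, hRdef, sumTruncSecondMoment]
        ring
      have hRe : R t = truncSecondMoment P U t + truncSecondMoment P D t := rfl
      have a1 := iU.moment_nonneg t
      have a2 := iD.moment_nonneg t
      have a3 := iU.tail_nonneg t
      have a4 := iD.tail_nonneg t
      rw [norm_div, Real.norm_of_nonneg ht.le, div_le_iff₀ ht, add_mul, add_mul, add_mul,
        div_mul_cancel₀ _ ht.ne', div_mul_cancel₀ _ ht.ne', e, Real.norm_eq_abs, hRe, abs_le]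
      constructor <;>
      nlinarith [sq_nonneg (truncMean P U t - truncMean P D t),
        sq_nonneg (truncMean P U t + truncMean P D t), mul_nonneg a1 a3, mul_nonneg a1 a4,
        mul_nonneg a2 a3, mul_nonneg a2 a4]
    have h2 := h1.const_sub 1
    rw [sub_zero] at h2
    refine h2.congr' ?_
    filter_upwards [hR.eventually_gt_atTop 0] with t ht
    field_simp
    ring
  have h3 := hWR.div hWV one_ne_zero
  rw [div_one] at h3
  refine h3.congr' ?_
  filter_upwards [hWV.eventually_const_lt one_pos, hR.eventually_gt_atTop 0,
    hVtop.eventually_gt_atTop 0] with t h4 h5 h6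
  have h7 : W t ≠ 0 := by
    intro h; rw [h, zero_div] at h4; exact lt_irrefl _ h4
  simp only [Pi.div_apply]
  field_simp

/-- Two independent variables with a square integrable difference are square integrable: restrict
to an event of positive probability on which the other variable is bounded. -/
theorem memLp_of_memLp_sub (hU : Measurable U) (hD : Measurable D) (hind : IndepFun U D P)
    (hX : MemLp (fun ω => U ω - D ω) 2 P) : MemLp U 2 P := by
  have hprob : IsProbabilityMeasure (P.map D) := Measure.isProbabilityMeasure_map hD.aemeasurable
  obtain ⟨K, hK⟩ := (isTailMoment_tail (P := P) hD).tail_lim.eventually_lt_const one_pos |>.exists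
  set i : ℝ → ℝ := {x : ℝ | |x| ≤ K}.indicator fun _ => 1 with hi
  have mi : Measurable i := measurable_const.indicator (measurableSet_abs_le K)
  have hind2 : IndepFun (fun ω => U ω ^ 2) (fun ω => i (D ω)) P :=
    hind.comp (φ := fun x => x ^ 2) (ψ := i) (by fun_prop) mi
  have hprod : Integrable ((fun ω => U ω ^ 2) * fun ω => i (D ω)) P := by
    have h1 := ((memLp_two_iff_integrable_sq hX.aestronglyMeasurable).1 hX).const_mul 2
    refine (h1.add (integrable_const (2 * K ^ 2))).mono' (by fun_prop) (.of_forall fun ω => ?_)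
    simp only [Pi.mul_apply, Pi.add_apply, hi]
    by_cases h : |D ω| ≤ K
    · rw [Set.indicator_of_mem (by exact h), mul_one, Real.norm_of_nonneg (sq_nonneg _)]
      have h2 : D ω ^ 2 ≤ K ^ 2 := by
        rw [← sq_abs]; exact pow_le_pow_left₀ (abs_nonneg _) h 2
      nlinarith [sq_nonneg (U ω - 2 * D ω)]
    · rw [Set.indicator_of_notMem (by exact h), mul_zero, norm_zero]
      positivity
  rw [memLp_two_iff_integrable_sq hU.aestronglyMeasurable]
  refine hind2.integrable_left_of_integrable_op (fun x y => x * y) 1 one_ne_zero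
    (fun x y => by simp [enorm_mul]) hprod (by fun_prop) (mi.comp hD).aestronglyMeasurable ?_
  intro h0
  have h1 : tail P D K = 1 := by
    rw [tail, ← probReal_univ (μ := P)]
    refine measureReal_congr ?_
    filter_upwards [h0] with ω h
    refine propext ⟨fun _ => trivial, fun _ => ?_⟩
    by_contra hcon
    have h2 : |D ω| ≤ K := not_lt.1 hcon
    rw [hi] at h
    rw [Set.indicator_of_mem (by exact h2)] at h
    exact one_ne_zero h
  linarith

end Variance

/-! ### Attraction to the normal law -/

section NormalLaw

variable {Ω : Type*} [MeasurableSpace Ω] {P : Measure Ω}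

theorem setOf_abs_const_mul_le {Ω : Type*} {A : ℝ} (hA : 0 < A) (X : Ω → ℝ) (t : ℝ) :
    {ω | |A * X ω| ≤ t} = {ω | |X ω| ≤ t / A} := by
  ext ω
  simp only [Set.mem_ofPred_eq]
  rw [abs_mul, abs_of_pos hA, le_div_iff₀ hA, mul_comm]

theorem truncSecondMoment_const_mul {A : ℝ} (hA : 0 < A) (X : Ω → ℝ) (t : ℝ) :
    truncSecondMoment P (fun ω => A * X ω) t = A ^ 2 * truncSecondMoment P X (t / A) := by
  rw [truncSecondMoment, truncSecondMoment, setOf_abs_const_mul_le hA, ← integral_const_mul]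
  congr 1
  ext ω
  by_cases h : |X ω| ≤ t / A
  · rw [Set.indicator_of_mem (by exact h), Set.indicator_of_mem (by exact h), mul_pow]
  · rw [Set.indicator_of_notMem (by exact h), Set.indicator_of_notMem (by exact h), mul_zero]

theorem truncVariance_const_mul {A : ℝ} (hA : 0 < A) (X : Ω → ℝ) (t : ℝ) :
    truncVariance P (fun ω => A * X ω) t = A ^ 2 * truncVariance P X (t / A) := by
  rw [truncVariance, truncVariance, setOf_abs_const_mul_le hA, ← variance_const_mul]
  congr 1
  ext ω
  by_cases h : |X ω| ≤ t / A
  · rw [Set.indicator_of_mem (by exact h), Set.indicator_of_mem (by exact h)]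
  · rw [Set.indicator_of_notMem (by exact h), Set.indicator_of_notMem (by exact h), mul_zero]

theorem tendsto_integral_indicator_abs_le {X f : Ω → ℝ} (hX : Measurable X) (hf : Integrable f P) :
    Tendsto (fun t => ∫ ω, {ω | |X ω| ≤ t}.indicator f ω ∂P) atTop (𝓝 (∫ ω, f ω ∂P)) := by
  refine tendsto_integral_filter_of_dominated_convergence (fun ω => ‖f ω‖)
    (.of_forall fun t => hf.aestronglyMeasurable.indicator (measurableSet_abs_le_const hX t))
    (.of_forall fun t => .of_forall fun ω => norm_indicator_le_norm_self _ _) hf.norm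
    (.of_forall fun ω => ?_)
  refine tendsto_const_nhds.congr' ?_
  filter_upwards [eventually_ge_atTop |X ω|] with t ht
  rw [Set.indicator_of_mem (by exact ht)]

theorem tendsto_truncSecondMoment {X : Ω → ℝ} (hX : Measurable X) (h : MemLp X 2 P) :
    Tendsto (truncSecondMoment P X) atTop (𝓝 (∫ ω, X ω ^ 2 ∂P)) :=
  tendsto_integral_indicator_abs_le hX ((memLp_two_iff_integrable_sq hX.aestronglyMeasurable).1 h)

theorem tendsto_truncVariance [IsProbabilityMeasure P] {X : Ω → ℝ} (hX : Measurable X)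
    (h : MemLp X 2 P) : Tendsto (truncVariance P X) atTop (𝓝 (variance X P)) := by
  have h1 := (tendsto_truncSecondMoment hX h).sub
    ((tendsto_integral_indicator_abs_le hX (h.integrable one_le_two)).pow 2)
  rw [variance_eq_sub h]
  exact h1.congr fun t => (truncVariance_eq hX t).symm

theorem tendsto_truncVariance_div [IsProbabilityMeasure P] {X : Ω → ℝ} (hX : Measurable X)
    (h : ¬ MemLp X 2 P) :
    Tendsto (fun t => truncVariance P X t / truncSecondMoment P X t) atTop (𝓝 1) := by
  have h1 := (tendsto_truncMean_sq_div_self hX h).const_sub 1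
  rw [sub_zero] at h1
  refine h1.congr' ?_
  filter_upwards [(tendsto_truncSecondMoment_atTop hX h).eventually_gt_atTop 0] with t ht
  rw [truncVariance_eq hX, sub_div, div_self ht.ne']

theorem isEquivalent_of_tendsto_nhds {f g : ℝ → ℝ} {v : ℝ} (hv : v ≠ 0)
    (hf : Tendsto f atTop (𝓝 v)) (hg : Tendsto g atTop (𝓝 v)) : f ~[atTop] g :=
  ((isEquivalent_const_iff_tendsto hv).2 hf).trans ((isEquivalent_const_iff_tendsto hv).2 hg).symm

variable [IsProbabilityMeasure P]

/-- For integrable variables the mean drift is the quotient of expectations that centres the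
`central` variable. The lower bounds keep the denominator of this quotient positive. -/
theorem integral_central_eq_zero {U D : Ω → ℝ} {m : ℝ} (hU : MemLp U 2 P) (hD : MemLp D 2 P)
    (hU1 : ∀ᵐ ω ∂P, 1 ≤ U ω) (hD1 : ∀ᵐ ω ∂P, 1 ≤ D ω) (hdrift : IsMeanDrift P U D m) :
    ∫ ω, central m U D ω ∂P = 0 := by
  have iU := hU.integrable one_le_two
  have iD := hD.integrable one_le_two
  have pos : ∀ {X : Ω → ℝ}, Integrable X P → (∀ᵐ ω ∂P, 1 ≤ X ω) → 1 ≤ ∫ ω, X ω ∂P := by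
    intro X iX hX
    have := integral_mono_ae (integrable_const (1 : ℝ)) iX hX
    simpa using this
  have eU := pos iU hU1
  have eD := pos iD hD1
  rcases hdrift with h | ⟨-, -, h⟩ | h | h
  · exact absurd iU h.1
  · simp only [central]
    rw [integral_sub (iU.const_mul _) (iD.const_mul _), integral_const_mul, integral_const_mul, h]
    have : (∫ ω, U ω ∂P) + ∫ ω, D ω ∂P ≠ 0 := by positivity
    field_simp
    ring
  · exact absurd iU h.1
  · exact absurd iD h.2.1

/-- The variance asymptotics of the central variable in the domain of attraction of the normal law.
If the central variable is square integrable, all functions involved converge to its variance; the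
drift enters only here, through the vanishing of the mean. Otherwise the squared truncated means are
negligible. -/
theorem attraction_two {U D : Ω → ℝ} (hU : Measurable U) (hD : Measurable D)
    (hind : IndepFun U D P) (hU1 : ∀ᵐ ω ∂P, 1 ≤ U ω) (hD1 : ∀ᵐ ω ∂P, 1 ≤ D ω)
    {m : ℝ} (hdrift : IsMeanDrift P U D m) (hm : m ∈ Set.Ioo (-1 : ℝ) 1)
    (h : InDomainOfAttraction P (central m U D) 2) :
    truncVariance P (central m U D) ~[atTop] truncSecondMoment P (central m U D) ∧
    truncSecondMoment P (central m U D) ~[atTop] sigmaSq P m U D ∧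
    (¬ (MemLp U 2 P ∧ MemLp D 2 P) →
      truncSecondMoment P (central m U D) ~[atTop] sigmaSqRaw P m U D) := by
  have hA : 0 < 1 - m := by linarith [hm.2]
  have hB : 0 < 1 + m := by linarith [hm.1]
  set X := central m U D with hXdef
  set U' : Ω → ℝ := fun ω => (1 - m) * U ω with hU'def
  set D' : Ω → ℝ := fun ω => (1 + m) * D ω with hD'def
  have hU' : Measurable U' := hU.const_mul _
  have hD' : Measurable D' := hD.const_mul _
  have hX : Measurable X := hU'.sub hD'
  have hXe : X = fun ω => U' ω - D' ω := rfl
  have hind' : IndepFun U' D' P :=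
    hind.comp (φ := fun x => (1 - m) * x) (ψ := fun x => (1 + m) * x) (by fun_prop) (by fun_prop)
  have hU0 : ∀ᵐ ω ∂P, 0 ≤ U' ω := hU1.mono fun ω h => mul_nonneg hA.le (zero_le_one.trans h)
  have hD0 : ∀ᵐ ω ∂P, 0 ≤ D' ω := hD1.mono fun ω h => mul_nonneg hB.le (zero_le_one.trans h)
  have eR : sigmaSqRaw P m U D = sumTruncSecondMoment P U' D' := by
    ext t
    rw [sigmaSqRaw, sumTruncSecondMoment, truncSecondMoment_const_mul hA,
      truncSecondMoment_const_mul hB]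
  have eS : sigmaSq P m U D = fun t => truncVariance P U' t + truncVariance P D' t := by
    ext t
    rw [sigmaSq, truncVariance_const_mul hA, truncVariance_const_mul hB]
  have hprob := Measure.isProbabilityMeasure_map (μ := P) hX.aemeasurable
  obtain ⟨σ, β, δ, a, θ, hσ, -, ha, hconv⟩ := h.tendsto_charFun hX
  by_cases hXL : MemLp X 2 P
  -- finite variance: all the functions have the same positive limit
  · have LU' : MemLp U' 2 P := memLp_of_memLp_sub hU' hD' hind' hXL
    have LD' : MemLp D' 2 P := by
      refine memLp_of_memLp_sub hD' hU' hind'.symm ?_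
      refine hXL.neg.ae_eq (.of_forall fun ω => ?_)
      simp [hXe]
    have LU : MemLp U 2 P := by
      refine (LU'.const_mul (1 - m)⁻¹).ae_eq (.of_forall fun ω => ?_)
      simp [hU'def, hA.ne']
    have LD : MemLp D 2 P := by
      refine (LD'.const_mul (1 + m)⁻¹).ae_eq (.of_forall fun ω => ?_)
      simp [hD'def, hB.ne']
    have h0 : ∫ ω, X ω ∂P = 0 := integral_central_eq_zero LU LD hU1 hD1 hdrift
    have hv : variance X P = ∫ ω, X ω ^ 2 ∂P := by
      rw [variance_eq_sub hXL, h0]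
      simp
    have hs : variance X P = variance U' P + variance D' P := by
      rw [hXe, variance_fun_sub LU' LD', hind'.covariance_eq_zero LU' LD']
      ring
    have hne : variance X P ≠ 0 := by
      rw [hv]
      intro hz
      have hz' := (integral_eq_zero_iff_of_nonneg (fun ω => sq_nonneg (X ω))
        hXL.integrable_sq).1 hz
      refine not_ae_eq_const (c := 0) (ψ := stableExponent 2 σ β δ) ?_ hconv ?_
      · rw [re_stableExponent two_pos]
        have : 0 < σ * |(1 : ℝ)| := by simpa using hσ
        have := Real.rpow_pos_of_pos this 2
        linarith
      · rw [ae_map_iff hX.aemeasurable (by exact measurableSet_singleton 0)]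
        filter_upwards [hz'] with ω hω
        simpa using hω
    have t1 := tendsto_truncVariance hX hXL
    have t2 := tendsto_truncSecondMoment hX hXL
    rw [← hv] at t2
    have t3 := (tendsto_truncVariance hU' LU').add (tendsto_truncVariance hD' LD')
    rw [← hs] at t3
    refine ⟨isEquivalent_of_tendsto_nhds hne t1 t2, ?_, fun hcon => absurd ⟨LU, LD⟩ hcon⟩
    rw [eS]
    exact isEquivalent_of_tendsto_nhds hne t2 t3
  · have hT := tendsto_sq_mul_absTail_div hσ ha hconv (mt (integrable_sq_map_iff hX).1 hXL)
    rw [← tail_eq_absTail hX, ← truncSecondMoment_eq_lawMoment hX] at hT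
    obtain ⟨hR, hVR⟩ := tendsto_truncSecondMoment_sub_div hU' hD' hind' hU0 hD0 hXL hT
    have hVtop := tendsto_truncSecondMoment_atTop hX hXL
    have hraw : truncSecondMoment P X ~[atTop] sumTruncSecondMoment P U' D' :=
      isEquivalent_of_tendsto_div_one (hR.eventually_gt_atTop 0) hVR
    refine ⟨isEquivalent_of_tendsto_div_one (hVtop.eventually_gt_atTop 0)
      (tendsto_truncVariance_div hX hXL), ?_, fun _ => by rw [eR]; exact hraw⟩
    refine hraw.trans (IsEquivalent.symm ?_)
    refine isEquivalent_of_tendsto_div_one (hR.eventually_gt_atTop 0) ?_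
    have h1 := ((tendsto_truncMean_sq_div hU' hR fun t => le_add_of_nonneg_right
      ((isTailMoment_tail hD').moment_nonneg t)).add (tendsto_truncMean_sq_div hD' hR
      fun t => le_add_of_nonneg_left ((isTailMoment_tail hU').moment_nonneg t))).const_sub 1
    rw [add_zero, sub_zero] at h1
    refine h1.congr' ?_
    filter_upwards [hR.eventually_gt_atTop 0] with t ht
    simp only [eS]
    rw [truncVariance_eq hU', truncVariance_eq hD', eq_div_iff ht.ne', sub_mul, add_mul,
      div_mul_cancel₀ _ ht.ne', div_mul_cancel₀ _ ht.ne', one_mul, sumTruncSecondMoment]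
    ring

end NormalLaw

end PRW

/-- Equivalent formulations of the stability assumption on the rise length `τu` and the descent
length `τd`, when the mean drift `m` exists and is not extremal. -/
theorem lemma4 {Ω : Type*} [MeasurableSpace Ω] (P : Measure Ω) [IsProbabilityMeasure P]
    (τu τd : Ω → ℕ) (hu : Measurable τu) (hd : Measurable τd)
    (hu1 : ∀ᵐ ω ∂P, 1 ≤ τu ω) (hd1 : ∀ᵐ ω ∂P, 1 ≤ τd ω) (hind : IndepFun τu τd P)
    (U D : Ω → ℝ) (hU : U = fun ω => (τu ω : ℝ)) (hD : D = fun ω => (τd ω : ℝ))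
    (m : ℝ) (hdrift : PRW.IsMeanDrift P U D m) (hm : m ∈ Set.Ioo (-1 : ℝ) 1) :
    (∀ α ∈ Set.Ioo (0 : ℝ) 2,
      [PRW.InDomainOfAttraction P (PRW.central m U D) α,
        PRW.InDomainOfAttraction P (fun ω => U ω - D ω) α,
        PRW.RegVar (PRW.sumTruncSecondMoment P U D) (2 - α) ∧ ∃ b, PRW.IsTailBalance P U D b,
        PRW.RegVar (PRW.sumTail P U D) (-α) ∧ ∃ b, PRW.IsTailBalance P U D b].TFAE ∧
      (PRW.InDomainOfAttraction P (PRW.central m U D) α →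
        ∃ b, PRW.IsTailBalance P U D b ∧
          PRW.tail P (fun ω => U ω - D ω) ~[atTop] PRW.sumTail P U D ∧
          PRW.tail P (fun ω => U ω + D ω) ~[atTop] PRW.sumTail P U D ∧
          PRW.truncSecondMoment P (fun ω => U ω - D ω) ~[atTop] PRW.sumTruncSecondMoment P U D ∧
          PRW.truncSecondMoment P (fun ω => U ω + D ω) ~[atTop] PRW.sumTruncSecondMoment P U D ∧
          PRW.tail P (PRW.central m U D) ~[atTop]
            (fun t => ((1 - m) ^ α * ((1 + b) / 2) + (1 + m) ^ α * ((1 - b) / 2)) *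
              PRW.sumTail P U D t) ∧
          PRW.truncSecondMoment P (PRW.central m U D) ~[atTop]
            (fun t => ((1 - m) ^ α * ((1 + b) / 2) + (1 + m) ^ α * ((1 - b) / 2)) *
              PRW.sumTruncSecondMoment P U D t) ∧
          Tendsto (PRW.tailBalance P (PRW.central m U D)) atTop
            (𝓝 (((1 - m) ^ α * (1 + b) - (1 + m) ^ α * (1 - b)) /
              ((1 - m) ^ α * (1 + b) + (1 + m) ^ α * (1 - b)))))) ∧
    (PRW.InDomainOfAttraction P (PRW.central m U D) 2 →
      PRW.truncVariance P (PRW.central m U D) ~[atTop]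
        PRW.truncSecondMoment P (PRW.central m U D) ∧
      PRW.truncSecondMoment P (PRW.central m U D) ~[atTop] PRW.sigmaSq P m U D ∧
      (¬ (MemLp U 2 P ∧ MemLp D 2 P) →
        PRW.truncSecondMoment P (PRW.central m U D) ~[atTop] PRW.sigmaSqRaw P m U D)) := by
  subst hU hD
  have hU : Measurable fun ω => (τu ω : ℝ) := measurable_from_top.comp hu
  have hD : Measurable fun ω => (τd ω : ℝ) := measurable_from_top.comp hd
  have hind' : IndepFun (fun ω => (τu ω : ℝ)) (fun ω => (τd ω : ℝ)) P :=
    hind.comp (φ := fun n : ℕ => (n : ℝ)) (ψ := fun n : ℕ => (n : ℝ)) measurable_from_top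
      measurable_from_top
  exact ⟨fun α hα => PRW.attraction_below_two hU hD hind' (.of_forall fun _ => Nat.cast_nonneg _)
      (.of_forall fun _ => Nat.cast_nonneg _) hm hα,
    PRW.attraction_two hU hD hind' (hu1.mono fun _ h => by exact_mod_cast h)
      (hd1.mono fun _ h => by exact_mod_cast h) hdrift hm⟩
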